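/- Let $\mathbf k$ be a commutative $\mathbb Q$-algebra and let $A$ be a unital associative $\mathbf k$-algebra for which $\mathbf k\to A$ is a $\mathbf k$-linearly split injection; put $\bar A=A/\mathbf k$. Let $\Omega=\Omega A$ be the differential envelope of $A$ (the unital graded algebra generated by the unital algebra $A$ in degree $0$ and by $da$, $a\in\bar A$, in degree $1$, with $d(ab)=da\,b+a\,db$), with differential $d:a\mapsto da\mapsto 0$, and let $\overline\Omega=\Omega/\mathbf k$. On $\overline\Omega$ let $b(\alpha\,da)=(-1)^{|\alpha|}[\alpha,a]$ with $b|_{\overline\Omega^0}=0$, let $\kappa(\alpha\,da)=(-1)^{|\alpha|}da\,\alpha$ with $\kappa|_{\overline\Omega^0}=\mathrm{Id}$, let $B|_{\overline\Omega^n}=(1+\kappa+\dots+\kappa^n)d$, and let $$\mathbf i(a_0\,da_1\cdots da_n)=\sum_{\ell=1}^n(-1)^{(\ell-1)(n-1)+1}[a_\ell,\ da_{\ell+1}\cdots da_n\,a_0\,da_1\cdots da_{\ell-1}].$$ Let $u$ be a formal variable of degree $-2$, let $R=\mathbf k((u))/u\mathbf k[[u]]$, and identify $\overline\Omega\otimes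 R$ with $\overline\Omega((u))/u\overline\Omega[[u]]$. Put $\overline{HC}{}^{per}(A)=H(\overline\Omega((u)),b-uB)$, $\overline{HC}{}^{-}(A)=H(\overline\Omega[[u]],b-uB)$ and $\overline{HC}(A)=H(\overline\Omega\otimes R,b-uB)$. Let $\overline{[d\Omega,d\Omega]}\subseteq\overline\Omega$ be the image of the span of the graded commutators of elements of $d\Omega$. Call $\ker(\mathrm{Id}-\kappa)^2$ the harmonic part and $\operatorname{im}(\mathrm{Id}-\kappa)^2$ the antiharmonic part of $\overline\Omega$; the harmonic (antiharmonic) part of a homology group consists of the classes of cycles all of whose coefficients are harmonic (antiharmonic). Then each of the pairs $(b,B)$ and $(\mathbf i,d)$ consists of anticommuting differentials on $\overline\Omega$, and there are isomorphisms, natural in $A$, compatible with the total grading and with multiplication by $u$, $$\overline{HC}{}^{per}_\bullet(A)\cong H_\bullet(\overline\Omega((u)),\mathbf i-ud),$$ $$\overline{HC}{}^{-}_\bullet(A)\cong H_\bullet(\overline\Omega[[u]],\mathbf i-ud)/\overline{[d\Omega,d\Omega]},$$ $$\overline{HC}_\bullet(A)\cong H_\bullet(\overline\Omega\otimes R,\mathbf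 i-ud)/\overline{[d\Omega,d\Omega]}.$$ In the second isomorphism $\overline{[d\Omega,d\Omega]}$ is embedded in the homology by constant terms in $u$. In the third it is embedded, naturally in $A$, by the injective $\mathbf k$-linear map $$f\longmapsto(\mathrm{Id}-u^{-1}s\,\mathbf i)^{-1}s(f)=\sum_{j\ge0}u^{-j}(s\,\mathbf i)^j s(f),$$ where $s:d\overline\Omega\to\overline\Omega$ is a set-theoretic section of $d$. Here all $\mathbf i(s\,\mathbf i)^js(f)$ lie in $d\overline\Omega$; the sum is finite if $f$ and $s$ are homogeneous; and the class of the sum, whenever the sum is finite, does not depend on $s$. In both cases the image of the embedding is exactly the antiharmonic part of the homology, and the homology is the direct sum of its harmonic and antiharmonic parts, so that the embedding is canonically split. -/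

import Mathlib

open scoped TensorProduct Polynomial

universe u v

noncomputable section

namespace NCForms

/-! ## The algebra of noncommutative differential forms -/

section Forms

variable (k : Type u) [CommRing k] (A : Type v) [Ring A] [Algebra k A]

/-- The unit map `k → A` is a `k`-split injection: it has a `k`-linear retraction. -/
class SplitUnit : Prop where
  exists_retraction : ∃ r : A →ₗ[k] k, ∀ c : k, r (algebraMap k A c) = c

/-- The `k`-module `A / k`. -/
abbrev Abar : Type v := A ⧸ LinearMap.range (Algebra.linearMap k A)

/-- The quotient map `A → A / k`. -/
def abar : A →ₗ[k] Abar k A := (LinearMap.range (Algebra.linearMap k A)).mkQ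

/-- The relations imposed on the tensor algebra of `A ⊕ A / k`: the summand `A` is a unital
subalgebra, and `d (a b) = d a · b + a · d b`, where `d a` is the class of `a` in `A / k`. -/
inductive Rel : TensorAlgebra k (A × Abar k A) → TensorAlgebra k (A × Abar k A) → Prop
  | one : Rel (TensorAlgebra.ι k ((1 : A), (0 : Abar k A))) 1
  | mul (a b : A) :
      Rel (TensorAlgebra.ι k (a, (0 : Abar k A)) * TensorAlgebra.ι k (b, (0 : Abar k A)))
        (TensorAlgebra.ι k (a * b, (0 : Abar k A)))
  | leibniz (a b : A) :
      Rel (TensorAlgebra.ι k ((0 : A), abar k A (a * b)))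
        (TensorAlgebra.ι k ((0 : A), abar k A a) * TensorAlgebra.ι k (b, (0 : Abar k A)) +
          TensorAlgebra.ι k (a, (0 : Abar k A)) * TensorAlgebra.ι k ((0 : A), abar k A b))

/-- The algebra `Ω A` of noncommutative differential forms (the differential envelope of `A`). -/
def Omega : Type (max u v) := RingQuot (Rel k A)

instance : Ring (Omega k A) := inferInstanceAs (Ring (RingQuot (Rel k A)))

instance : Algebra k (Omega k A) := inferInstanceAs (Algebra k (RingQuot (Rel k A)))

/-- The quotient map from the tensor algebra. -/
def quot : TensorAlgebra k (A × Abar k A) →ₐ[k] Omega k A := RingQuot.mkAlgHom k (Rel k A)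

lemma quot_rel {x y : TensorAlgebra k (A × Abar k A)} (h : Rel k A x y) :
    quot k A x = quot k A y := RingQuot.mkAlgHom_rel k h

/-- The inclusion `A = Ω⁰ A → Ω A`. -/
def inc : A →ₐ[k] Omega k A :=
  AlgHom.ofLinearMap
    ((quot k A).toLinearMap ∘ₗ TensorAlgebra.ι k ∘ₗ LinearMap.inl k A (Abar k A))
    (by simpa using quot_rel k A (Rel.one))
    (fun a b => by simpa using (quot_rel k A (Rel.mul a b)).symm)

/-- The map `A / k → Ω A` sending the class of `a` to `d a`. -/
def dA : Abar k A →ₗ[k] Omega k A :=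
  (quot k A).toLinearMap ∘ₗ TensorAlgebra.ι k ∘ₗ LinearMap.inr k A (Abar k A)

lemma dA_mul (a b : A) :
    dA k A (abar k A (a * b)) =
      dA k A (abar k A a) * inc k A b + inc k A a * dA k A (abar k A b) := by
  simpa [dA, inc] using quot_rel k A (Rel.leibniz a b)

@[simp] lemma abar_algebraMap (c : k) : abar k A (algebraMap k A c) = 0 := by
  rw [abar, Submodule.mkQ_apply, Submodule.Quotient.mk_eq_zero]
  exact ⟨c, by simp⟩

@[simp] lemma abar_one : abar k A 1 = 0 := by
  simpa using abar_algebraMap k A 1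

variable {k A}

/-- The universal property of `Ω A`. -/
def lift {B : Type*} [Ring B] [Algebra k B] (f : A →ₐ[k] B) (δ : Abar k A →ₗ[k] B)
    (h : ∀ a b, δ (abar k A (a * b)) = δ (abar k A a) * f b + f a * δ (abar k A b)) :
    Omega k A →ₐ[k] B :=
  RingQuot.liftAlgHom k ⟨TensorAlgebra.lift k (f.toLinearMap.coprod δ), by
    intro x y hxy
    cases hxy with
    | one => simp
    | mul a b => simp
    | leibniz a b => simpa using h a b⟩

section lift
variable {B : Type*} [Ring B] [Algebra k B] (f : A →ₐ[k] B) (δ : Abar k A →ₗ[k] B)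
    (h : ∀ a b, δ (abar k A (a * b)) = δ (abar k A a) * f b + f a * δ (abar k A b))

@[simp] lemma lift_inc (a : A) : lift f δ h (inc k A a) = f a := by
  have := RingQuot.liftAlgHom_mkAlgHom_apply (S := k) (s := Rel k A)
    (TensorAlgebra.lift k (f.toLinearMap.coprod δ)) (by
      intro x y hxy
      cases hxy with
      | one => simp
      | mul a b => simp
      | leibniz a b => simpa using h a b) (TensorAlgebra.ι k (a, (0 : Abar k A)))
  refine this.trans ?_
  simp

@[simp] lemma lift_dA (x : Abar k A) : lift f δ h (dA k A x) = δ x := by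
  have := RingQuot.liftAlgHom_mkAlgHom_apply (S := k) (s := Rel k A)
    (TensorAlgebra.lift k (f.toLinearMap.coprod δ)) (by
      intro x y hxy
      cases hxy with
      | one => simp
      | mul a b => simp
      | leibniz a b => simpa using h a b) (TensorAlgebra.ι k ((0 : A), x))
  refine this.trans ?_
  simp

end lift

/-- Algebra maps out of `Ω A` are determined by their values on `a` and `d a`. -/
lemma algHom_ext {B : Type*} [Ring B] [Algebra k B] {f g : Omega k A →ₐ[k] B}
    (h₀ : ∀ a, f (inc k A a) = g (inc k A a))
    (h₁ : ∀ x, f (dA k A x) = g (dA k A x)) : f = g := by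
  refine RingQuot.ringQuot_ext' k f g (TensorAlgebra.hom_ext (LinearMap.ext fun p => ?_))
  obtain ⟨a, x⟩ := p
  have hp : ((a, x) : A × Abar k A) = (a, 0) + (0, x) := by simp
  have e₀ := h₀ a
  have e₁ := h₁ x
  simp only [LinearMap.comp_apply, hp, map_add]
  exact congrArg₂ (· + ·) e₀ e₁

variable (k A)

/-! ### Grading -/

/-- The submodule `Ωⁿ A` of forms of degree `n`, spanned by the products `a₀ da₁ ⋯ daₙ`. -/
def deg (n : ℕ) : Submodule k (Omega k A) :=
  LinearMap.range (inc k A).toLinearMap * LinearMap.range (dA k A) ^ n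

/-- The grading as an algebra map: a form `ω = ∑ ωₙ` with `ωₙ` of degree `n` goes to the
polynomial `∑ ωₙ Xⁿ`. -/
def comps : Omega k A →ₐ[k] (Omega k A)[X] :=
  lift (Polynomial.CAlgHom.comp (inc k A))
    ((Polynomial.monomial 1).restrictScalars k ∘ₗ dA k A) (fun a b => by
      simp [dA_mul, Polynomial.C_mul_monomial, Polynomial.monomial_mul_C])

/-- The parity automorphism, `(-1)ⁿ` on forms of degree `n`. -/
def eps : Omega k A →ₐ[k] Omega k A :=
  lift (inc k A) (-dA k A) (fun a b => by
    simp only [LinearMap.neg_apply, dA_mul]; noncomm_ring)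

/-! ### The de Rham differential -/

/-- The value at `a` of the algebra map `dMat` below. -/
def dMatA : A →ₐ[k] Matrix (Fin 2) (Fin 2) (Omega k A) :=
  AlgHom.ofLinearMap
    { toFun := fun a => !![inc k A a, dA k A (abar k A a); 0, inc k A a]
      map_add' := fun a b => by
        ext i j; fin_cases i <;> fin_cases j <;> simp
      map_smul' := fun c a => by
        ext i j; fin_cases i <;> fin_cases j <;> simp }
    (by ext i j; fin_cases i <;> fin_cases j <;> simp)
    (fun a b => by
      ext i j; fin_cases i <;> fin_cases j <;> simp [Matrix.mul_apply, dA_mul, add_comm])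

/-- The value at `d a` of the algebra map `dMat` below. -/
def dMatD : Abar k A →ₗ[k] Matrix (Fin 2) (Fin 2) (Omega k A) where
  toFun x := !![-dA k A x, 0; 0, dA k A x]
  map_add' x y := by
    ext i j; fin_cases i <;> fin_cases j <;> simp [add_comm]
  map_smul' c x := by
    ext i j; fin_cases i <;> fin_cases j <;> simp

/-- The algebra map `α ↦ (ε α, d α; 0, α)`, which encodes the graded Leibniz rule. -/
def dMat : Omega k A →ₐ[k] Matrix (Fin 2) (Fin 2) (Omega k A) :=
  lift (dMatA k A) (dMatD k A) (fun a b => by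
    ext i j; fin_cases i <;> fin_cases j <;>
      simp [dMatA, dMatD, dA_mul, add_comm])

/-- The Karoubi-de Rham differential, the odd derivation with `a ↦ d a ↦ 0`. -/
def dOp : Omega k A →ₗ[k] Omega k A where
  toFun ω := dMat k A ω 0 1
  map_add' x y := by simp
  map_smul' c x := by simp

@[simp] lemma eps_inc (a : A) : eps k A (inc k A a) = inc k A a := by simp [eps]

@[simp] lemma eps_dA (x : Abar k A) : eps k A (dA k A x) = -dA k A x := by simp [eps]

lemma dOp_inc (a : A) : dOp k A (inc k A a) = dA k A (abar k A a) := by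
  simp [dOp, dMat, dMatA, dMatD]

lemma dOp_dA (x : Abar k A) : dOp k A (dA k A x) = 0 := by
  simp [dOp, dMat, dMatA, dMatD]

lemma omega_induction {p : Omega k A → Prop} (hinc : ∀ a, p (inc k A a))
    (hdA : ∀ x, p (dA k A x)) (hadd : ∀ x y, p x → p y → p (x + y))
    (hmul : ∀ x y, p x → p y → p (x * y)) (ω : Omega k A) : p ω := by
  obtain ⟨t, rfl⟩ := RingQuot.mkAlgHom_surjective k (Rel k A) ω
  change p (quot k A t)
  induction t using TensorAlgebra.induction with
  | algebraMap c => simpa using hinc (algebraMap k A c)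
  | ι m =>
    obtain ⟨a, x⟩ := m
    have e : quot k A (TensorAlgebra.ι k (a, x)) = inc k A a + dA k A x := by
      change _ = quot k A (TensorAlgebra.ι k (a, 0)) + quot k A (TensorAlgebra.ι k (0, x))
      rw [← map_add, ← map_add]; simp
    rw [e]; exact hadd _ _ (hinc a) (hdA x)
  | mul x y hx hy => simpa using hmul _ _ hx hy
  | add x y hx hy => simpa using hadd _ _ hx hy

lemma dMat_apply (ω : Omega k A) :
    dMat k A ω = !![eps k A ω, dOp k A ω; 0, ω] := by
  have h : dMat k A ω 0 0 = eps k A ω ∧ dMat k A ω 1 0 = 0 ∧ dMat k A ω 1 1 = ω := by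
    induction ω using omega_induction with
    | hinc a => simp [dMat, dMatA]
    | hdA x => simp [dMat, dMatD]
    | hadd x y hx hy => simp [hx, hy]
    | hmul x y hx hy => simp [Matrix.mul_apply, hx, hy]
  ext i j
  fin_cases i <;> fin_cases j
  · exact h.1
  · rfl
  · exact h.2.1
  · exact h.2.2

/-- The graded Leibniz rule. -/
lemma dOp_mul (α β : Omega k A) :
    dOp k A (α * β) = dOp k A α * β + eps k A α * dOp k A β := by
  have h := congrFun (congrFun (map_mul (dMat k A) α β) 0) 1
  simp only [dMat_apply, Matrix.mul_apply, Fin.sum_univ_two] at h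
  simpa [add_comm] using h

lemma dOp_one : dOp k A 1 = 0 := by
  simpa using dOp_inc k A (1 : A)

/-! ### Splitting off the last differential

Every form is uniquely `a + ∑ α dx` with `a ∈ A`, `α ∈ Ω A` and `x ∈ A / k`.  The decomposition
`Ω A → A × (Ω A ⊗ A / k)` is the orbit map at `(1, 0)` of the following left action of `Ω A`. -/

/-- The action of `Ω A` on `Ω A ⊗ A / k` by left multiplication. -/
def leftMul : Omega k A →ₐ[k] Module.End k (Omega k A ⊗[k] Abar k A) :=
  (Module.End.rTensorAlgHom k (Omega k A) (Abar k A)).comp (Algebra.lmul k (Omega k A))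

@[simp] lemma leftMul_tmul (ω α : Omega k A) (x : Abar k A) :
    leftMul k A ω (α ⊗ₜ x) = (ω * α) ⊗ₜ x := rfl

/-- The action of `A` on `A × (Ω A ⊗ A / k)`: `b · (a, w) = (b a, b w)`. -/
def actA : A →ₐ[k] Module.End k (A × (Omega k A ⊗[k] Abar k A)) :=
  AlgHom.ofLinearMap
    { toFun := fun a => (LinearMap.mulLeft k a).prodMap (leftMul k A (inc k A a))
      map_add' := fun a b => by
        refine LinearMap.ext fun p => ?_
        simp [add_mul]
      map_smul' := fun c a => by
        refine LinearMap.ext fun p => ?_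
        simp }
    (by
      refine LinearMap.ext fun p => ?_
      simp)
    (fun a b => by
      refine LinearMap.ext fun p => ?_
      simp)

/-- The action of `d x` on `A × (Ω A ⊗ A / k)`, as a function of `x ∈ A`:
`d x · (a, w) = (0, 1 ⊗ x a - x ⊗ a + (d x) w)`. -/
def actD' : A →ₗ[k] Module.End k (A × (Omega k A ⊗[k] Abar k A)) where
  toFun x := LinearMap.inr k A (Omega k A ⊗[k] Abar k A) ∘ₗ LinearMap.coprod
    (TensorProduct.mk k (Omega k A) (Abar k A) 1 ∘ₗ abar k A ∘ₗ LinearMap.mulLeft k x -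
      TensorProduct.mk k (Omega k A) (Abar k A) (inc k A x) ∘ₗ abar k A)
    (leftMul k A (dA k A (abar k A x)))
  map_add' x y := by
    refine LinearMap.ext fun p => ?_
    simp [add_mul, TensorProduct.tmul_add]
    abel
  map_smul' c x := by
    refine LinearMap.ext fun p => ?_
    simp [TensorProduct.smul_tmul', smul_add, smul_sub]

/-- The action of `d x`, for `x ∈ A / k`, on `A × (Ω A ⊗ A / k)`. -/
def actD : Abar k A →ₗ[k] Module.End k (A × (Omega k A ⊗[k] Abar k A)) :=
  Submodule.liftQ (M₂ := Module.End k (A × (Omega k A ⊗[k] Abar k A)))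
    (LinearMap.range (Algebra.linearMap k A)) (actD' k A) (by
    rintro _ ⟨c, rfl⟩
    rw [LinearMap.mem_ker]
    refine LinearMap.ext fun p => ?_
    simp only [actD', LinearMap.coe_mk, AddHom.coe_mk, Algebra.linearMap_apply, abar_algebraMap]
    simp [Algebra.algebraMap_eq_smul_one, TensorProduct.smul_tmul'])

@[simp] lemma actD_abar (x : A) : actD k A (abar k A x) = actD' k A x :=
  rfl

/-- The left action of `Ω A` on `A × (Ω A ⊗ A / k)`. -/
def act : Omega k A →ₐ[k] Module.End k (A × (Omega k A ⊗[k] Abar k A)) :=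
  lift (B := Module.End k (A × (Omega k A ⊗[k] Abar k A))) (actA k A) (actD k A) (fun a b => by
    refine LinearMap.ext fun p => ?_
    simp [actA, actD', dA_mul]
    abel)

/-- The decomposition `a + ∑ α dx ↦ (a, ∑ α ⊗ x)`. -/
def splitLast : Omega k A →ₗ[k] A × (Omega k A ⊗[k] Abar k A) :=
  LinearMap.applyₗ ((1 : A), (0 : Omega k A ⊗[k] Abar k A)) ∘ₗ (act k A).toLinearMap

lemma act_inr (ω : Omega k A) (w : Omega k A ⊗[k] Abar k A) :
    act k A ω (0, w) = (0, leftMul k A ω w) := by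
  induction ω using omega_induction generalizing w with
  | hinc a => simp [act, actA]
  | hdA x =>
    obtain ⟨x, rfl⟩ := Submodule.mkQ_surjective _ x
    change act k A (dA k A (abar k A x)) _ = (0, leftMul k A (dA k A (abar k A x)) w)
    simp [act, actD']
  | hadd x y hx hy => simp [hx, hy]
  | hmul x y hx hy => simp [hx, hy]

@[simp] lemma splitLast_inc (a : A) : splitLast k A (inc k A a) = (a, 0) := by
  simp [splitLast, act, actA]

@[simp] lemma splitLast_mul_dA (α : Omega k A) (x : Abar k A) :
    splitLast k A (α * dA k A x) = (0, α ⊗ₜ x) := by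
  obtain ⟨x, rfl⟩ := Submodule.mkQ_surjective _ x
  change splitLast k A (α * dA k A (abar k A x)) = (0, α ⊗ₜ abar k A x)
  have h : act k A (dA k A (abar k A x)) (1, 0) = (0, 1 ⊗ₜ abar k A x) := by
    simp [act, actD']
  have e : splitLast k A (α * dA k A (abar k A x)) =
      act k A α (act k A (dA k A (abar k A x)) (1, 0)) := by
    simp [splitLast]
  rw [e, h, act_inr, leftMul_tmul, mul_one]

/-! ### The operators `b`, `κ`, `B` and `i` -/

/-- The bilinear map `(α, a) ↦ α a - a α`, which depends only on the class of `a` in `A / k`. -/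
def commR : Abar k A →ₗ[k] Omega k A →ₗ[k] Omega k A :=
  (LinearMap.range (Algebra.linearMap k A)).liftQ
    (((LinearMap.mul k (Omega k A)).flip - LinearMap.mul k (Omega k A)) ∘ₗ (inc k A).toLinearMap)
    (by
      rintro _ ⟨c, rfl⟩
      refine LinearMap.mem_ker.2 (LinearMap.ext fun p => ?_)
      simp [Algebra.algebraMap_eq_smul_one])

@[simp] lemma commR_abar (a : A) (α : Omega k A) :
    commR k A (abar k A a) α = α * inc k A a - inc k A a * α := by
  have h : commR k A (abar k A a) = (((LinearMap.mul k (Omega k A)).flip -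
      LinearMap.mul k (Omega k A)) ∘ₗ (inc k A).toLinearMap) a := Submodule.liftQ_apply _ _ a
  rw [h]; simp

/-- The Hochschild differential: `b (a) = 0` and `b (α da) = (-1)^|α| [α, a]`. -/
def bOp : Omega k A →ₗ[k] Omega k A :=
  TensorProduct.lift ((commR k A).flip ∘ₗ (eps k A).toLinearMap) ∘ₗ
    LinearMap.snd k A (Omega k A ⊗[k] Abar k A) ∘ₗ splitLast k A

/-- The Karoubi operator: `κ (a) = a` and `κ (α da) = (-1)^|α| da α`. -/
def kappa : Omega k A →ₗ[k] Omega k A :=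
  LinearMap.coprod (inc k A).toLinearMap
    (TensorProduct.lift
      (((LinearMap.mul k (Omega k A)) ∘ₗ dA k A).flip ∘ₗ (eps k A).toLinearMap)) ∘ₗ splitLast k A

/-- The Connes differential: `B = (1 + κ + ⋯ + κⁿ) d` on forms of degree `n`. -/
def connesB : Omega k A →ₗ[k] Omega k A :=
  Polynomial.lsum (fun n => (∑ j ∈ Finset.range (n + 1), kappa k A ^ j) ∘ₗ dOp k A) ∘ₗ
    (comps k A).toLinearMap

/-- Auxiliary recursion for the contraction `i` on forms of degree `n`.  On `α = a₀ da₁ ⋯ daₘ` it is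
`β ↦ ∑_{1 ≤ ℓ ≤ m} (-1)^((ℓ-1)(n-1)+1) [a_ℓ, da_{ℓ+1} ⋯ daₘ β a₀ da₁ ⋯ da_{ℓ-1}]`. -/
def iAux (n : ℕ) : ℕ → Omega k A →ₗ[k] Omega k A →ₗ[k] Omega k A
  | 0 => 0
  | m + 1 => TensorProduct.lift
      (LinearMap.mk₂ k
        (fun (α : Omega k A) (x : Abar k A) =>
          (-1 : k) ^ (m * (n - 1)) • (commR k A x ∘ₗ LinearMap.mulRight k α) +
            iAux n m α ∘ₗ LinearMap.mulLeft k (dA k A x))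
        (fun α α' x => by
          refine LinearMap.ext fun β => ?_
          simp [mul_add]; abel)
        (fun c α x => by
          refine LinearMap.ext fun β => ?_
          simp [smul_comm c])
        (fun α x x' => by
          refine LinearMap.ext fun β => ?_
          simp [add_mul]; abel)
        (fun c α x => by
          refine LinearMap.ext fun β => ?_
          simp [smul_comm c])) ∘ₗ
    LinearMap.snd k A (Omega k A ⊗[k] Abar k A) ∘ₗ splitLast k A

/-- The contraction `i`: on `a₀ da₁ ⋯ daₙ` it is
`∑_{1 ≤ ℓ ≤ n} (-1)^((ℓ-1)(n-1)+1) [a_ℓ, da_{ℓ+1} ⋯ daₙ a₀ da₁ ⋯ da_{ℓ-1}]`. -/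
def iOp : Omega k A →ₗ[k] Omega k A :=
  Polynomial.lsum (fun n => (LinearMap.applyₗ (1 : Omega k A)) ∘ₗ iAux k A n n) ∘ₗ
    (comps k A).toLinearMap

/-! The defining formulas of the operators. -/

/-- The form `da₁ ⋯ daₙ`. -/
def word (l : List A) : Omega k A := (l.map fun a => dA k A (abar k A a)).prod

@[simp] lemma comps_inc (a : A) : comps k A (inc k A a) = Polynomial.C (inc k A a) := by
  simp [comps]

@[simp] lemma comps_dA (x : Abar k A) :
    comps k A (dA k A x) = Polynomial.monomial 1 (dA k A x) := by
  simp [comps]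

lemma comps_of_mem_deg {n : ℕ} {ω : Omega k A} (h : ω ∈ deg k A n) :
    comps k A ω = Polynomial.monomial n ω := by
  have key : ∀ n (t : Omega k A), t ∈ LinearMap.range (dA k A) ^ n →
      comps k A t = Polynomial.monomial n t := by
    intro n
    induction n with
    | zero =>
      intro t ht
      rw [pow_zero, Submodule.mem_one] at ht
      obtain ⟨c, rfl⟩ := ht
      rw [AlgHom.commutes]; rfl
    | succ n ih =>
      intro t ht
      rw [pow_succ] at ht
      refine Submodule.mul_induction_on ht ?_ ?_
      · rintro x hx _ ⟨y, rfl⟩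
        rw [map_mul, ih x hx, comps_dA, Polynomial.monomial_mul_monomial]
      · intro x y hx hy
        rw [map_add, hx, hy, map_add]
  refine Submodule.mul_induction_on h ?_ ?_
  · rintro _ ⟨a, rfl⟩ t ht
    rw [map_mul, key n t ht, AlgHom.toLinearMap_apply, comps_inc, Polynomial.C_mul_monomial]
  · intro x y hx hy
    rw [map_add, hx, hy, map_add]

lemma eps_of_mem_deg {n : ℕ} {ω : Omega k A} (h : ω ∈ deg k A n) :
    eps k A ω = (-1 : k) ^ n • ω := by
  have key : ∀ n (t : Omega k A), t ∈ LinearMap.range (dA k A) ^ n →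
      eps k A t = (-1 : k) ^ n • t := by
    intro n
    induction n with
    | zero =>
      intro t ht
      rw [pow_zero, Submodule.mem_one] at ht
      obtain ⟨c, rfl⟩ := ht
      rw [AlgHom.commutes]; simp
    | succ n ih =>
      intro t ht
      rw [pow_succ] at ht
      refine Submodule.mul_induction_on ht ?_ ?_
      · rintro x hx _ ⟨y, rfl⟩
        rw [map_mul, ih x hx, eps_dA]; simp [pow_succ]
      · intro x y hx hy
        rw [map_add, hx, hy, smul_add]
  refine Submodule.mul_induction_on h ?_ ?_
  · rintro _ ⟨a, rfl⟩ t ht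
    rw [map_mul, key n t ht, AlgHom.toLinearMap_apply, eps_inc, mul_smul_comm]
  · intro x y hx hy
    rw [map_add, hx, hy, smul_add]

lemma bOp_inc (a : A) : bOp k A (inc k A a) = 0 := by simp [bOp]

lemma bOp_mul_dA {n : ℕ} {α : Omega k A} (h : α ∈ deg k A n) (a : A) :
    bOp k A (α * dA k A (abar k A a)) = (-1 : k) ^ n • (α * inc k A a - inc k A a * α) := by
  simp [bOp, eps_of_mem_deg k A h, smul_sub]

lemma kappa_inc (a : A) : kappa k A (inc k A a) = inc k A a := by simp [kappa]

lemma kappa_mul_dA {n : ℕ} {α : Omega k A} (h : α ∈ deg k A n) (x : Abar k A) :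
    kappa k A (α * dA k A x) = (-1 : k) ^ n • (dA k A x * α) := by
  simp [kappa, eps_of_mem_deg k A h]

lemma connesB_of_mem_deg {n : ℕ} {ω : Omega k A} (h : ω ∈ deg k A n) :
    connesB k A ω = ∑ j ∈ Finset.range (n + 1), (kappa k A ^ j) (dOp k A ω) := by
  simp [connesB, comps_of_mem_deg k A h, Polynomial.lsum]

lemma word_mem (l : List A) : word k A l ∈ LinearMap.range (dA k A) ^ l.length := by
  induction l with
  | nil => simpa [word] using Submodule.one_le.1 (le_refl (1 : Submodule k (Omega k A)))
  | cons a l ih =>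
    rw [List.length_cons, pow_succ']
    simpa [word] using Submodule.mul_mem_mul (LinearMap.mem_range_self (dA k A) (abar k A a)) ih

lemma inc_mul_word_mem (a : A) (l : List A) : inc k A a * word k A l ∈ deg k A l.length :=
  Submodule.mul_mem_mul ⟨a, rfl⟩ (word_mem k A l)

lemma iAux_word (n : ℕ) (a₀ : A) (l : List A) (β : Omega k A) :
    iAux k A n l.length (inc k A a₀ * word k A l) β =
      ∑ j ∈ Finset.range l.length, (-1 : k) ^ (j * (n - 1) + 1) •
        (inc k A (l.getD j 0) *
            (word k A (l.drop (j + 1)) * β * inc k A a₀ * word k A (l.take j)) -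
          (word k A (l.drop (j + 1)) * β * inc k A a₀ * word k A (l.take j)) *
            inc k A (l.getD j 0)) := by
  induction l using List.reverseRecOn generalizing β with
  | nil => simp [iAux]
  | append_singleton l a ih =>
    have hw : inc k A a₀ * word k A (l ++ [a]) =
        (inc k A a₀ * word k A l) * dA k A (abar k A a) := by
      simp [word, mul_assoc]
    have hl : (l ++ [a]).length = l.length + 1 := by simp
    rw [hw, hl, Finset.sum_range_succ, add_comm (Finset.sum _ _)]
    simp only [iAux, LinearMap.comp_apply, splitLast_mul_dA, LinearMap.snd_apply,
      TensorProduct.lift.tmul, LinearMap.mk₂_apply, LinearMap.add_apply, ih, LinearMap.smul_apply,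
      LinearMap.mulRight_apply, LinearMap.mulLeft_apply, commR_abar]
    congr 1
    · simp [word, pow_succ, mul_assoc, ← smul_neg]
    · refine Finset.sum_congr rfl fun j hj => ?_
      have hj' := Finset.mem_range.1 hj
      rw [List.getD_append _ _ _ _ hj', List.drop_append_of_le_length hj',
        List.take_append_of_le_length hj'.le]
      simp [word, mul_assoc]

/-- The defining formula of the contraction. -/
lemma iOp_word (a₀ : A) (l : List A) :
    iOp k A (inc k A a₀ * word k A l) =
      ∑ j ∈ Finset.range l.length, (-1 : k) ^ (j * (l.length - 1) + 1) •
        (inc k A (l.getD j 0) *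
            (word k A (l.drop (j + 1)) * inc k A a₀ * word k A (l.take j)) -
          (word k A (l.drop (j + 1)) * inc k A a₀ * word k A (l.take j)) *
            inc k A (l.getD j 0)) := by
  have h := iAux_word k A l.length a₀ l 1
  simp only [mul_one] at h
  rw [← h]
  simp [iOp, comps_of_mem_deg k A (inc_mul_word_mem k A a₀ l), Polynomial.lsum]

/-! ### The reduced complex -/

/-- The reduced forms `Ω̄ A = Ω A / k`. -/
abbrev Obar : Type (max u v) := Omega k A ⧸ LinearMap.range (Algebra.linearMap k (Omega k A))

/-- The projection `Ω A → Ω̄ A`. -/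
def toBar : Omega k A →ₗ[k] Obar k A := (LinearMap.range (Algebra.linearMap k (Omega k A))).mkQ

variable {k A} in
/-- The operator on `Ω̄ A` induced by an operator `T` on `Ω A` with `T 1 ∈ k`. -/
def descend (T : Omega k A →ₗ[k] Omega k A) (c : k) (h : T 1 = c • 1) :
    Obar k A →ₗ[k] Obar k A :=
  Submodule.mapQ _ _ T (by
    rintro _ ⟨r, rfl⟩
    refine ⟨r * c, ?_⟩
    simp [Algebra.algebraMap_eq_smul_one, h, mul_smul])

lemma one_mem_deg : (1 : Omega k A) ∈ deg k A 0 := by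
  simpa [word] using inc_mul_word_mem k A 1 []

/-- The de Rham differential on `Ω̄ A`. -/
def dBar : Obar k A →ₗ[k] Obar k A := descend (dOp k A) 0 (by simp [dOp_one])

/-- The Hochschild differential on `Ω̄ A`. -/
def bBar : Obar k A →ₗ[k] Obar k A :=
  descend (bOp k A) 0 (by simpa using bOp_inc k A (1 : A))

/-- The Karoubi operator on `Ω̄ A`. -/
def kappaBar : Obar k A →ₗ[k] Obar k A :=
  descend (kappa k A) 1 (by simpa using kappa_inc k A (1 : A))

/-- The Connes differential on `Ω̄ A`. -/
def connesBBar : Obar k A →ₗ[k] Obar k A :=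
  descend (connesB k A) 0 (by simp [connesB_of_mem_deg k A (one_mem_deg k A), dOp_one])

/-- The contraction `i` on `Ω̄ A`. -/
def iBar : Obar k A →ₗ[k] Obar k A :=
  descend (iOp k A) 0 (by simpa [word] using iOp_word k A 1 [])

/-- The forms of degree `m` in `Ω̄ A`, for an integer `m` (zero if `m < 0`). -/
def degBar (m : ℤ) : Submodule k (Obar k A) :=
  ⨆ (p : ℕ) (_ : (p : ℤ) = m), (deg k A p).map (toBar k A)

/-- Harmonic forms, `ker (1 - κ)²`. -/
def harm : Submodule k (Obar k A) := LinearMap.ker ((1 - kappaBar k A) ^ 2)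

/-- Antiharmonic forms, `im (1 - κ)²`. -/
def antiharm : Submodule k (Obar k A) := LinearMap.range ((1 - kappaBar k A) ^ 2)

/-- The span `[V, V]` of the graded commutators of homogeneous elements of `V ⊆ Ω A`. -/
def superComm (V : Submodule k (Omega k A)) : Submodule k (Omega k A) :=
  Submodule.span k {z | ∃ (m n : ℕ) (x y : Omega k A), x ∈ V ⊓ deg k A m ∧ y ∈ V ⊓ deg k A n ∧
    z = x * y - (-1 : k) ^ (m * n) • (y * x)}

/-- The image of `[dΩ, dΩ]` in `Ω̄ A`. -/
def commBar : Submodule k (Obar k A) :=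
  (superComm k A (LinearMap.range (dOp k A))).map (toBar k A)

end Forms

/-! ### Functoriality -/

section Functoriality

variable {k : Type u} [CommRing k] {A A' : Type v} [Ring A] [Algebra k A] [Ring A'] [Algebra k A']
variable (φ : A →ₐ[k] A')

/-- The map `A / k → A' / k` induced by an algebra map. -/
def abarMap : Abar k A →ₗ[k] Abar k A' :=
  Submodule.mapQ _ _ φ.toLinearMap (by rintro _ ⟨c, rfl⟩; exact ⟨c, by simp⟩)

@[simp] lemma abarMap_abar (a : A) : abarMap φ (abar k A a) = abar k A' (φ a) := rfl

/-- The map `Ω A → Ω A'` induced by an algebra map. -/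
def omegaMap : Omega k A →ₐ[k] Omega k A' :=
  lift ((inc k A').comp φ) (dA k A' ∘ₗ abarMap φ) (fun a b => by simp [dA_mul])

@[simp] lemma omegaMap_inc (a : A) : omegaMap φ (inc k A a) = inc k A' (φ a) :=
  lift_inc _ _ _ a

@[simp] lemma omegaMap_dA (x : Abar k A) :
    omegaMap φ (dA k A x) = dA k A' (abarMap φ x) :=
  lift_dA _ _ _ x

lemma eps_omegaMap (ω : Omega k A) :
    eps k A' (omegaMap φ ω) = omegaMap φ (eps k A ω) := by
  induction ω using omega_induction with
  | hinc a => simp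
  | hdA x => simp
  | hadd x y hx hy => simp [hx, hy]
  | hmul x y hx hy => simp [hx, hy]

lemma dOp_omegaMap (ω : Omega k A) :
    dOp k A' (omegaMap φ ω) = omegaMap φ (dOp k A ω) := by
  induction ω using omega_induction with
  | hinc a => simp [dOp_inc]
  | hdA x => simp [dOp_dA]
  | hadd x y hx hy => simp [hx, hy]
  | hmul x y hx hy => simp [hx, hy, dOp_mul, eps_omegaMap]

lemma comps_omegaMap (ω : Omega k A) :
    comps k A' (omegaMap φ ω) = (comps k A ω).map (omegaMap φ : Omega k A →+* Omega k A') := by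
  induction ω using omega_induction with
  | hinc a => simp
  | hdA x => simp
  | hadd x y hx hy => simp [hx, hy]
  | hmul x y hx hy => simp [hx, hy]

/-- The map of `A × (Ω A ⊗ A / k)` induced by an algebra map. -/
def lastMap : A × (Omega k A ⊗[k] Abar k A) →ₗ[k] A' × (Omega k A' ⊗[k] Abar k A') :=
  φ.toLinearMap.prodMap (TensorProduct.map (omegaMap φ).toLinearMap (abarMap φ))

lemma leftMul_map (ω : Omega k A) (w : Omega k A ⊗[k] Abar k A) :
    leftMul k A' (omegaMap φ ω) (TensorProduct.map (omegaMap φ).toLinearMap (abarMap φ) w) =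
      TensorProduct.map (omegaMap φ).toLinearMap (abarMap φ) (leftMul k A ω w) := by
  induction w using TensorProduct.induction_on with
  | zero => simp
  | tmul x y => simp
  | add x y hx hy => simp [hx, hy]

lemma act_omegaMap (ω : Omega k A) (p : A × (Omega k A ⊗[k] Abar k A)) :
    act k A' (omegaMap φ ω) (lastMap φ p) = lastMap φ (act k A ω p) := by
  induction ω using omega_induction generalizing p with
  | hinc a =>
    have h := leftMul_map φ (inc k A a) p.2
    rw [omegaMap_inc] at h
    simp [act, actA, lastMap, h]
  | hdA x =>
    obtain ⟨x, rfl⟩ := Submodule.mkQ_surjective _ x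
    have h := leftMul_map φ (dA k A (abar k A x)) p.2
    rw [omegaMap_dA] at h
    change act k A' (omegaMap φ (dA k A (abar k A x))) _ =
      lastMap φ (act k A (dA k A (abar k A x)) p)
    simp only [abarMap_abar] at h
    simp [act, actD', lastMap, h]
  | hadd x y hx hy => simp [hx, hy]
  | hmul x y hx hy => simp [hx, hy]

lemma splitLast_omegaMap (ω : Omega k A) :
    splitLast k A' (omegaMap φ ω) = lastMap φ (splitLast k A ω) := by
  have h := act_omegaMap φ ω (1, 0)
  have e : lastMap φ ((1 : A), (0 : Omega k A ⊗[k] Abar k A)) = (1, 0) := by simp [lastMap]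
  rw [e] at h
  exact h

lemma commR_omegaMap (x : Abar k A) (α : Omega k A) :
    commR k A' (abarMap φ x) (omegaMap φ α) = omegaMap φ (commR k A x α) := by
  obtain ⟨x, rfl⟩ := Submodule.mkQ_surjective _ x
  change commR k A' (abarMap φ (abar k A x)) _ = omegaMap φ (commR k A (abar k A x) α)
  simp

lemma bOp_omegaMap (ω : Omega k A) :
    bOp k A' (omegaMap φ ω) = omegaMap φ (bOp k A ω) := by
  simp only [bOp, LinearMap.comp_apply, splitLast_omegaMap, LinearMap.snd_apply, lastMap,
    LinearMap.prodMap_apply]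
  induction (splitLast k A ω).2 using TensorProduct.induction_on with
  | zero => simp
  | tmul α x => simp [eps_omegaMap, commR_omegaMap]
  | add x y hx hy => simp only [map_add, hx, hy]

lemma kappa_omegaMap (ω : Omega k A) :
    kappa k A' (omegaMap φ ω) = omegaMap φ (kappa k A ω) := by
  simp only [kappa, LinearMap.comp_apply, splitLast_omegaMap, lastMap,
    LinearMap.prodMap_apply, LinearMap.coprod_apply, map_add]
  congr 1
  · simp
  · induction (splitLast k A ω).2 using TensorProduct.induction_on with
    | zero => simp
    | tmul α x => simp [eps_omegaMap]
    | add x y hx hy => simp only [map_add, hx, hy]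

lemma lsum_map {f : ℕ → Omega k A →ₗ[k] Omega k A} {f' : ℕ → Omega k A' →ₗ[k] Omega k A'}
    (h : ∀ n ω, f' n (omegaMap φ ω) = omegaMap φ (f n ω)) (p : (Omega k A)[X]) :
    Polynomial.lsum f' (p.map (omegaMap φ : Omega k A →+* Omega k A')) =
      omegaMap φ (Polynomial.lsum f p) := by
  induction p using Polynomial.induction_on' with
  | add p q hp hq => simp only [Polynomial.map_add, map_add, hp, hq]
  | monomial n a => simp [Polynomial.lsum, h]

lemma kappa_pow_omegaMap (j : ℕ) (ω : Omega k A) :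
    (kappa k A' ^ j) (omegaMap φ ω) = omegaMap φ ((kappa k A ^ j) ω) := by
  induction j generalizing ω with
  | zero => simp
  | succ j ih => simp [pow_succ, ih, kappa_omegaMap]

lemma connesB_omegaMap (ω : Omega k A) :
    connesB k A' (omegaMap φ ω) = omegaMap φ (connesB k A ω) := by
  simp only [connesB, LinearMap.comp_apply, AlgHom.toLinearMap_apply, comps_omegaMap]
  refine lsum_map φ (fun n ω => ?_) _
  simp [dOp_omegaMap, kappa_pow_omegaMap]

lemma iAux_omegaMap (n m : ℕ) (ω β : Omega k A) :
    iAux k A' n m (omegaMap φ ω) (omegaMap φ β) = omegaMap φ (iAux k A n m ω β) := by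
  induction m generalizing ω β with
  | zero => simp [iAux]
  | succ m ih =>
    simp only [iAux, LinearMap.comp_apply, splitLast_omegaMap, LinearMap.snd_apply, lastMap,
      LinearMap.prodMap_apply]
    induction (splitLast k A ω).2 using TensorProduct.induction_on with
    | zero => simp
    | tmul α x =>
      simp [← ih, ← commR_omegaMap]
    | add x y hx hy => simp only [map_add, LinearMap.add_apply, hx, hy]

lemma iOp_omegaMap (ω : Omega k A) :
    iOp k A' (omegaMap φ ω) = omegaMap φ (iOp k A ω) := by
  simp only [iOp, LinearMap.comp_apply, AlgHom.toLinearMap_apply, comps_omegaMap]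
  refine lsum_map φ (fun n ω => ?_) _
  simpa using iAux_omegaMap φ n n ω 1

/-- The map `Ω̄ A → Ω̄ A'` induced by an algebra map. -/
def obarMap : Obar k A →ₗ[k] Obar k A' :=
  Submodule.mapQ _ _ (omegaMap φ).toLinearMap (by rintro _ ⟨c, rfl⟩; exact ⟨c, by simp⟩)

lemma obarMap_descend {T : Omega k A →ₗ[k] Omega k A} {T' : Omega k A' →ₗ[k] Omega k A'}
    {c c' : k} {h : T 1 = c • 1} {h' : T' 1 = c' • 1}
    (hT : ∀ ω, T' (omegaMap φ ω) = omegaMap φ (T ω)) :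
    obarMap φ ∘ₗ descend T c h = descend T' c' h' ∘ₗ obarMap φ := by
  refine LinearMap.ext fun x => ?_
  obtain ⟨ω, rfl⟩ := Submodule.mkQ_surjective _ x
  exact congrArg (toBar k A') (hT ω).symm

lemma obarMap_dBar : obarMap φ ∘ₗ dBar k A = dBar k A' ∘ₗ obarMap φ :=
  obarMap_descend φ (dOp_omegaMap φ)

lemma obarMap_bBar : obarMap φ ∘ₗ bBar k A = bBar k A' ∘ₗ obarMap φ :=
  obarMap_descend φ (bOp_omegaMap φ)

lemma obarMap_connesBBar : obarMap φ ∘ₗ connesBBar k A = connesBBar k A' ∘ₗ obarMap φ :=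
  obarMap_descend φ (connesB_omegaMap φ)

lemma obarMap_iBar : obarMap φ ∘ₗ iBar k A = iBar k A' ∘ₗ obarMap φ :=
  obarMap_descend φ (iOp_omegaMap φ)

end Functoriality

/-! ### Laurent series and the three complexes

Elements of `M((u))` are Hahn series over `ℤ`, the coefficient at `j` being that of `uʲ`. -/

section Series

variable {k : Type u} [CommRing k] {M N : Type*} [AddCommGroup M] [Module k M]
  [AddCommGroup N] [Module k N]

/-- Applying a linear map to all coefficients of a Laurent series. -/
def mapCoeff (f : M →ₗ[k] N) : HahnSeries ℤ M →ₗ[k] HahnSeries ℤ N where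
  toFun x := x.map f
  map_add' x y := by ext; simp
  map_smul' c x := by ext; simp

@[simp] lemma mapCoeff_coeff (f : M →ₗ[k] N) (x : HahnSeries ℤ M) (j : ℤ) :
    (mapCoeff f x).coeff j = f (x.coeff j) := rfl

variable (k M) in
/-- Multiplication by `u` on Laurent series. -/
def uMul : HahnSeries ℤ M →ₗ[k] HahnSeries ℤ M where
  toFun x :=
    { coeff := fun j => x.coeff (j - 1)
      isPWO_support' := by
        have h := x.isPWO_support.image_of_monotone (f := fun j : ℤ => j + 1)
          (fun a b hab => by simpa using hab)
        refine h.mono fun j hj => ⟨j - 1, hj, by simp⟩ }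
  map_add' x y := by ext; simp
  map_smul' c x := by ext; simp

@[simp] lemma uMul_coeff (x : HahnSeries ℤ M) (j : ℤ) :
    (uMul k M x).coeff j = x.coeff (j - 1) := rfl

variable (k M) in
/-- The submodule `uʳ M[[u]]` of `M((u))`. -/
def uPow (r : ℤ) : Submodule k (HahnSeries ℤ M) where
  carrier := {x | ∀ j < r, x.coeff j = 0}
  zero_mem' := by simp
  add_mem' hx hy j hj := by simp [hx j hj, hy j hj]
  smul_mem' c x hx j hj := by simp [hx j hj]

/-- The Laurent series whose coefficient at `uʲ` lies in `S j` for all `j`. -/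
def coeffSub (S : ℤ → Submodule k M) : Submodule k (HahnSeries ℤ M) where
  carrier := {x | ∀ j, x.coeff j ∈ S j}
  zero_mem' := by simp
  add_mem' hx hy j := by simpa using (S j).add_mem (hx j) (hy j)
  smul_mem' c x hx j := by simpa using (S j).smul_mem c (hx j)

lemma mapCoeff_uPow (f : M →ₗ[k] N) (r : ℤ) (x : HahnSeries ℤ M) (hx : x ∈ uPow k M r) :
    mapCoeff f x ∈ uPow k N r := fun j hj => by simp [hx j hj]

lemma uMul_uPow (r : ℤ) (x : HahnSeries ℤ M) (hx : x ∈ uPow k M r) :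
    uMul k M x ∈ uPow k M r := fun j hj => by simpa using hx (j - 1) (by omega)

/-- The differential `p - u q` on `M((u))`. -/
def diff (p q : M →ₗ[k] M) : HahnSeries ℤ M →ₗ[k] HahnSeries ℤ M :=
  mapCoeff p - uMul k M ∘ₗ mapCoeff q

lemma diff_uPow (p q : M →ₗ[k] M) (r : ℤ) (x : HahnSeries ℤ M) (hx : x ∈ uPow k M r) :
    diff p q x ∈ uPow k M r :=
  (uPow k M r).sub_mem (mapCoeff_uPow p r x hx) (uMul_uPow r _ (mapCoeff_uPow q r x hx))

/-- The map of the modules `M[[u]]` induced by a map of Laurent series preserving them. -/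
def onPow (T : HahnSeries ℤ M →ₗ[k] HahnSeries ℤ N)
    (hT : ∀ r, ∀ x ∈ uPow k M r, T x ∈ uPow k N r) : uPow k M 0 →ₗ[k] uPow k N 0 :=
  T.restrict (hT 0)

/-- The map of the modules `M ⊗ R = M((u)) / u M[[u]]`, where `R = k((u)) / u k[[u]]`, induced by
a map of Laurent series. -/
def onPol (T : HahnSeries ℤ M →ₗ[k] HahnSeries ℤ N)
    (hT : ∀ r, ∀ x ∈ uPow k M r, T x ∈ uPow k N r) :
    (HahnSeries ℤ M ⧸ uPow k M 1) →ₗ[k] (HahnSeries ℤ N ⧸ uPow k N 1) :=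
  Submodule.mapQ _ _ T (hT 1)

/-- The homology `ker D / im D` of a differential. -/
abbrev Homol {C : Type*} [AddCommGroup C] [Module k C] (D : C →ₗ[k] C) : Type _ :=
  LinearMap.ker D ⧸ (LinearMap.range D).submoduleOf (LinearMap.ker D)

/-- The map on homology induced by a chain map. -/
def Homol.map {C C' : Type*} [AddCommGroup C] [Module k C] [AddCommGroup C'] [Module k C']
    {D : C →ₗ[k] C} {D' : C' →ₗ[k] C'} (f : C →ₗ[k] C') (h : f ∘ₗ D = D' ∘ₗ f) :
    Homol D →ₗ[k] Homol D' :=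
  Submodule.mapQ _ _
    (f.restrict (p := LinearMap.ker D) (q := LinearMap.ker D') (fun x hx => by
      have e := LinearMap.congr_fun h x
      simp only [LinearMap.comp_apply, LinearMap.mem_ker.1 hx, map_zero] at e
      exact e.symm))
    (by
      rintro ⟨x, hx⟩ ⟨y, hy⟩
      refine ⟨f y, ?_⟩
      have e := LinearMap.congr_fun h y
      simp only [LinearMap.comp_apply, hy] at e
      exact e.symm)

/-- `x` is the homology class of the cycle `z`. -/
def IsClassOf {C : Type*} [AddCommGroup C] [Module k C] {D : C →ₗ[k] C} (x : Homol D) (z : C) :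
    Prop :=
  ∃ hz : z ∈ LinearMap.ker D, x = Submodule.Quotient.mk ⟨z, hz⟩

/-- The homology classes represented by cycles in the submodule `S`. -/
def Homol.part {C : Type*} [AddCommGroup C] [Module k C] (D : C →ₗ[k] C) (S : Submodule k C) :
    Submodule k (Homol D) :=
  (S.submoduleOf (LinearMap.ker D)).map (Submodule.mkQ _)

lemma mapCoeff_diff {p q : M →ₗ[k] M} {p' q' : N →ₗ[k] N} (f : M →ₗ[k] N)
    (hp : f ∘ₗ p = p' ∘ₗ f) (hq : f ∘ₗ q = q' ∘ₗ f) :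
    mapCoeff f ∘ₗ diff p q = diff p' q' ∘ₗ mapCoeff f := by
  refine LinearMap.ext fun x => ?_
  ext j
  have h₁ := LinearMap.congr_fun hp (x.coeff j)
  have h₂ := LinearMap.congr_fun hq (x.coeff (j - 1))
  simp only [LinearMap.comp_apply] at h₁ h₂
  simp [diff, h₁, h₂]

lemma uMul_diff (p q : M →ₗ[k] M) : uMul k M ∘ₗ diff p q = diff p q ∘ₗ uMul k M := by
  refine LinearMap.ext fun x => ?_
  ext j
  simp [diff]

section
variable (p q : M →ₗ[k] M)

/-- The differential `p - u q` on `M[[u]]`. -/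
abbrev diffPow : uPow k M 0 →ₗ[k] uPow k M 0 := onPow (diff p q) (diff_uPow p q)

/-- The differential `p - u q` on `M ⊗ R`. -/
abbrev diffPol : (HahnSeries ℤ M ⧸ uPow k M 1) →ₗ[k] (HahnSeries ℤ M ⧸ uPow k M 1) :=
  onPol (diff p q) (diff_uPow p q)

/-- `H (M((u)), p - u q)`. -/
abbrev HPer := Homol (diff p q)

/-- `H (M[[u]], p - u q)`. -/
abbrev HNeg := Homol (diffPow p q)

/-- `H (M ⊗ R, p - u q)`. -/
abbrev HOrd := Homol (diffPol p q)

/-- Multiplication by `u` on `H (M((u)), p - u q)`. -/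
def uPer : HPer p q →ₗ[k] HPer p q := Homol.map (uMul k M) (uMul_diff p q)

/-- Multiplication by `u` on `H (M[[u]], p - u q)`. -/
def uNeg : HNeg p q →ₗ[k] HNeg p q :=
  Homol.map (onPow (uMul k M) uMul_uPow) (by
    refine LinearMap.ext fun x => Subtype.ext ?_
    exact LinearMap.congr_fun (uMul_diff p q) x.1)

/-- Multiplication by `u` on `H (M ⊗ R, p - u q)`. -/
def uOrd : HOrd p q →ₗ[k] HOrd p q :=
  Homol.map (onPol (uMul k M) uMul_uPow) (by
    refine LinearMap.ext fun x => ?_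
    obtain ⟨x, rfl⟩ := Submodule.mkQ_surjective _ x
    exact congrArg (Submodule.mkQ _) (LinearMap.congr_fun (uMul_diff p q) x))

/-- The classes in `H (M((u)), p - u q)` of cycles with coefficient at `uʲ` in `S j`. -/
def partPer (S : ℤ → Submodule k M) : Submodule k (HPer p q) :=
  Homol.part (diff p q) (coeffSub S)

/-- The classes in `H (M[[u]], p - u q)` of cycles with coefficient at `uʲ` in `S j`. -/
def partNeg (S : ℤ → Submodule k M) : Submodule k (HNeg p q) :=
  Homol.part (diffPow p q) ((coeffSub S).submoduleOf (uPow k M 0))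

/-- The classes in `H (M ⊗ R, p - u q)` of cycles with coefficient at `uʲ` in `S j`. -/
def partOrd (S : ℤ → Submodule k M) : Submodule k (HOrd p q) :=
  Homol.part (diffPol p q) ((coeffSub S).map (uPow k M 1).mkQ)

end

section
variable {p q : M →ₗ[k] M} {p' q' : N →ₗ[k] N} (f : M →ₗ[k] N)
  (hp : f ∘ₗ p = p' ∘ₗ f) (hq : f ∘ₗ q = q' ∘ₗ f)

/-- Functoriality of `H (M((u)), p - u q)`. -/
def mapPer : HPer p q →ₗ[k] HPer p' q' := Homol.map (mapCoeff f) (mapCoeff_diff f hp hq)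

/-- Functoriality of `H (M[[u]], p - u q)`. -/
def mapNeg : HNeg p q →ₗ[k] HNeg p' q' :=
  Homol.map (onPow (mapCoeff f) (mapCoeff_uPow f)) (by
    refine LinearMap.ext fun x => Subtype.ext ?_
    exact LinearMap.congr_fun (mapCoeff_diff f hp hq) x.1)

/-- Functoriality of `H (M ⊗ R, p - u q)`. -/
def mapOrd : HOrd p q →ₗ[k] HOrd p' q' :=
  Homol.map (onPol (mapCoeff f) (mapCoeff_uPow f)) (by
    refine LinearMap.ext fun x => ?_
    obtain ⟨x, rfl⟩ := Submodule.mkQ_surjective _ x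
    exact congrArg (Submodule.mkQ _) (LinearMap.congr_fun (mapCoeff_diff f hp hq) x))

end

end Series

/-! ### Cyclic homology -/

section Cyclic

variable (k : Type u) [CommRing k] (A : Type v) [Ring A] [Algebra k A]

/-- Total degree `n`, where `u` has degree `-2`: the coefficient at `uʲ` has degree `n + 2 j`. -/
def totDeg (n : ℤ) : ℤ → Submodule k (Obar k A) := fun j => degBar k A (n + 2 * j)

/-- Reduced periodic cyclic homology `H (Ω̄((u)), b - u B)`. -/
abbrev HCper := HPer (bBar k A) (connesBBar k A)

/-- Reduced negative cyclic homology `H (Ω̄[[u]], b - u B)`. -/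
abbrev HCneg := HNeg (bBar k A) (connesBBar k A)

/-- Reduced cyclic homology `H (Ω̄ ⊗ R, b - u B)`. -/
abbrev HC := HOrd (bBar k A) (connesBBar k A)

/-- `H (Ω̄((u)), i - u d)`. -/
abbrev HRper := HPer (iBar k A) (dBar k A)

/-- `H (Ω̄[[u]], i - u d)`. -/
abbrev HRneg := HNeg (iBar k A) (dBar k A)

/-- `H (Ω̄ ⊗ R, i - u d)`. -/
abbrev HR := HOrd (iBar k A) (dBar k A)

variable {k A} {A' : Type v} [Ring A'] [Algebra k A'] (φ : A →ₐ[k] A')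

/-- Functoriality of `H (Ω̄((u)), b - u B)`. -/
abbrev HCper.map : HCper k A →ₗ[k] HCper k A' :=
  mapPer (obarMap φ) (obarMap_bBar φ) (obarMap_connesBBar φ)

/-- Functoriality of `H (Ω̄[[u]], b - u B)`. -/
abbrev HCneg.map : HCneg k A →ₗ[k] HCneg k A' :=
  mapNeg (obarMap φ) (obarMap_bBar φ) (obarMap_connesBBar φ)

/-- Functoriality of `H (Ω̄ ⊗ R, b - u B)`. -/
abbrev HC.map : HC k A →ₗ[k] HC k A' :=
  mapOrd (obarMap φ) (obarMap_bBar φ) (obarMap_connesBBar φ)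

/-- Functoriality of `H (Ω̄((u)), i - u d)`. -/
abbrev HRper.map : HRper k A →ₗ[k] HRper k A' :=
  mapPer (obarMap φ) (obarMap_iBar φ) (obarMap_dBar φ)

/-- Functoriality of `H (Ω̄[[u]], i - u d)`. -/
abbrev HRneg.map : HRneg k A →ₗ[k] HRneg k A' :=
  mapNeg (obarMap φ) (obarMap_iBar φ) (obarMap_dBar φ)

/-- Functoriality of `H (Ω̄ ⊗ R, i - u d)`. -/
abbrev HR.map : HR k A →ₗ[k] HR k A' :=
  mapOrd (obarMap φ) (obarMap_iBar φ) (obarMap_dBar φ)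

end Cyclic

end NCForms

end

/-! The Karoubi operator satisfies bd + db = 1 - κ, so it commutes with b and d. On forms of degree
n one also has κⁿ⁺¹ d = d and κⁿ - 1 = b κⁿ d, because κ rotates the differentials of a form
cyclically. Hence (κⁿ⁺¹ - 1)(κⁿ - 1) = 0 in degree n. Over ℚ the factor (X - 1)² splits off by
coprimality, which gives Ω̄ = ker (1 - κ)² ⊕ im (1 - κ)² (`KaroubiModule.isCompl`). The harmonic
projection P is, on each element, a polynomial in κ, and 1 - κ is invertible on antiharmonic forms.
The contraction is i = (1 + κ + ⋯ + κⁿ⁻¹) b in degree n (`iOp_of_mem_deg`), so all operators are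
expressed through b, d and κ. From there on the argument is about an abstract `KaroubiModule`.

On the harmonic part κ fixes the values of b and d, so that i = n b and B = (n + 1) d in degree n.
Dividing by n! in degree n turns (b, B) into (i, d) (`E_b`, `E_B`, `F_i`, `F_d`). On the
antiharmonic part i = B = 0, since both involve sums over a full period of κ. There b - uB is just
b, and it is contracted by d / (1 - κ) without any power of u (`b_G`); cyclic homology is therefore
purely harmonic in all three versions.

The differential i - ud is -ud on the antiharmonic part, and its contraction by b / (1 - κ) costs a
factor u⁻¹. Laurent series allow it, and the periodic theories agree. For power series the closed
antiharmonic constant terms survive (`range_negEmb`). Modulo u Ω̄[[u]] the antiharmonic constant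
terms survive modulo closed ones (`range_ordEmb`). In both cases what survives is d of the
antiharmonic forms. This is the image of [dΩ, dΩ], because (1 - κ)(w da) = [w, da] and [x, z] = (1 -
κⁿ)(xz) for exact x and z with z of degree n (`exactAnti_eq_commBar`).

For an arbitrary section s, the series ∑ u⁻ʲ (s i)ʲ s f and the constant series given by the
antiharmonic primitive of f have the same image -uf under i - ud in Laurent series. Their difference
is a Laurent cycle of bounded form degree. It is a boundary (`exists_diff_eq`), because the split
unit provides a contraction h of d on Ω̄, and u⁻¹ h contracts i - ud up to sign and up to the term
u⁻¹ (i h + h i), which lowers the degree of forms. -/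

noncomputable section

namespace NCForms

section Identities

variable (k : Type u) [CommRing k] (A : Type v) [Ring A] [Algebra k A]

/-! ### Words and the grading -/

@[simp] lemma word_nil : word k A [] = 1 := rfl

lemma word_cons (a : A) (l : List A) :
    word k A (a :: l) = dA k A (abar k A a) * word k A l := by simp [word]

lemma word_append (l l' : List A) : word k A (l ++ l') = word k A l * word k A l' := by
  simp [word]

lemma word_singleton (a : A) : word k A [a] = dA k A (abar k A a) := by simp [word]

lemma range_dA_pow (n : ℕ) :
    LinearMap.range (dA k A) ^ n = Submodule.span k {w | ∃ l : List A, l.length = n ∧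
      w = word k A l} := by
  induction n with
  | zero =>
    rw [pow_zero, Submodule.one_eq_span]
    congr 1
    ext w
    simp
  | succ n ih =>
    refine le_antisymm ?_ (Submodule.span_le.2 ?_)
    · rw [pow_succ', ih, Submodule.mul_le]
      rintro _ ⟨x, rfl⟩ t ht
      obtain ⟨a, rfl⟩ := Submodule.mkQ_surjective _ x
      refine (Submodule.span_le (p := (Submodule.span k _).comap
        (LinearMap.mulLeft k (dA k A (abar k A a))))).2 ?_ ht
      rintro _ ⟨l, rfl, rfl⟩
      exact Submodule.subset_span ⟨a :: l, rfl, (word_cons k A a l).symm⟩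
    · rintro _ ⟨l, hl, rfl⟩
      exact hl ▸ word_mem k A l

lemma deg_eq_span (n : ℕ) :
    deg k A n = Submodule.span k {w | ∃ (a : A) (l : List A), l.length = n ∧
      w = inc k A a * word k A l} := by
  refine le_antisymm ?_ (Submodule.span_le.2 ?_)
  · rw [deg, range_dA_pow, Submodule.mul_le]
    rintro _ ⟨a, rfl⟩ t ht
    refine (Submodule.span_le (p := (Submodule.span k _).comap
      (LinearMap.mulLeft k (inc k A a)))).2 ?_ ht
    rintro _ ⟨l, hl, rfl⟩
    exact Submodule.subset_span ⟨a, l, hl, rfl⟩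
  · rintro _ ⟨a, l, rfl, rfl⟩
    exact inc_mul_word_mem k A a l

variable {k A} in
lemma eq_of_mem_deg {N : Type*} [AddCommGroup N] [Module k N] {T T' : Omega k A →ₗ[k] N} {n : ℕ}
    (h : ∀ (a : A) (l : List A), l.length = n →
      T (inc k A a * word k A l) = T' (inc k A a * word k A l))
    {ω : Omega k A} (hω : ω ∈ deg k A n) : T ω = T' ω := by
  rw [deg_eq_span] at hω
  refine LinearMap.eqOn_span (f := T) (g := T') ?_ hω
  rintro _ ⟨a, l, hl, rfl⟩
  exact h a l hl

variable {k A} in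
lemma map_mem_of_mem_deg {N : Type*} [AddCommGroup N] [Module k N] {T : Omega k A →ₗ[k] N}
    {S : Submodule k N} {n : ℕ}
    (h : ∀ (a : A) (l : List A), l.length = n → T (inc k A a * word k A l) ∈ S)
    {ω : Omega k A} (hω : ω ∈ deg k A n) : T ω ∈ S := by
  rw [deg_eq_span] at hω
  refine (Submodule.span_le (p := S.comap T)).2 ?_ hω
  rintro _ ⟨a, l, hl, rfl⟩
  exact h a l hl

lemma range_dA_pow_le_deg (n : ℕ) : LinearMap.range (dA k A) ^ n ≤ deg k A n := by
  intro t ht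
  have h := Submodule.mul_mem_mul (M := LinearMap.range (inc k A).toLinearMap)
    (LinearMap.mem_range_self (inc k A).toLinearMap 1) ht
  rw [AlgHom.toLinearMap_apply, map_one, one_mul] at h
  exact h

lemma word_mem_deg (l : List A) : word k A l ∈ deg k A l.length :=
  range_dA_pow_le_deg k A _ (word_mem k A l)

lemma inc_mem_deg (a : A) : inc k A a ∈ deg k A 0 := by
  simpa using inc_mul_word_mem k A a []

lemma dA_mem_deg (x : Abar k A) : dA k A x ∈ deg k A 1 :=
  range_dA_pow_le_deg k A 1 (by simp)

/-- The Leibniz rule in the form dx · b = d(xb) - x · db moves a coefficient to the left past one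
differential. Multiplicativity of the grading rests on this. -/
lemma range_dA_pow_mul_le (n : ℕ) :
    LinearMap.range (dA k A) ^ n * LinearMap.range (inc k A).toLinearMap ≤ deg k A n := by
  induction n with
  | zero => simp [deg]
  | succ n ih =>
    have h₁ : LinearMap.range (dA k A) * LinearMap.range (inc k A).toLinearMap ≤
        LinearMap.range (inc k A).toLinearMap * LinearMap.range (dA k A) := by
      rw [Submodule.mul_le]
      rintro _ ⟨x, rfl⟩ _ ⟨b, rfl⟩
      obtain ⟨x, rfl⟩ := Submodule.mkQ_surjective _ x
      have e : dA k A (abar k A x) * inc k A b =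
          inc k A 1 * dA k A (abar k A (x * b)) - inc k A x * dA k A (abar k A b) := by
        rw [dA_mul]; simp
      change dA k A (abar k A x) * inc k A b ∈ _
      rw [e]
      exact Submodule.sub_mem _ (Submodule.mul_mem_mul ⟨_, rfl⟩ ⟨_, rfl⟩)
        (Submodule.mul_mem_mul ⟨_, rfl⟩ ⟨_, rfl⟩)
    calc LinearMap.range (dA k A) ^ (n + 1) * LinearMap.range (inc k A).toLinearMap
        = LinearMap.range (dA k A) ^ n *
          (LinearMap.range (dA k A) * LinearMap.range (inc k A).toLinearMap) := by
          rw [pow_succ, mul_assoc]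
      _ ≤ LinearMap.range (dA k A) ^ n *
          (LinearMap.range (inc k A).toLinearMap * LinearMap.range (dA k A)) := by gcongr
      _ = LinearMap.range (dA k A) ^ n *
          LinearMap.range (inc k A).toLinearMap * LinearMap.range (dA k A) := by rw [mul_assoc]
      _ ≤ deg k A n * LinearMap.range (dA k A) := by gcongr
      _ = deg k A (n + 1) := by rw [deg, deg, pow_succ, mul_assoc]

variable {k A} in
lemma mul_mem_deg {m n : ℕ} {α β : Omega k A} (hα : α ∈ deg k A m) (hβ : β ∈ deg k A n) :
    α * β ∈ deg k A (m + n) := by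
  have h : deg k A m * deg k A n ≤ deg k A (m + n) := by
    calc deg k A m * deg k A n
        = LinearMap.range (inc k A).toLinearMap * (LinearMap.range (dA k A) ^ m *
            LinearMap.range (inc k A).toLinearMap) * LinearMap.range (dA k A) ^ n := by
          simp only [deg, mul_assoc]
      _ ≤ LinearMap.range (inc k A).toLinearMap * deg k A m * LinearMap.range (dA k A) ^ n := by
          gcongr; exact range_dA_pow_mul_le k A m
      _ = (LinearMap.range (inc k A).toLinearMap * LinearMap.range (inc k A).toLinearMap) *
            LinearMap.range (dA k A) ^ (m + n) := by
          simp only [deg, mul_assoc, pow_add]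
      _ ≤ deg k A (m + n) := by
          rw [deg]
          gcongr
          rw [Submodule.mul_le]
          rintro _ ⟨a, rfl⟩ _ ⟨b, rfl⟩
          exact ⟨a * b, by simp⟩
  exact h (Submodule.mul_mem_mul hα hβ)

variable {k A} in
lemma mul_inc_mem_deg {n : ℕ} {α : Omega k A} (hα : α ∈ deg k A n) (a : A) :
    α * inc k A a ∈ deg k A n := by
  have h := mul_mem_deg hα (inc_mem_deg k A a)
  rwa [add_zero] at h

variable {k A} in
lemma inc_mul_mem_deg {n : ℕ} {α : Omega k A} (hα : α ∈ deg k A n) (a : A) :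
    inc k A a * α ∈ deg k A n := by
  have h := mul_mem_deg (inc_mem_deg k A a) hα
  rwa [zero_add] at h

lemma iSup_deg : ⨆ n, deg k A n = ⊤ := by
  refine eq_top_iff.2 fun ω _ => ?_
  induction ω using omega_induction with
  | hinc a => exact Submodule.mem_iSup_of_mem 0 (inc_mem_deg k A a)
  | hdA x => exact Submodule.mem_iSup_of_mem 1 (dA_mem_deg k A x)
  | hadd x y hx hy => exact add_mem (hx trivial) (hy trivial)
  | hmul x y hx hy =>
    have key : ∀ x ∈ ⨆ n, deg k A n, ∀ y ∈ ⨆ n, deg k A n, x * y ∈ ⨆ n, deg k A n := by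
      intro x hx y hy
      refine Submodule.iSup_induction _ (motive := fun x => x * y ∈ ⨆ n, deg k A n) hx
        (fun m x hx => ?_) (by simp) (fun x x' h h' => by rw [add_mul]; exact add_mem h h')
      refine Submodule.iSup_induction _ (motive := fun y => x * y ∈ ⨆ n, deg k A n) hy
        (fun n y hy => ?_) (by simp) (fun x x' h h' => by rw [mul_add]; exact add_mem h h')
      exact Submodule.mem_iSup_of_mem (m + n) (mul_mem_deg hx hy)
    exact key x (hx trivial) y (hy trivial)

variable {k A} in
/-- Linear maps on forms are determined by their values on the forms `a₀ da₁ ⋯ daₙ`. -/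
lemma linearMap_ext_word {N : Type*} [AddCommGroup N] [Module k N] {T T' : Omega k A →ₗ[k] N}
    (h : ∀ (a : A) (l : List A),
      T (inc k A a * word k A l) = T' (inc k A a * word k A l)) : T = T' := by
  have h' : ⨆ n, deg k A n ≤ LinearMap.eqLocus T T' :=
    iSup_le fun n ω hω => eq_of_mem_deg (fun a l _ => h a l) hω
  exact LinearMap.ext fun ω => h' (iSup_deg k A ▸ Submodule.mem_top)

lemma dOp_word (l : List A) : dOp k A (word k A l) = 0 := by
  induction l with
  | nil => exact dOp_one k A
  | cons a l ih => rw [word_cons, dOp_mul, dOp_dA, ih]; simp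

lemma dOp_inc_mul_word (a : A) (l : List A) :
    dOp k A (inc k A a * word k A l) = word k A (a :: l) := by
  rw [dOp_mul, dOp_inc, dOp_word, word_cons]; simp

variable {k A} in
lemma dOp_mem_pow {n : ℕ} {ω : Omega k A} (h : ω ∈ deg k A n) :
    dOp k A ω ∈ LinearMap.range (dA k A) ^ (n + 1) :=
  map_mem_of_mem_deg (fun a l hl => by
    rw [dOp_inc_mul_word, ← hl]
    exact word_mem k A (a :: l)) h

variable {k A} in
lemma dOp_mem_deg {n : ℕ} {ω : Omega k A} (h : ω ∈ deg k A n) : dOp k A ω ∈ deg k A (n + 1) :=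
  range_dA_pow_le_deg k A _ (dOp_mem_pow h)

lemma dOp_dOp : dOp k A ∘ₗ dOp k A = 0 :=
  linearMap_ext_word fun a l => by simp [dOp_inc_mul_word, dOp_word]

/-! ### The Hochschild differential and the Karoubi operator -/

lemma inc_mul_word_append (a c : A) (l : List A) :
    inc k A a * word k A (l ++ [c]) = inc k A a * word k A l * dA k A (abar k A c) := by
  rw [word_append, word_singleton, mul_assoc]

lemma bOp_inc_mul_word_append (a c : A) (l : List A) :
    bOp k A (inc k A a * word k A (l ++ [c])) = (-1 : k) ^ l.length •
      (inc k A a * word k A l * inc k A c - inc k A c * (inc k A a * word k A l)) := by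
  rw [inc_mul_word_append, bOp_mul_dA k A (inc_mul_word_mem k A a l)]

variable {k A} in
lemma bOp_mem_deg {n : ℕ} {ω : Omega k A} (h : ω ∈ deg k A (n + 1)) : bOp k A ω ∈ deg k A n := by
  refine map_mem_of_mem_deg (fun a l hl => ?_) h
  induction l using List.reverseRecOn with
  | nil => simp at hl
  | append_singleton l c _ =>
    obtain rfl : l.length = n := by simpa using hl
    rw [bOp_inc_mul_word_append]
    refine Submodule.smul_mem _ _ (Submodule.sub_mem _ ?_ ?_)
    · exact mul_inc_mem_deg (inc_mul_word_mem k A a l) c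
    · exact inc_mul_mem_deg (inc_mul_word_mem k A a l) c

lemma bOp_of_mem_deg_zero {ω : Omega k A} (h : ω ∈ deg k A 0) : bOp k A ω = 0 :=
  eq_of_mem_deg (T' := 0) (fun a l hl => by
    rw [List.length_eq_zero_iff.1 hl]; simp [bOp_inc]) h

/-- On α dc dx the square is, up to sign, [α, cx] - [αc, x] - [xα, c], and the six products cancel
in pairs. -/
lemma bOp_bOp : bOp k A ∘ₗ bOp k A = 0 := by
  refine linearMap_ext_word fun a l => ?_
  rw [LinearMap.comp_apply, LinearMap.zero_apply]
  induction l using List.reverseRecOn with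
  | nil => simp [bOp_inc]
  | append_singleton l x _ =>
    rw [bOp_inc_mul_word_append, map_smul]
    induction l using List.reverseRecOn with
    | nil => simp [← map_mul, ← map_sub, bOp_inc]
    | append_singleton l c _ =>
      obtain ⟨α, hα'⟩ : ∃ α, α = inc k A a * word k A l := ⟨_, rfl⟩
      have hα : α ∈ deg k A l.length := hα' ▸ inc_mul_word_mem k A a l
      rw [inc_mul_word_append, ← hα']
      -- The operator b is computed only on forms that end in a differential, so the trailing
      -- coefficient x is first moved inside.
      have e : α * dA k A (abar k A c) * inc k A x =
          α * dA k A (abar k A (c * x)) - α * inc k A c * dA k A (abar k A x) := by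
        rw [dA_mul, mul_add, mul_assoc, mul_assoc, add_sub_cancel_right]
      have h₁ : α * inc k A c ∈ deg k A l.length := mul_inc_mem_deg hα c
      have h₂ : inc k A x * α ∈ deg k A l.length := inc_mul_mem_deg hα x
      rw [e, ← mul_assoc, map_sub, map_sub, bOp_mul_dA k A hα, bOp_mul_dA k A h₁,
        bOp_mul_dA k A h₂, ← smul_sub, ← smul_sub]
      have : (α * inc k A (c * x) - inc k A (c * x) * α -
          (α * inc k A c * inc k A x - inc k A x * (α * inc k A c)) -
          (inc k A x * α * inc k A c - inc k A c * (inc k A x * α))) = 0 := by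
        simp only [map_mul, mul_assoc]; abel
      rw [this, smul_zero, smul_zero]

/-- On α dc the commutators [dα, c] coming from bd and from db have opposite signs. What remains is
the Leibniz term α dc minus the signed dc α. -/
lemma bOp_dOp_add :
    bOp k A ∘ₗ dOp k A + dOp k A ∘ₗ bOp k A = LinearMap.id - kappa k A := by
  refine linearMap_ext_word fun a l => ?_
  simp only [LinearMap.add_apply, LinearMap.comp_apply, LinearMap.sub_apply, LinearMap.id_apply]
  induction l using List.reverseRecOn with
  | nil =>
    have h := bOp_mul_dA k A (one_mem_deg k A) a
    rw [one_mul] at h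
    simp [bOp_inc, dOp_inc, kappa_inc, h]
  | append_singleton l c _ =>
    obtain ⟨α, hα'⟩ : ∃ α, α = inc k A a * word k A l := ⟨_, rfl⟩
    have hα : α ∈ deg k A l.length := hα' ▸ inc_mul_word_mem k A a l
    rw [inc_mul_word_append, ← hα']
    have hdα := dOp_mem_deg hα
    have e₁ : dOp k A (α * inc k A c) =
        dOp k A α * inc k A c + (-1 : k) ^ l.length • (α * dA k A (abar k A c)) := by
      rw [dOp_mul, dOp_inc, eps_of_mem_deg k A hα, smul_mul_assoc]
    have e₂ : dOp k A (inc k A c * α) =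
        dA k A (abar k A c) * α + inc k A c * dOp k A α := by
      rw [dOp_mul, dOp_inc, eps_inc]
    rw [dOp_mul, dOp_dA, mul_zero, add_zero, bOp_mul_dA k A hdα, bOp_mul_dA k A hα,
      kappa_mul_dA k A hα, map_smul, map_sub, e₁, e₂]
    rcases neg_one_pow_eq_or k l.length with h | h <;>
      simp only [pow_succ, h, mul_neg_one, neg_neg, one_smul, neg_smul] <;> abel

lemma kappa_eq : kappa k A = LinearMap.id - (bOp k A ∘ₗ dOp k A + dOp k A ∘ₗ bOp k A) := by
  rw [bOp_dOp_add]; simp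

lemma kappa_bOp (ω : Omega k A) : kappa k A (bOp k A ω) = bOp k A (kappa k A ω) := by
  have h (ω) : bOp k A (bOp k A ω) = 0 := LinearMap.congr_fun (bOp_bOp k A) ω
  rw [kappa_eq]
  simp [h]

/-- Rotating several differentials at once by a power of the Karoubi operator. -/
lemma kappa_pow_mul_word {p : ℕ} {β : Omega k A} (hβ : β ∈ deg k A p) (l : List A) :
    (kappa k A ^ l.length) (β * word k A l) =
      (-1 : k) ^ (l.length * (p + l.length + 1)) • (word k A l * β) := by
  induction l using List.reverseRecOn generalizing p β with
  | nil => simp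
  | append_singleton l c ih =>
    have h₁ : β * word k A l ∈ deg k A (p + l.length) := mul_mem_deg hβ (word_mem_deg k A l)
    have h₂ : dA k A (abar k A c) * β ∈ deg k A (1 + p) := mul_mem_deg (dA_mem_deg k A _) hβ
    rw [List.length_append, List.length_singleton, pow_succ, Module.End.mul_apply, word_append,
      word_singleton, ← mul_assoc, kappa_mul_dA k A h₁, map_smul, ← mul_assoc, ih h₂, smul_smul,
      ← pow_add, mul_assoc]
    congr 1
    rw [neg_one_pow_eq_pow_mod_two, neg_one_pow_eq_pow_mod_two (n := (_ + 1) * _)]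
    congr 1
    -- The exponent of the single rotation plus that of the induction hypothesis, now in degree p +
    -- 1, differs from the required one by 2.
    have : (l.length + 1) * (p + (l.length + 1) + 1) =
      (p + l.length + l.length * (1 + p + l.length + 1)) + 2 := by ring
    rw [this]; simp

lemma neg_one_pow_mul_succ (n : ℕ) : (-1 : k) ^ (n * (n + 1)) = 1 :=
  (Nat.even_mul_succ_self n).neg_one_pow

lemma kappa_pow_word (l : List A) : (kappa k A ^ l.length) (word k A l) = word k A l := by
  have h := kappa_pow_mul_word k A (one_mem_deg k A) l
  simpa [neg_one_pow_mul_succ] using h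

lemma kappa_pow_inc_mul_word (a : A) (l : List A) :
    (kappa k A ^ l.length) (inc k A a * word k A l) = word k A l * inc k A a := by
  have h := kappa_pow_mul_word k A (inc_mem_deg k A a) l
  simpa [neg_one_pow_mul_succ] using h

variable {k A} in
-- The form d ω is a combination of products of n + 1 differentials. Each application of κ rotates
-- such a product by one place, and the sign of a full turn is (-1)^((n+1)(n+2)) = 1.
lemma kappa_pow_dOp {n : ℕ} {ω : Omega k A} (h : ω ∈ deg k A n) :
    (kappa k A ^ (n + 1)) (dOp k A ω) = dOp k A ω :=
  eq_of_mem_deg (T := (kappa k A ^ (n + 1)) ∘ₗ dOp k A) (fun a l hl => by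
    subst hl
    rw [LinearMap.comp_apply, dOp_inc_mul_word]
    exact kappa_pow_word k A (a :: l)) h

variable {k A} in
-- After n rotations a₀ da₁ ⋯ daₙ becomes da₁ ⋯ daₙ a₀, so the left side is the commutator [da₁ ⋯
-- daₙ, a₀]. The same commutator is b of κⁿ (da₀ da₁ ⋯ daₙ) = ± da₁ ⋯ daₙ da₀.
lemma kappa_pow_sub {n : ℕ} {ω : Omega k A} (h : ω ∈ deg k A n) :
    (kappa k A ^ n) ω - ω = bOp k A ((kappa k A ^ n) (dOp k A ω)) :=
  eq_of_mem_deg (T := (kappa k A ^ n) - LinearMap.id)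
    (T' := bOp k A ∘ₗ (kappa k A ^ n) ∘ₗ dOp k A) (fun a l hl => by
    subst hl
    rw [LinearMap.sub_apply, LinearMap.id_apply, LinearMap.comp_apply, LinearMap.comp_apply,
      dOp_inc_mul_word, kappa_pow_inc_mul_word, word_cons,
      kappa_pow_mul_word k A (dA_mem_deg k A _), map_smul,
      bOp_mul_dA k A (word_mem_deg k A l), smul_smul, ← pow_add, Even.neg_one_pow, one_smul]
    -- The rotations contribute n (n + 2) to the exponent and b contributes n; the total is even.
    rw [← Nat.mul_succ]
    have : l.length * (1 + l.length + 1).succ = l.length * (l.length + 1) + 2 * l.length := by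
      simp only [Nat.succ_eq_add_one]; ring
    rw [this]
    exact (Nat.even_mul_succ_self _).add (even_two_mul _)) h

variable {k A} in
/-- The contraction is `(1 + κ + ⋯ + κⁿ⁻¹) b` on forms of degree `n`. -/
lemma iOp_of_mem_deg {n : ℕ} {ω : Omega k A} (h : ω ∈ deg k A n) :
    iOp k A ω = ∑ j ∈ Finset.range n, (kappa k A ^ j) (bOp k A ω) := by
  have hc : ∀ j (ω : Omega k A), (kappa k A ^ j) (bOp k A ω) = bOp k A ((kappa k A ^ j) ω) := by
    intro j
    induction j with
    | zero => simp
    | succ j ih => intro ω; rw [pow_succ, Module.End.mul_apply, kappa_bOp, ih]; rfl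
  simp only [hc]
  rw [← map_sum]
  refine eq_of_mem_deg (T' := bOp k A ∘ₗ ∑ j ∈ Finset.range n, kappa k A ^ j) (fun a l hl => ?_) h
    |>.trans (by simp)
  subst hl
  -- With b moved outside, the sum over ℓ is read backwards: the term in which m differentials
  -- follow a_ℓ corresponds to κᵐ, which brings these m differentials to the front and leaves da_ℓ
  -- last, ready for b.
  rw [iOp_word, LinearMap.comp_apply, LinearMap.sum_apply, map_sum,
    ← Finset.sum_range_reflect]
  refine Finset.sum_congr rfl fun m hm => ?_
  have hm := Finset.mem_range.1 hm
  obtain ⟨l₁, c, l₂, rfl, rfl⟩ : ∃ l₁ c l₂, l = l₁ ++ c :: l₂ ∧ l₂.length = m := by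
    refine ⟨l.take (l.length - 1 - m), l[l.length - 1 - m], l.drop (l.length - m), ?_, by
      rw [List.length_drop]; omega⟩
    have : l.length - m = l.length - 1 - m + 1 := by omega
    rw [this, List.getElem_cons_drop, List.take_append_drop]
  have hj : (l₁ ++ c :: l₂).length - 1 - l₂.length = l₁.length := by
    rw [List.length_append, List.length_cons]; omega
  have hd : (l₁ ++ c :: l₂).drop (l₁.length + 1) = l₂ := by
    rw [List.drop_append]; simp
  have hβ : inc k A a * word k A (l₁ ++ [c]) ∈ deg k A (l₁.length + 1) := by
    simpa using inc_mul_word_mem k A a (l₁ ++ [c])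
  have e : inc k A a * word k A (l₁ ++ c :: l₂) =
      inc k A a * word k A (l₁ ++ [c]) * word k A l₂ := by
    rw [mul_assoc, ← word_append]; simp
  have hα : word k A l₂ * inc k A a * word k A l₁ ∈ deg k A (l₂.length + 0 + l₁.length) :=
    mul_mem_deg (mul_mem_deg (word_mem_deg k A l₂) (inc_mem_deg k A a)) (word_mem_deg k A l₁)
  rw [hj, hd, e, kappa_pow_mul_word k A hβ, map_smul, inc_mul_word_append]
  have e' : word k A l₂ * (inc k A a * word k A l₁ * dA k A (abar k A c)) =
      word k A l₂ * inc k A a * word k A l₁ * dA k A (abar k A c) := by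
    simp only [mul_assoc]
  rw [e', bOp_mul_dA k A hα, smul_smul, ← pow_add, pow_succ, mul_neg_one, neg_smul, ← smul_neg,
    neg_sub]
  congr 1
  -- Both exponents are congruent to |l₁| |l₂| + |l₁| modulo 2. The additional sign in the
  -- definition of i has been used to exchange the two terms of the commutator.
  · rw [neg_one_pow_eq_pow_mod_two, neg_one_pow_eq_pow_mod_two (n := _ + (_ + _))]
    congr 1
    have h₁ : (l₁ ++ c :: l₂).length - 1 = l₁.length + l₂.length := by
      rw [List.length_append, List.length_cons]; omega
    rw [h₁]
    have h₂ := Nat.even_mul_succ_self l₁.length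
    have h₃ := Nat.even_mul_succ_self l₂.length
    rw [← Nat.ModEq, Nat.ModEq.comm]
    obtain ⟨x, hx⟩ := h₂
    obtain ⟨y, hy⟩ := h₃
    change (_ : ℕ) % 2 = _ % 2
    have e₁ : l₂.length * (l₁.length + 1 + l₂.length + 1) + (l₂.length + 0 + l₁.length) =
        l₁.length * l₂.length + l₂.length * (l₂.length + 1) + 2 * l₂.length + l₁.length := by ring
    have e₂ : l₁.length * (l₁.length + l₂.length) + l₁.length + l₁.length =
        l₁.length * l₂.length + l₁.length * (l₁.length + 1) + l₁.length := by ring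
    omega
  · simp [mul_assoc]

end Identities

/-! ### Modules with a Karoubi operator -/

/-- A graded module with the operators `κ, b, d, i, B` of noncommutative forms, and with the operators
`c` and `c'` which multiply by `1 / n!` and by `n!` in degree `n`. -/
structure KaroubiModule (k : Type*) [CommRing k] [Algebra ℚ k] (M : Type*) [AddCommGroup M]
    [Module k M] where
  (κ b d i B c c' : Module.End k M)
  V : ℕ → Submodule k M
  iSup_V : ⨆ n, V n = ⊤
  b_mem : ∀ {n x}, x ∈ V (n + 1) → b x ∈ V n
  b_zero : ∀ {x}, x ∈ V 0 → b x = 0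
  d_mem : ∀ {n x}, x ∈ V n → d x ∈ V (n + 1)
  bb : ∀ x, b (b x) = 0
  dd : ∀ x, d (d x) = 0
  bd : ∀ x, b (d x) + d (b x) = x - κ x
  κ_pow_d : ∀ {n x}, x ∈ V n → (κ ^ (n + 1)) (d x) = d x
  κ_pow_sub : ∀ {n x}, x ∈ V n → (κ ^ n) x - x = b ((κ ^ n) (d x))
  i_eq : ∀ {n x}, x ∈ V n → i x = ∑ j ∈ Finset.range n, (κ ^ j) (b x)
  B_eq : ∀ {n x}, x ∈ V n → B x = ∑ j ∈ Finset.range (n + 1), (κ ^ j) (d x)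
  c_eq : ∀ {n x}, x ∈ V n → c x = algebraMap ℚ k (n.factorial : ℚ)⁻¹ • x
  c'_eq : ∀ {n x}, x ∈ V n → c' x = algebraMap ℚ k (n.factorial : ℚ) • x

namespace KaroubiModule

variable {k : Type*} [CommRing k] [Algebra ℚ k] {M : Type*} [AddCommGroup M] [Module k M]
  {M' : Type*} [AddCommGroup M'] [Module k M'] (K : KaroubiModule k M) (K' : KaroubiModule k M')

/-- The operator `1 - κ`. -/
def y : Module.End k M := 1 - K.κ

lemma y_apply (x : M) : K.y x = x - K.κ x := rfl

lemma ext_V {N : Type*} [AddCommGroup N] [Module k N] {T T' : M →ₗ[k] N}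
    (h : ∀ n, ∀ x ∈ K.V n, T x = T' x) (x : M) : T x = T' x := by
  have h' : ⨆ n, K.V n ≤ LinearMap.eqLocus T T' := iSup_le fun n x hx => h n x hx
  exact h' (K.iSup_V ▸ Submodule.mem_top)

lemma κ_apply (x : M) : K.κ x = x - (K.b (K.d x) + K.d (K.b x)) := by rw [K.bd]; abel

lemma κ_b (x : M) : K.κ (K.b x) = K.b (K.κ x) := by simp [κ_apply, K.bb]

lemma κ_d (x : M) : K.κ (K.d x) = K.d (K.κ x) := by simp [κ_apply, K.dd]

lemma κ_pow_b (j : ℕ) (x : M) : (K.κ ^ j) (K.b x) = K.b ((K.κ ^ j) x) := by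
  induction j generalizing x with
  | zero => rfl
  | succ j ih => rw [pow_succ, Module.End.mul_apply, κ_b, ih]; rfl

lemma κ_pow_d' (j : ℕ) (x : M) : (K.κ ^ j) (K.d x) = K.d ((K.κ ^ j) x) := by
  induction j generalizing x with
  | zero => rfl
  | succ j ih => rw [pow_succ, Module.End.mul_apply, κ_d, ih]; rfl

lemma y_b (x : M) : K.y (K.b x) = K.b (K.y x) := by simp [y_apply, κ_b]

lemma y_d (x : M) : K.y (K.d x) = K.d (K.y x) := by simp [y_apply, κ_d]

lemma κ_mem {n : ℕ} {x : M} (hx : x ∈ K.V n) : K.κ x ∈ K.V n := by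
  rw [κ_apply]
  refine sub_mem hx (add_mem (K.b_mem (K.d_mem hx)) ?_)
  cases n with
  | zero => simp [K.b_zero hx]
  | succ n => exact K.d_mem (K.b_mem hx)

lemma κ_pow_mem (j : ℕ) {n : ℕ} {x : M} (hx : x ∈ K.V n) : (K.κ ^ j) x ∈ K.V n := by
  induction j with
  | zero => exact hx
  | succ j ih => rw [pow_succ', Module.End.mul_apply]; exact K.κ_mem ih

/-- Apply b to κⁿ - 1 = b κⁿ d and use b² = 0. This is the counterpart of `κ_pow_d` for b, with
period n in place of n + 1. -/
lemma κ_pow_b_of_mem {n : ℕ} {x : M} (hx : x ∈ K.V n) : (K.κ ^ n) (K.b x) = K.b x := by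
  have h := congrArg K.b (K.κ_pow_sub hx)
  rw [K.bb, map_sub, sub_eq_zero] at h
  rw [κ_pow_b, h]

/-! #### The harmonic decomposition -/

open Polynomial in
-- The geometric sum takes the value N at X = 1, and N is a unit in a ℚ-algebra.
lemma isCoprime_geom (N : ℕ) (hN : 0 < N) :
    IsCoprime (X - 1 : k[X]) (∑ j ∈ Finset.range N, X ^ j) := by
  -- The sum is regarded as a polynomial over k[X] and evaluated at the two elements X and 1 of
  -- k[X], which gives ∑ Xʲ - N = (X - 1) T.
  obtain ⟨T, hT⟩ := sub_dvd_eval_sub (X : k[X]) 1 (∑ j ∈ Finset.range N, X ^ j : k[X][X])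
  simp only [eval_finsetSum, eval_pow, eval_X, one_pow, Finset.sum_const, Finset.card_range,
    nsmul_eq_mul, mul_one] at hT
  have hu : (C (algebraMap ℚ k (N : ℚ)⁻¹) : k[X]) * (N : k[X]) = 1 := by
    rw [← map_natCast (C : k →+* k[X]), ← map_natCast (algebraMap ℚ k), ← map_mul, ← map_mul,
      inv_mul_cancel₀ (by positivity), map_one, map_one]
  refine ⟨-C (algebraMap ℚ k (N : ℚ)⁻¹) * T, C (algebraMap ℚ k (N : ℚ)⁻¹), ?_⟩
  linear_combination C (algebraMap ℚ k (N : ℚ)⁻¹) * hT + hu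

open Polynomial

lemma aeval_pow_sub (N : ℕ) (x : M) : aeval K.κ (X ^ N - 1 : k[X]) x = (K.κ ^ N) x - x := by
  simp

lemma y_eq_aeval : K.y = aeval K.κ (1 - X : k[X]) := by simp [y]

lemma y_sq_eq_aeval : K.y ^ 2 = aeval K.κ ((X - 1) ^ 2 : k[X]) := by
  rw [y_eq_aeval, ← map_pow]; congr 1; ring

lemma aeval_eq_zero_of_dvd {p q : k[X]} (h : p ∣ q) {x : M} (hx : aeval K.κ p x = 0) :
    aeval K.κ q x = 0 := by
  obtain ⟨r, rfl⟩ := h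
  rw [mul_comm, map_mul, Module.End.mul_apply, hx, map_zero]

lemma aeval_mem {W : Submodule k M} (hW : ∀ x ∈ W, K.κ x ∈ W) (p : k[X]) {x : M} (hx : x ∈ W) :
    aeval K.κ p x ∈ W := by
  induction p using Polynomial.induction_on generalizing x with
  | C a => simpa [Module.algebraMap_end_apply] using W.smul_mem a hx
  | add p q hp hq => rw [map_add]; exact W.add_mem (hp hx) (hq hx)
  | monomial n a h =>
    rw [pow_succ, ← mul_assoc, map_mul, aeval_X]
    exact h (hW x hx)

lemma pow_sub_one_dvd {R : Type*} [CommRing R] {m n : ℕ} (h : m ∣ n) : (X ^ m - 1 : R[X]) ∣ X ^ n - 1 := by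
  obtain ⟨r, rfl⟩ := h
  simpa [pow_mul] using sub_dvd_pow_sub_pow (X ^ m : R[X]) 1 r

/-- In degree n > 0 the product (κⁿ⁺¹ - 1)(κⁿ - 1) vanishes, and N = n (n + 1) is a common multiple
of the two exponents. The uniform shape (X ^ N - 1)² passes to sums by multiplying the exponents. -/
lemma exists_pow_sq (x : M) : ∃ N > 0, aeval K.κ ((X ^ N - 1) ^ 2 : k[X]) x = 0 := by
  have hx : x ∈ ⨆ n, K.V n := K.iSup_V ▸ Submodule.mem_top
  refine Submodule.iSup_induction _
    (motive := fun x => ∃ N > 0, aeval K.κ ((X ^ N - 1) ^ 2 : k[X]) x = 0) hx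
    (fun n x hx => ?_) ⟨1, one_pos, map_zero _⟩ ?_
  · rcases n.eq_zero_or_pos with rfl | hn
    · refine ⟨1, one_pos, ?_⟩
      -- In degree 0 the relation κ⁰ - 1 = b d says only that b d x = x - x. With N = 1 one uses
      -- instead that (1 - κ) x = b d x and that κ fixes d x.
      have h := K.κ_pow_d hx
      simp only [zero_add, pow_one] at h
      have hκ : K.κ x = x - K.b (K.d x) := by rw [κ_apply, K.b_zero hx]; simp
      simp [sq, hκ, κ_b, h]
    · refine ⟨n * (n + 1), by positivity, ?_⟩
      refine K.aeval_eq_zero_of_dvd (p := (X ^ (n + 1) - 1) * (X ^ n - 1)) ?_ ?_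
      · rw [sq]
        exact mul_dvd_mul (pow_sub_one_dvd ⟨n, mul_comm _ _⟩) (pow_sub_one_dvd ⟨n + 1, rfl⟩)
      · rw [map_mul, Module.End.mul_apply, K.aeval_pow_sub n, K.κ_pow_sub hx, aeval_pow_sub, κ_pow_b,
          κ_pow_d', K.κ_pow_d (K.κ_pow_mem n hx), sub_self]
  · rintro x z ⟨N, hN, hx⟩ ⟨N', hN', hz⟩
    refine ⟨N * N', by positivity, ?_⟩
    rw [map_add, K.aeval_eq_zero_of_dvd (pow_dvd_pow_of_dvd (pow_sub_one_dvd ⟨N', rfl⟩) 2) hx,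
      K.aeval_eq_zero_of_dvd (pow_dvd_pow_of_dvd (pow_sub_one_dvd ⟨N, mul_comm _ _⟩) 2) hz, add_zero]

/-- A decomposition of the identity on `x` by coprime polynomials in `κ`. -/
lemma exists_bezout (x : M) : ∃ p q : k[X], p * (X - 1) ^ 2 + q = 1 ∧
    aeval K.κ (q * (X - 1) ^ 2) x = 0 := by
  obtain ⟨N, hN, h⟩ := K.exists_pow_sq x
  obtain ⟨p, q, hpq⟩ := (isCoprime_geom (k := k) N hN).pow (m := 2) (n := 2)
  -- The second summand is a multiple of the square of the geometric sum, so its product with (X -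
  -- 1)² is a multiple of (X ^ N - 1)².
  refine ⟨p, _, hpq, K.aeval_eq_zero_of_dvd ?_ h⟩
  rw [mul_assoc, ← mul_pow, geom_sum_mul]
  exact Dvd.intro_left _ rfl

/-- Harmonic elements. -/
def harmonic : Submodule k M := LinearMap.ker (K.y ^ 2)

/-- Antiharmonic elements. -/
def antiharmonic : Submodule k M := LinearMap.range (K.y ^ 2)

/-- The exponent N depends on the element, so there is no uniform Bezout identity. One identity p (κ
- 1)² + q = 1 per element suffices: q x is harmonic and the other summand is antiharmonic, while on
a common element (1 - κ)² z both summands vanish. -/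
lemma isCompl : IsCompl K.harmonic K.antiharmonic := by
  constructor
  · rw [Submodule.disjoint_def]
    rintro _ hx ⟨z, rfl⟩
    obtain ⟨p, q, h, h'⟩ := K.exists_bezout z
    rw [harmonic, LinearMap.mem_ker] at hx
    rw [map_mul, ← y_sq_eq_aeval, Module.End.mul_apply] at h'
    have e := LinearMap.congr_fun (congrArg (aeval K.κ) h) ((K.y ^ 2) z)
    rw [map_add, map_mul, ← y_sq_eq_aeval, LinearMap.add_apply, Module.End.mul_apply, hx, h'] at e
    simpa using e.symm
  · rw [codisjoint_iff, eq_top_iff]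
    intro x _
    obtain ⟨p, q, h, h'⟩ := K.exists_bezout x
    have e := LinearMap.congr_fun (congrArg (aeval K.κ) h) x
    rw [map_add, map_one, LinearMap.add_apply, Module.End.one_apply] at e
    rw [← e, add_comm]
    refine Submodule.add_mem_sup ?_ ⟨aeval K.κ p x, ?_⟩
    · rw [harmonic, LinearMap.mem_ker, y_sq_eq_aeval, ← Module.End.mul_apply, ← map_mul, mul_comm]
      exact h'
    · rw [y_sq_eq_aeval, ← Module.End.mul_apply, ← map_mul, mul_comm]

/-- The harmonic projection. -/
def P : Module.End k M := K.harmonic.projection K.antiharmonic K.isCompl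

lemma P_mem (x : M) : K.P x ∈ K.harmonic := Submodule.projection_apply_mem _ _

lemma P_of_mem {x : M} (hx : x ∈ K.harmonic) : K.P x = x :=
  (Submodule.projection_eq_self_iff _ _).2 hx

lemma P_of_mem_antiharmonic {x : M} (hx : x ∈ K.antiharmonic) : K.P x = 0 :=
  (Submodule.projection_apply_eq_zero_iff _).2 hx

lemma P_eq_zero_iff {x : M} : K.P x = 0 ↔ x ∈ K.antiharmonic :=
  Submodule.projection_apply_eq_zero_iff _

lemma P_P (x : M) : K.P (K.P x) = K.P x := K.P_of_mem (K.P_mem x)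

lemma sub_P_mem (x : M) : x - K.P x ∈ K.antiharmonic := by
  rw [← P_eq_zero_iff, map_sub, P_P, sub_self]

lemma P_eq_of {x h a : M} (hh : h ∈ K.harmonic) (ha : a ∈ K.antiharmonic) (e : h + a = x) :
    K.P x = h := by
  rw [← e, map_add, K.P_of_mem hh, K.P_of_mem_antiharmonic ha, add_zero]

/-- By the Bezout identity P x = q(κ) x for some polynomial q depending on x. The main use is that P
preserves degrees. -/
lemma P_mem_of_mem {W : Submodule k M} (hW : ∀ x ∈ W, K.κ x ∈ W) {x : M} (hx : x ∈ W) :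
    K.P x ∈ W := by
  obtain ⟨p, q, h, h'⟩ := K.exists_bezout x
  have e := LinearMap.congr_fun (congrArg (aeval K.κ) h) x
  rw [map_add, map_one, LinearMap.add_apply, Module.End.one_apply, add_comm] at e
  rw [K.P_eq_of ?_ ?_ e]
  · exact K.aeval_mem hW q hx
  · rw [harmonic, LinearMap.mem_ker, y_sq_eq_aeval, ← Module.End.mul_apply, ← map_mul, mul_comm]
    exact h'
  · exact ⟨aeval K.κ p x, by rw [y_sq_eq_aeval, ← Module.End.mul_apply, ← map_mul, mul_comm]⟩

variable {K K'} in
/-- The harmonic projection commutes with the maps which commute with `κ`. -/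
lemma P_comm {f : M →ₗ[k] M'} (hf : ∀ x, f (K.κ x) = K'.κ (f x)) (x : M) :
    f (K.P x) = K'.P (f x) := by
  have hy (x) : f (K.y x) = K'.y (f x) := by simp [y_apply, hf]
  refine (K'.P_eq_of (a := f (x - K.P x)) ?_ ?_ (by rw [← map_add]; simp)).symm
  · have h := K.P_mem x
    rw [harmonic, LinearMap.mem_ker, sq, Module.End.mul_apply] at h ⊢
    rw [← hy, ← hy, h, map_zero]
  · obtain ⟨z, hz⟩ := K.sub_P_mem x
    refine ⟨f z, ?_⟩
    rw [← hz, sq, sq, Module.End.mul_apply, Module.End.mul_apply, hy, hy]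

lemma P_b (x : M) : K.P (K.b x) = K.b (K.P x) := (P_comm (fun x => (K.κ_b x).symm) x).symm

lemma P_d (x : M) : K.P (K.d x) = K.d (K.P x) := (P_comm (fun x => (K.κ_d x).symm) x).symm

lemma P_κ (x : M) : K.P (K.κ x) = K.κ (K.P x) := (P_comm (f := K.κ) (fun _ => rfl) x).symm

lemma P_y (x : M) : K.P (K.y x) = K.y (K.P x) := by simp [y_apply, P_κ]

lemma y_mem_antiharmonic {x : M} (hx : x ∈ K.antiharmonic) : K.y x ∈ K.antiharmonic := by
  rw [← P_eq_zero_iff] at hx ⊢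
  rw [P_y, hx, map_zero]

lemma d_mem_antiharmonic {x : M} (hx : x ∈ K.antiharmonic) : K.d x ∈ K.antiharmonic := by
  rw [← P_eq_zero_iff] at hx ⊢
  rw [P_d, hx, map_zero]

lemma eq_zero_of_y {x : M} (hx : x ∈ K.antiharmonic) (h : K.y x = 0) : x = 0 := by
  rw [← K.P_of_mem_antiharmonic hx]
  refine (K.P_of_mem ?_).symm
  rw [harmonic, LinearMap.mem_ker, sq, Module.End.mul_apply, h, map_zero]

/-- The operator `1 - κ` is invertible on antiharmonic elements. -/
def yEquiv : K.antiharmonic ≃ₗ[k] K.antiharmonic :=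
  LinearEquiv.ofBijective (K.y.restrict fun _ => K.y_mem_antiharmonic) (by
    constructor
    · rw [injective_iff_map_eq_zero]
      rintro ⟨x, hx⟩ h
      exact Subtype.ext (K.eq_zero_of_y hx (congrArg Subtype.val h))
    · rintro ⟨_, ⟨z, rfl⟩⟩
      -- The obvious preimage (1 - κ) z of (1 - κ)² z need not be antiharmonic. Subtracting the
      -- harmonic part of z repairs this and does not change (1 - κ)² z.
      refine ⟨⟨K.y (z - K.P z), K.y_mem_antiharmonic (K.sub_P_mem z)⟩, Subtype.ext ?_⟩
      have h := K.P_mem z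
      rw [harmonic, LinearMap.mem_ker, sq, Module.End.mul_apply] at h
      change K.y (K.y (z - K.P z)) = _
      rw [map_sub, map_sub, h, sub_zero]
      rfl)

/-- The inverse of `1 - κ` on antiharmonic elements, zero on harmonic elements. -/
def Y : Module.End k M :=
  K.antiharmonic.subtype ∘ₗ K.yEquiv.symm.toLinearMap ∘ₗ
    (LinearMap.id - K.P).codRestrict K.antiharmonic K.sub_P_mem

lemma Y_mem (x : M) : K.Y x ∈ K.antiharmonic := Subtype.property _

lemma y_Y (x : M) : K.y (K.Y x) = x - K.P x :=
  congrArg Subtype.val (K.yEquiv.apply_symm_apply ⟨x - K.P x, K.sub_P_mem x⟩)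

lemma Y_y (x : M) : K.Y (K.y x) = x - K.P x := by
  rw [← sub_eq_zero]
  refine K.eq_zero_of_y (sub_mem (K.Y_mem _) (K.sub_P_mem x)) ?_
  rw [map_sub, y_Y, map_sub, P_y, sub_self]

lemma Y_P (x : M) : K.Y (K.P x) = 0 :=
  K.eq_zero_of_y (K.Y_mem _) (by rw [y_Y, P_P, sub_self])

variable {K K'} in
lemma Y_comm {f : M →ₗ[k] M'} (hf : ∀ x, f (K.κ x) = K'.κ (f x)) (x : M) :
    f (K.Y x) = K'.Y (f x) := by
  have hy (x) : f (K.y x) = K'.y (f x) := by simp [y_apply, hf]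
  have h : f (K.Y x) ∈ K'.antiharmonic := by
    rw [← P_eq_zero_iff, ← P_comm hf, K.P_of_mem_antiharmonic (K.Y_mem x), map_zero]
  rw [← sub_eq_zero]
  refine K'.eq_zero_of_y (sub_mem h (K'.Y_mem _)) ?_
  rw [map_sub, y_Y, ← hy, y_Y, map_sub, P_comm hf, sub_self]

lemma Y_b (x : M) : K.Y (K.b x) = K.b (K.Y x) := (Y_comm (fun x => (K.κ_b x).symm) x).symm

lemma Y_d (x : M) : K.Y (K.d x) = K.d (K.Y x) := (Y_comm (fun x => (K.κ_d x).symm) x).symm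

/-! #### The operators on harmonic and on antiharmonic elements -/

/-- The ideal generated by (X - 1)² and X ^ N - 1 contains X - 1, because X - 1 is coprime to the
geometric sum. -/
lemma y_eq_zero_of_pow {N : ℕ} (hN : 0 < N) {x : M} (h : (K.y ^ 2) x = 0)
    (hx : (K.κ ^ N) x = x) : K.y x = 0 := by
  obtain ⟨p, q, hpq⟩ := isCoprime_geom (k := k) N hN
  have e := LinearMap.congr_fun (congrArg (aeval K.κ) hpq) (K.y x)
  rw [map_add, map_one, LinearMap.add_apply, Module.End.one_apply] at e
  rw [← e, y_eq_aeval, ← Module.End.mul_apply, ← Module.End.mul_apply, ← map_mul, ← map_mul,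
    K.aeval_eq_zero_of_dvd (p := (X - 1) ^ 2) ⟨-p, by ring⟩ (by rw [← y_sq_eq_aeval, h]),
    K.aeval_eq_zero_of_dvd (p := X ^ N - 1) ⟨-q, by rw [← geom_sum_mul]; ring⟩
      (by rw [aeval_pow_sub, hx, sub_self]), add_zero]

/-- For harmonic x the element d x is killed by (1 - κ)² and has finite period under κ, hence is
fixed by κ. This and the analogue for b collapse the sums that define B and i. -/
lemma y_d_of_mem {n : ℕ} {x : M} (hx : x ∈ K.V n) (h : x ∈ K.harmonic) : K.y (K.d x) = 0 := by
  refine K.y_eq_zero_of_pow n.succ_pos ?_ (K.κ_pow_d hx)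
  rw [harmonic, LinearMap.mem_ker, sq, Module.End.mul_apply] at h
  rw [sq, Module.End.mul_apply, y_d, y_d, h, map_zero]

lemma y_b_of_mem {n : ℕ} {x : M} (hx : x ∈ K.V n) (h : x ∈ K.harmonic) : K.y (K.b x) = 0 := by
  -- The period n carries no information in degree 0, where b vanishes anyway.
  rcases n.eq_zero_or_pos with rfl | hn
  · rw [K.b_zero hx, map_zero]
  · refine K.y_eq_zero_of_pow hn ?_ (K.κ_pow_b_of_mem hx)
    rw [harmonic, LinearMap.mem_ker, sq, Module.End.mul_apply] at h
    rw [sq, Module.End.mul_apply, y_b, y_b, h, map_zero]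

lemma P_mem_V {n : ℕ} {x : M} (hx : x ∈ K.V n) : K.P x ∈ K.V n :=
  K.P_mem_of_mem (fun _ => K.κ_mem) hx

lemma y_d_P (x : M) : K.y (K.d (K.P x)) = 0 :=
  K.ext_V (T := K.y ∘ₗ K.d ∘ₗ K.P) (T' := 0)
    (fun _ _ hx => K.y_d_of_mem (K.P_mem_V hx) (K.P_mem _)) x

lemma sum_pow_of_y {x : M} (h : K.y x = 0) (n : ℕ) :
    ∑ j ∈ Finset.range n, (K.κ ^ j) x = algebraMap ℚ k n • x := by
  have hκ : K.κ x = x := by rw [y_apply, sub_eq_zero] at h; exact h.symm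
  have hj (j : ℕ) : (K.κ ^ j) x = x := by
    induction j with
    | zero => rfl
    | succ j ih => rw [pow_succ, Module.End.mul_apply, hκ, ih]
  simp [hj, Nat.cast_smul_eq_nsmul]

lemma i_of_mem {n : ℕ} {x : M} (hx : x ∈ K.V n) (h : x ∈ K.harmonic) :
    K.i x = algebraMap ℚ k n • K.b x := by
  rw [K.i_eq hx, K.sum_pow_of_y (K.y_b_of_mem hx h)]

lemma B_of_mem {n : ℕ} {x : M} (hx : x ∈ K.V n) (h : x ∈ K.harmonic) :
    K.B x = algebraMap ℚ k (n + 1 : ℕ) • K.d x := by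
  rw [K.B_eq hx, K.sum_pow_of_y (K.y_d_of_mem hx h)]

lemma sum_pow_y (n : ℕ) (x : M) :
    ∑ j ∈ Finset.range n, (K.κ ^ j) (K.y x) = x - (K.κ ^ n) x := by
  have h := LinearMap.congr_fun (geom_sum_mul_neg K.κ n) x
  simpa [Module.End.mul_apply, LinearMap.sum_apply, y_apply] using h

lemma y_sum_pow (n : ℕ) (x : M) :
    K.y (∑ j ∈ Finset.range n, (K.κ ^ j) x) = x - (K.κ ^ n) x := by
  have h := LinearMap.congr_fun (mul_neg_geom_sum K.κ n) x
  simpa [Module.End.mul_apply, LinearMap.sum_apply, y_apply] using h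

/-- The sum over a full period telescopes: ∑ κʲ (1 - κ) b = (1 - κⁿ) b = 0 in degree n. With the
three variants below, i and B vanish on the antiharmonic part and take harmonic values. -/
lemma i_y (x : M) : K.i (K.y x) = 0 :=
  K.ext_V (T := K.i ∘ₗ K.y) (T' := 0) (fun n x hx => by
    have h : K.y x ∈ K.V n := sub_mem hx (K.κ_mem hx)
    rw [LinearMap.comp_apply, K.i_eq h]
    simp only [← K.y_b]
    rw [sum_pow_y, K.κ_pow_b_of_mem hx, sub_self, LinearMap.zero_apply]) x

lemma y_i (x : M) : K.y (K.i x) = 0 :=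
  K.ext_V (T := K.y ∘ₗ K.i) (T' := 0) (fun n x hx => by
    rw [LinearMap.comp_apply, K.i_eq hx, y_sum_pow, K.κ_pow_b_of_mem hx, sub_self,
      LinearMap.zero_apply]) x

lemma B_y (x : M) : K.B (K.y x) = 0 :=
  K.ext_V (T := K.B ∘ₗ K.y) (T' := 0) (fun n x hx => by
    have h : K.y x ∈ K.V n := sub_mem hx (K.κ_mem hx)
    rw [LinearMap.comp_apply, K.B_eq h]
    simp only [← K.y_d]
    rw [sum_pow_y, K.κ_pow_d hx, sub_self, LinearMap.zero_apply]) x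

lemma y_B (x : M) : K.y (K.B x) = 0 :=
  K.ext_V (T := K.y ∘ₗ K.B) (T' := 0) (fun n x hx => by
    rw [LinearMap.comp_apply, K.B_eq hx, y_sum_pow, K.κ_pow_d hx, sub_self,
      LinearMap.zero_apply]) x

lemma i_antiharmonic {x : M} (hx : x ∈ K.antiharmonic) : K.i x = 0 := by
  obtain ⟨z, rfl⟩ := hx
  rw [sq, Module.End.mul_apply, i_y]

lemma B_antiharmonic {x : M} (hx : x ∈ K.antiharmonic) : K.B x = 0 := by
  obtain ⟨z, rfl⟩ := hx
  rw [sq, Module.End.mul_apply, B_y]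

lemma P_i (x : M) : K.P (K.i x) = K.i x :=
  K.P_of_mem (by rw [harmonic, LinearMap.mem_ker, sq, Module.End.mul_apply, y_i, map_zero])

lemma P_B (x : M) : K.P (K.B x) = K.B x :=
  K.P_of_mem (by rw [harmonic, LinearMap.mem_ker, sq, Module.End.mul_apply, y_B, map_zero])

lemma i_P (x : M) : K.i (K.P x) = K.i x := by
  have h := K.i_antiharmonic (K.sub_P_mem x)
  rw [map_sub, sub_eq_zero] at h
  exact h.symm

lemma B_P (x : M) : K.B (K.P x) = K.B x := by
  have h := K.B_antiharmonic (K.sub_P_mem x)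
  rw [map_sub, sub_eq_zero] at h
  exact h.symm

lemma i_mem {n : ℕ} {x : M} (hx : x ∈ K.V (n + 1)) : K.i x ∈ K.V n := by
  rw [K.i_eq hx]
  exact sum_mem fun j _ => K.κ_pow_mem j (K.b_mem hx)

lemma i_zero {x : M} (hx : x ∈ K.V 0) : K.i x = 0 := by simp [K.i_eq hx]

lemma i_i (x : M) : K.i (K.i x) = 0 :=
  K.ext_V (T := K.i ∘ₗ K.i) (T' := 0) (fun n x hx => by
    cases n with
    | zero => simp [K.i_zero hx]
    | succ n =>
      rw [LinearMap.comp_apply, K.i_eq (K.i_mem hx), K.i_eq hx, map_sum]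
      simp [κ_pow_b, K.bb]) x

lemma B_B (x : M) : K.B (K.B x) = 0 :=
  K.ext_V (T := K.B ∘ₗ K.B) (T' := 0) (fun n x hx => by
    have h : K.B x ∈ K.V (n + 1) := by
      rw [K.B_eq hx]
      exact sum_mem fun j _ => K.κ_pow_mem j (K.d_mem hx)
    rw [LinearMap.comp_apply, K.B_eq h, K.B_eq hx, map_sum]
    simp [κ_pow_d', K.dd]) x

/-- In degree n the sum for i d has one term more than that for d i. The first n terms pair to ∑ κʲ
(bd + db) = ∑ κʲ (1 - κ) = 1 - κⁿ, and the remaining κⁿ b d = b κⁿ d equals κⁿ - 1. -/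
lemma i_d (x : M) : K.i (K.d x) + K.d (K.i x) = 0 :=
  K.ext_V (T := K.i ∘ₗ K.d + K.d ∘ₗ K.i) (T' := 0) (fun n x hx => by
    have h₁ := K.κ_pow_sub hx
    have h₂ := K.sum_pow_y n x
    rw [LinearMap.add_apply, LinearMap.comp_apply, LinearMap.comp_apply, LinearMap.zero_apply,
      K.i_eq (K.d_mem hx), K.i_eq hx, map_sum, Finset.sum_range_succ]
    simp only [← K.κ_pow_d'] at *
    rw [add_right_comm, ← Finset.sum_add_distrib]
    simp only [← map_add, K.bd, ← K.y_apply]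
    rw [h₂, κ_pow_b, ← h₁]; abel) x

/-- The cancellation is the one of `i_d`: here b B carries the extra term b κⁿ d. -/
lemma b_B (x : M) : K.b (K.B x) + K.B (K.b x) = 0 :=
  K.ext_V (T := K.b ∘ₗ K.B + K.B ∘ₗ K.b) (T' := 0) (fun n x hx => by
    have h₁ := K.κ_pow_sub hx
    have h₂ := K.sum_pow_y n x
    have h₃ : K.B (K.b x) = ∑ j ∈ Finset.range n, (K.κ ^ j) (K.d (K.b x)) := by
      cases n with
      | zero => simp [K.b_zero hx]
      | succ n => rw [K.B_eq (K.b_mem hx)]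
    rw [LinearMap.add_apply, LinearMap.comp_apply, LinearMap.comp_apply, LinearMap.zero_apply,
      K.B_eq hx, h₃, map_sum, Finset.sum_range_succ]
    simp only [← K.κ_pow_b] at *
    rw [add_right_comm, ← Finset.sum_add_distrib]
    simp only [← map_add, K.bd, ← K.y_apply]
    rw [h₂, ← h₁]; abel) x

/-! #### The comparison of the pairs `(b, B)` and `(i, d)` -/

lemma c_mem {n : ℕ} {x : M} (hx : x ∈ K.V n) : K.c x ∈ K.V n := by
  rw [K.c_eq hx]; exact Submodule.smul_mem _ _ hx

lemma c'_mem {n : ℕ} {x : M} (hx : x ∈ K.V n) : K.c' x ∈ K.V n := by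
  rw [K.c'_eq hx]; exact Submodule.smul_mem _ _ hx

lemma algebraMap_factorial_smul (n : ℕ) (x : M) :
    algebraMap ℚ k (n.factorial : ℚ)⁻¹ • algebraMap ℚ k (n.factorial : ℚ) • x = x := by
  rw [smul_smul, ← map_mul, inv_mul_cancel₀ (by positivity), map_one, one_smul]

lemma c_c' (x : M) : K.c (K.c' x) = x :=
  K.ext_V (T := K.c ∘ₗ K.c') (T' := LinearMap.id) (fun n x hx => by
    rw [LinearMap.comp_apply, K.c_eq (K.c'_mem hx), K.c'_eq hx, algebraMap_factorial_smul,
      LinearMap.id_apply]) x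

lemma c'_c (x : M) : K.c' (K.c x) = x :=
  K.ext_V (T := K.c' ∘ₗ K.c) (T' := LinearMap.id) (fun n x hx => by
    rw [LinearMap.comp_apply, K.c'_eq (K.c_mem hx), K.c_eq hx, smul_comm,
      algebraMap_factorial_smul, LinearMap.id_apply]) x

lemma P_c (x : M) : K.P (K.c x) = K.c (K.P x) :=
  K.ext_V (T := K.P ∘ₗ K.c) (T' := K.c ∘ₗ K.P) (fun n x hx => by
    rw [LinearMap.comp_apply, LinearMap.comp_apply, K.c_eq hx, K.c_eq (K.P_mem_V hx), map_smul]) x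

lemma P_c' (x : M) : K.P (K.c' x) = K.c' (K.P x) :=
  K.ext_V (T := K.P ∘ₗ K.c') (T' := K.c' ∘ₗ K.P) (fun n x hx => by
    rw [LinearMap.comp_apply, LinearMap.comp_apply, K.c'_eq hx, K.c'_eq (K.P_mem_V hx),
      map_smul]) x

/-- The comparison map from `(b, B)` to `(i, d)`. -/
def E : Module.End k M := K.c ∘ₗ K.P

/-- The comparison map from `(i, d)` to `(b, B)`. -/
def F : Module.End k M := K.c' ∘ₗ K.P

/-- The scalings cancel but the projection stays, so `E` and `F` become inverse on homology exactly
where P is homotopic to the identity. -/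
lemma E_F : K.E ∘ₗ K.F = K.P := LinearMap.ext fun x => by simp [E, F, P_c', P_P, c_c']

lemma F_E : K.F ∘ₗ K.E = K.P := LinearMap.ext fun x => by simp [E, F, P_c, P_P, c'_c]

lemma E_mem {n : ℕ} {x : M} (hx : x ∈ K.V n) : K.E x ∈ K.V n := K.c_mem (K.P_mem_V hx)

lemma F_mem {n : ℕ} {x : M} (hx : x ∈ K.V n) : K.F x ∈ K.V n := K.c'_mem (K.P_mem_V hx)

lemma factorial_succ_smul (n : ℕ) (x : M) :
    algebraMap ℚ k ((n + 1).factorial : ℚ)⁻¹ • algebraMap ℚ k ((n + 1 : ℕ) : ℚ) • x =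
      algebraMap ℚ k (n.factorial : ℚ)⁻¹ • x := by
  rw [smul_smul, ← map_mul]
  congr 2
  rw [Nat.factorial_succ]
  push_cast
  field_simp

lemma factorial_succ_smul' (n : ℕ) (x : M) :
    algebraMap ℚ k (n.factorial : ℚ) • algebraMap ℚ k ((n + 1 : ℕ) : ℚ) • x =
      algebraMap ℚ k ((n + 1).factorial : ℚ) • x := by
  rw [smul_smul, ← map_mul]
  congr 2
  rw [Nat.factorial_succ]
  push_cast
  ring

/-- On harmonic elements of degree n one has i = n b and B = (n + 1) d, and these factors are the
ratios of consecutive factorials. The next three lemmas rest on the same cancellation. -/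
lemma E_b : K.E ∘ₗ K.b = K.i ∘ₗ K.E := LinearMap.ext <| K.ext_V fun n x hx => by
  simp only [E, LinearMap.comp_apply, P_b]
  have h := K.P_mem_V hx
  rw [K.c_eq h, map_smul, K.i_of_mem h (K.P_mem x)]
  cases n with
  | zero => simp [K.b_zero h]
  | succ n => rw [K.c_eq (K.b_mem h), factorial_succ_smul]

lemma E_B : K.E ∘ₗ K.B = K.d ∘ₗ K.E := LinearMap.ext <| K.ext_V fun n x hx => by
  have h := K.P_mem_V hx
  have hB : K.P (K.B x) = K.B (K.P x) := by rw [P_B, B_P]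
  simp only [E, LinearMap.comp_apply, hB]
  rw [K.c_eq h, map_smul, K.B_of_mem h (K.P_mem x), map_smul, K.c_eq (K.d_mem h), smul_comm,
    factorial_succ_smul]

lemma F_i : K.F ∘ₗ K.i = K.b ∘ₗ K.F := LinearMap.ext <| K.ext_V fun n x hx => by
  have h := K.P_mem_V hx
  have hi : K.P (K.i x) = K.i (K.P x) := by rw [P_i, i_P]
  simp only [F, LinearMap.comp_apply, hi]
  rw [K.c'_eq h, map_smul, K.i_of_mem h (K.P_mem x), map_smul]
  cases n with
  | zero => simp [K.b_zero h]
  | succ n => rw [K.c'_eq (K.b_mem h), smul_comm, factorial_succ_smul']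

lemma F_d : K.F ∘ₗ K.d = K.B ∘ₗ K.F := LinearMap.ext <| K.ext_V fun n x hx => by
  simp only [F, LinearMap.comp_apply, P_d]
  have h := K.P_mem_V hx
  rw [K.c'_eq h, map_smul, K.B_of_mem h (K.P_mem x), K.c'_eq (K.d_mem h), factorial_succ_smul']

variable {K K'} in
lemma E_comm {f : M →ₗ[k] M'} (hf : ∀ x, f (K.κ x) = K'.κ (f x)) (hc : ∀ x, f (K.c x) = K'.c (f x))
    (x : M) : f (K.E x) = K'.E (f x) := by
  simp [E, hc, P_comm hf]

variable {K K'} in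
lemma F_comm {f : M →ₗ[k] M'} (hf : ∀ x, f (K.κ x) = K'.κ (f x))
    (hc : ∀ x, f (K.c' x) = K'.c' (f x)) (x : M) : f (K.F x) = K'.F (f x) := by
  simp [F, hc, P_comm hf]

/-! #### Contractions of the antiharmonic part -/

/-- The contraction `d / (1 - κ)` of the antiharmonic part for the differential `b`. -/
def G : Module.End k M := K.Y ∘ₗ K.d

/-- The contraction `b / (1 - κ)` of the antiharmonic part for the differential `d`. -/
def G' : Module.End k M := K.Y ∘ₗ K.b

/-- Since Y commutes with b, the left side is Y (bd + db) = Y (1 - κ), the antiharmonic projection.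
-/
lemma b_G (x : M) : K.b (K.G x) + K.G (K.b x) = x - K.P x := by
  simp only [G, LinearMap.comp_apply]
  rw [← Y_b, ← map_add, K.bd, ← K.y_apply, Y_y]

/-- Together with `G_B` this shows that the summand -uB of the differential does not disturb the
contraction of b. -/
lemma B_G (x : M) : K.B (K.G x) = 0 := K.B_antiharmonic (K.Y_mem _)

lemma G_B (x : M) : K.G (K.B x) = 0 := by
  have h := K.P_d (K.B x)
  rw [P_B] at h
  rw [G, LinearMap.comp_apply, ← h, Y_P]

lemma d_G' (x : M) : K.d (K.G' x) + K.G' (K.d x) = x - K.P x := by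
  simp only [G', LinearMap.comp_apply]
  rw [← Y_d, ← map_add, add_comm, K.bd, ← K.y_apply, Y_y]

lemma i_G' (x : M) : K.i (K.G' x) = 0 := K.i_antiharmonic (K.Y_mem _)

lemma G'_i (x : M) : K.G' (K.i x) = 0 := by
  have h := K.P_b (K.i x)
  rw [P_i] at h
  rw [G', LinearMap.comp_apply, ← h, Y_P]

lemma G'_mem (x : M) : K.G' x ∈ K.antiharmonic := K.Y_mem _

variable {K K'} in
lemma G'_comm {f : M →ₗ[k] M'} (hf : ∀ x, f (K.κ x) = K'.κ (f x))
    (hb : ∀ x, f (K.b x) = K'.b (f x)) (x : M) : f (K.G' x) = K'.G' (f x) := by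
  simp [G', hb, Y_comm hf]

end KaroubiModule

/-! ### Homology of differentials -/

namespace Homol

variable {k : Type*} [CommRing k] {C C' C'' C₁ : Type*} [AddCommGroup C] [Module k C]
  [AddCommGroup C'] [Module k C'] [AddCommGroup C''] [Module k C''] [AddCommGroup C₁] [Module k C₁]
  {D : C →ₗ[k] C} {D' : C' →ₗ[k] C'} {D'' : C'' →ₗ[k] C''} {D₁ : C₁ →ₗ[k] C₁}

/-- The class of a cycle. -/
def mk (z : C) (hz : D z = 0) : Homol D := Submodule.Quotient.mk ⟨z, hz⟩

lemma exists_mk (x : Homol D) : ∃ (z : C) (hz : D z = 0), x = mk z hz := by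
  obtain ⟨⟨z, hz⟩, rfl⟩ := Submodule.mkQ_surjective _ x
  exact ⟨z, hz, rfl⟩

lemma mk_eq_mk_iff {z z' : C} {hz : D z = 0} {hz' : D z' = 0} :
    mk z hz = mk z' hz' ↔ ∃ w, D w = z - z' :=
  Submodule.Quotient.eq _

lemma mk_eq_zero_iff {z : C} {hz : D z = 0} : mk z hz = 0 ↔ ∃ w, D w = z :=
  Submodule.Quotient.mk_eq_zero _

lemma mk_add {z z' : C} (hz : D z = 0) (hz' : D z' = 0) :
    mk z hz + mk z' hz' = mk (z + z') (by rw [map_add, hz, hz', add_zero]) := rfl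

lemma mk_congr {z z' : C} (h : z = z') (hz : D z = 0) : mk z hz = mk z' (h ▸ hz) := by
  subst h; rfl

lemma map_mk (f : C →ₗ[k] C') (h : f ∘ₗ D = D' ∘ₗ f) (z : C) (hz : D z = 0) :
    map f h (mk z hz) = mk (f z) (by
      have e := LinearMap.congr_fun h z
      simp only [LinearMap.comp_apply, hz, map_zero] at e
      exact e.symm) := rfl

lemma map_map_eq {f : C →ₗ[k] C'} {g : C' →ₗ[k] C''} {f' : C →ₗ[k] C₁} {g' : C₁ →ₗ[k] C''}
    (hf : f ∘ₗ D = D' ∘ₗ f) (hg : g ∘ₗ D' = D'' ∘ₗ g) (hf' : f' ∘ₗ D = D₁ ∘ₗ f')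
    (hg' : g' ∘ₗ D₁ = D'' ∘ₗ g') (h : ∀ z, g (f z) = g' (f' z)) (x : Homol D) :
    map g hg (map f hf x) = map g' hg' (map f' hf' x) := by
  obtain ⟨z, hz, rfl⟩ := exists_mk x
  exact mk_congr (h z) _

lemma map_map {f : C →ₗ[k] C'} {g : C' →ₗ[k] C''} {e : C →ₗ[k] C''}
    (hf : f ∘ₗ D = D' ∘ₗ f) (hg : g ∘ₗ D' = D'' ∘ₗ g) (he : e ∘ₗ D = D'' ∘ₗ e)
    (h : ∀ z, g (f z) = e z) (x : Homol D) : map g hg (map f hf x) = map e he x := by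
  obtain ⟨z, hz, rfl⟩ := exists_mk x
  exact mk_congr (h z) _

lemma map_eq_self {f : C →ₗ[k] C} (hf : f ∘ₗ D = D ∘ₗ f) (h : C →ₗ[k] C)
    (H : ∀ z, D (h z) + h (D z) = z - f z) (x : Homol D) : map f hf x = x := by
  obtain ⟨z, hz, rfl⟩ := exists_mk x
  rw [map_mk, eq_comm, mk_eq_mk_iff]
  exact ⟨h z, by rw [← H, hz, map_zero, add_zero]⟩

lemma mem_part_iff {S : Submodule k C} {x : Homol D} :
    x ∈ part D S ↔ ∃ (z : C) (hz : D z = 0), z ∈ S ∧ x = mk z hz := by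
  constructor
  · rintro ⟨⟨z, hz⟩, hS, rfl⟩
    exact ⟨z, hz, hS, rfl⟩
  · rintro ⟨z, hz, hS, rfl⟩
    exact ⟨⟨z, hz⟩, hS, rfl⟩

lemma map_mem_part {f : C →ₗ[k] C'} (hf : f ∘ₗ D = D' ∘ₗ f) {S : Submodule k C}
    {S' : Submodule k C'} (h : ∀ z ∈ S, f z ∈ S') {x : Homol D} (hx : x ∈ part D S) :
    map f hf x ∈ part D' S' := by
  obtain ⟨z, hz, hS, rfl⟩ := mem_part_iff.1 hx
  exact mem_part_iff.2 ⟨f z, _, h z hS, rfl⟩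

section Projection

variable {P : C →ₗ[k] C} (hP : P ∘ₗ D = D ∘ₗ P) {S S' : Submodule k C}
  (hS : ∀ z, z ∈ S ↔ P z = z) (hS' : ∀ z, z ∈ S' ↔ P z = 0) (hPP : ∀ z, P (P z) = P z)

include hP hS' hPP in
-- If P z is a boundary, then z and z - P z represent the same class, and P kills z - P z.
lemma ker_map_eq_part : LinearMap.ker (map P hP) = part D S' := by
  ext x
  rw [LinearMap.mem_ker]
  constructor
  · intro hx
    obtain ⟨z, hz, rfl⟩ := exists_mk x
    refine mem_part_iff.2 ⟨z - P z, ?_, (hS' _).2 (by rw [map_sub, hPP, sub_self]), ?_⟩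
    · have e := LinearMap.congr_fun hP z
      simp only [LinearMap.comp_apply, hz, map_zero] at e
      rw [map_sub, hz, ← e, sub_self]
    · rw [map_mk, mk_eq_zero_iff] at hx
      rw [mk_eq_mk_iff]
      simpa using hx
  · intro hx
    obtain ⟨z, hz, h, rfl⟩ := mem_part_iff.1 hx
    rw [map_mk, mk_eq_zero_iff]
    exact ⟨0, by rw [map_zero, (hS' z).1 h]⟩

include hP hS hS' hPP in
lemma isCompl_part : IsCompl (part D S) (part D S') := by
  constructor
  · rw [Submodule.disjoint_def]
    intro x hx hx'
    rw [← ker_map_eq_part hP hS' hPP, LinearMap.mem_ker] at hx'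
    obtain ⟨z, hz, h, rfl⟩ := mem_part_iff.1 hx
    rw [← hx', map_mk]
    exact mk_congr ((hS z).1 h).symm _
  · rw [codisjoint_iff, eq_top_iff]
    intro x _
    obtain ⟨z, hz, rfl⟩ := exists_mk x
    have e := LinearMap.congr_fun hP z
    simp only [LinearMap.comp_apply, hz, map_zero] at e
    have hz' : D (z - P z) = 0 := by rw [map_sub, hz, ← e, sub_self]
    have : mk z hz = mk (P z) e.symm + mk (z - P z) hz' := by
      rw [mk_add]; exact mk_congr (by abel) _
    rw [this]
    exact Submodule.add_mem_sup (mem_part_iff.2 ⟨_, _, (hS _).2 (hPP z), rfl⟩)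
      (mem_part_iff.2 ⟨_, _, (hS' _).2 (by rw [map_sub, hPP, sub_self]), rfl⟩)

end Projection

/-- The classes of a linear family of cycles. -/
def ofCycles (c : C' →ₗ[k] C) (h : ∀ f, D (c f) = 0) : C' →ₗ[k] Homol D :=
  Submodule.mkQ _ ∘ₗ c.codRestrict (LinearMap.ker D) h

lemma ofCycles_apply (c : C' →ₗ[k] C) (h : ∀ f, D (c f) = 0) (f : C') :
    ofCycles c h f = mk (c f) (h f) := rfl

end Homol

/-! ### Quotients by the kernel of a split surjection -/

section QuotEquiv

variable {k : Type*} [CommRing k] {X Z : Type*} [AddCommGroup X] [Module k X] [AddCommGroup Z]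
  [Module k Z]

/-- A split surjection `F` identifies its target with the quotient by its kernel. -/
def quotEquiv (E : X →ₗ[k] Z) (F : Z →ₗ[k] X) (h : ∀ x, F (E x) = x) (R : Submodule k Z)
    (hR : R = LinearMap.ker F) : X ≃ₗ[k] Z ⧸ R :=
  (Submodule.quotEquivOfEq R _ hR ≪≫ₗ
    F.quotKerEquivOfSurjective fun x => ⟨E x, h x⟩).symm

/-- This reduces compatibility with u and naturality of the isomorphism to the same properties of
`F`, with no choice of representatives. -/
lemma quotEquiv_eq_mk_iff {E : X →ₗ[k] Z} {F : Z →ₗ[k] X} {h : ∀ x, F (E x) = x}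
    {R : Submodule k Z} {hR : R = LinearMap.ker F} {x : X} {z : Z} :
    quotEquiv E F h R hR x = Submodule.Quotient.mk z ↔ F z = x := by
  rw [quotEquiv, LinearEquiv.symm_apply_eq, eq_comm]
  rfl

lemma map_quotEquiv {E : X →ₗ[k] Z} {F : Z →ₗ[k] X} {h : ∀ x, F (E x) = x}
    {R : Submodule k Z} {hR : R = LinearMap.ker F} {S : Submodule k X} {T : Submodule k Z}
    (hE : ∀ x ∈ S, E x ∈ T) (hF : ∀ z ∈ T, F z ∈ S) :
    S.map (quotEquiv E F h R hR).toLinearMap = T.map R.mkQ := by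
  ext t
  constructor
  · rintro ⟨x, hx, rfl⟩
    exact ⟨E x, hE x hx, (quotEquiv_eq_mk_iff.2 (h x)).symm⟩
  · rintro ⟨z, hz, rfl⟩
    exact ⟨F z, hF z hz, quotEquiv_eq_mk_iff.2 rfl⟩

end QuotEquiv

/-! ### Laurent series -/

section Series

variable {k : Type*} [CommRing k] {M N N' : Type*} [AddCommGroup M] [Module k M]
  [AddCommGroup N] [Module k N] [AddCommGroup N'] [Module k N']

@[simp] lemma diff_coeff (p q : M →ₗ[k] M) (x : HahnSeries ℤ M) (j : ℤ) :
    (diff p q x).coeff j = p (x.coeff j) - q (x.coeff (j - 1)) := rfl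

variable (k M) in
/-- Division by `u` on Laurent series. -/
def uInv : HahnSeries ℤ M →ₗ[k] HahnSeries ℤ M where
  toFun x :=
    { coeff := fun j => x.coeff (j + 1)
      isPWO_support' := by
        have h := x.isPWO_support.image_of_monotone (f := fun j : ℤ => j - 1)
          (fun a b hab => by simpa using hab)
        refine h.mono fun j hj => ⟨j + 1, hj, by simp⟩ }
  map_add' x y := by ext; simp
  map_smul' c x := by ext; simp

@[simp] lemma uInv_coeff (x : HahnSeries ℤ M) (j : ℤ) :
    (uInv k M x).coeff j = x.coeff (j + 1) := rfl

variable (k M) in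
/-- Laurent series with only a constant term. -/
def constL : M →ₗ[k] HahnSeries ℤ M where
  toFun x := HahnSeries.single 0 x
  map_add' x y := by ext j; by_cases h : j = 0 <;> simp [h]
  map_smul' c x := by ext j; by_cases h : j = 0 <;> simp [h]

@[simp] lemma constL_coeff_zero (x : M) : (constL k M x).coeff 0 = x :=
  HahnSeries.coeff_single_same ..

lemma constL_coeff_of_ne (x : M) {j : ℤ} (h : j ≠ 0) : (constL k M x).coeff j = 0 :=
  HahnSeries.coeff_single_of_ne h

lemma constL_mem_uPow (x : M) : constL k M x ∈ uPow k M 0 := fun _ hj =>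
  constL_coeff_of_ne x hj.ne

/-- A homotopy for p that anticommutes with q acts coefficientwise as a homotopy for p - uq. It
involves no division by u, so it also serves for M[[u]] and M ⊗ R. -/
lemma diff_homotopy {p q G P : M →ₗ[k] M} (hp : ∀ x, p (G x) + G (p x) = x - P x)
    (hq : ∀ x, q (G x) + G (q x) = 0) (z : HahnSeries ℤ M) :
    diff p q (mapCoeff G z) + mapCoeff G (diff p q z) = z - mapCoeff P z := by
  ext j
  have h₁ := hp (z.coeff j)
  have h₂ := hq (z.coeff (j - 1))
  simp only [HahnSeries.coeff_add, HahnSeries.coeff_sub, diff_coeff, mapCoeff_coeff, map_sub]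
  rw [← h₁, eq_sub_of_add_eq h₂]
  abel

section
variable {p q : M →ₗ[k] M} {S : ℤ → Submodule k M}

lemma mem_partNeg_iff {x : HNeg p q} : x ∈ partNeg p q S ↔
    ∃ (z : uPow k M 0) (hz : diffPow p q z = 0), (∀ j, z.1.coeff j ∈ S j) ∧ x = Homol.mk z hz :=
  Homol.mem_part_iff

/-- Coefficients from r on are unconstrained, because a representative can be truncated there and
zero lies in every `S j`. -/
lemma mem_coeffSub_map_iff {r : ℤ} {z : HahnSeries ℤ M} :
    (Submodule.Quotient.mk z : HahnSeries ℤ M ⧸ uPow k M r) ∈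
      (coeffSub S).map (uPow k M r).mkQ ↔ ∀ j < r, z.coeff j ∈ S j := by
  constructor
  · rintro ⟨z', hz', h⟩ j hj
    have := (Submodule.Quotient.eq _).1 h j hj
    rw [HahnSeries.coeff_sub, sub_eq_zero] at this
    exact this ▸ hz' j
  · intro h
    refine ⟨HahnSeries.truncLTLinearMap k r z, fun j => ?_, ?_⟩
    · by_cases hj : j < r
      · simpa [HahnSeries.coeff_truncLT, hj] using h j hj
      · simp [HahnSeries.coeff_truncLT, hj]
    · refine (Submodule.Quotient.eq _).2 fun j hj => ?_
      simp [HahnSeries.coeff_truncLT, hj]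

end

/-! ### Functoriality of the three homologies -/

section
variable {p q : M →ₗ[k] M} {p' q' : N →ₗ[k] N} {f : M →ₗ[k] N}
  (hp : f ∘ₗ p = p' ∘ₗ f) (hq : f ∘ₗ q = q' ∘ₗ f)

include hp hq in
lemma mapNeg_chain : onPow (mapCoeff f) (mapCoeff_uPow f) ∘ₗ diffPow p q =
    diffPow p' q' ∘ₗ onPow (mapCoeff f) (mapCoeff_uPow f) :=
  LinearMap.ext fun x => Subtype.ext (LinearMap.congr_fun (mapCoeff_diff f hp hq) x.1)

include hp hq in
lemma mapOrd_chain : onPol (mapCoeff f) (mapCoeff_uPow f) ∘ₗ diffPol p q =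
    diffPol p' q' ∘ₗ onPol (mapCoeff f) (mapCoeff_uPow f) := by
  refine LinearMap.ext fun x => ?_
  obtain ⟨x, rfl⟩ := Submodule.mkQ_surjective _ x
  exact congrArg (Submodule.mkQ _) (LinearMap.congr_fun (mapCoeff_diff f hp hq) x)

lemma mapPer_uPer (x : HPer p q) : mapPer f hp hq (uPer p q x) = uPer p' q' (mapPer f hp hq x) :=
  Homol.map_map_eq _ _ _ _ (fun _ => by ext; simp) x

lemma mapNeg_uNeg (x : HNeg p q) : mapNeg f hp hq (uNeg p q x) = uNeg p' q' (mapNeg f hp hq x) :=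
  Homol.map_map_eq _ _ _ _ (fun _ => Subtype.ext (by ext; rfl)) x

lemma mapOrd_uOrd (x : HOrd p q) : mapOrd f hp hq (uOrd p q x) = uOrd p' q' (mapOrd f hp hq x) :=
  Homol.map_map_eq _ _ _ _ (fun z => by
    obtain ⟨z, rfl⟩ := Submodule.mkQ_surjective _ z
    exact congrArg (Submodule.mkQ _) (by ext; rfl)) x

variable {S : ℤ → Submodule k M} {S' : ℤ → Submodule k N} (hS : ∀ j, ∀ x ∈ S j, f x ∈ S' j)

include hS in
lemma mapPer_mem_part {x : HPer p q} (hx : x ∈ partPer p q S) :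
    mapPer f hp hq x ∈ partPer p' q' S' :=
  Homol.map_mem_part _ (S := coeffSub S) (S' := coeffSub S')
    (fun _ hz j => hS j _ (hz j)) hx

include hS in
lemma mapNeg_mem_part {x : HNeg p q} (hx : x ∈ partNeg p q S) :
    mapNeg f hp hq x ∈ partNeg p' q' S' :=
  Homol.map_mem_part (f := onPow (mapCoeff f) (mapCoeff_uPow f)) _
    (S := (coeffSub S).submoduleOf _)
    (S' := (coeffSub S').submoduleOf _) (fun _ hz j => hS j _ (hz j)) hx

include hS in
lemma mapOrd_mem_part {x : HOrd p q} (hx : x ∈ partOrd p q S) :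
    mapOrd f hp hq x ∈ partOrd p' q' S' := by
  refine Homol.map_mem_part _ ?_ hx
  rintro _ ⟨z, hz, rfl⟩
  exact ⟨mapCoeff f z, fun j => hS j _ (hz j), rfl⟩

section Comp

variable {p'' q'' : N' →ₗ[k] N'} {g : N →ₗ[k] N'} (hp' : g ∘ₗ p' = p'' ∘ₗ g)
  (hq' : g ∘ₗ q' = q'' ∘ₗ g)

lemma mapPer_mapPer {e : M →ₗ[k] N'} (he : g ∘ₗ f = e) (hp'' : e ∘ₗ p = p'' ∘ₗ e)
    (hq'' : e ∘ₗ q = q'' ∘ₗ e) (x : HPer p q) :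
    mapPer g hp' hq' (mapPer f hp hq x) = mapPer e hp'' hq'' x := by
  subst he
  exact Homol.map_map _ _ _ (fun _ => by ext; rfl) x

lemma mapNeg_mapNeg {e : M →ₗ[k] N'} (he : g ∘ₗ f = e) (hp'' : e ∘ₗ p = p'' ∘ₗ e)
    (hq'' : e ∘ₗ q = q'' ∘ₗ e) (x : HNeg p q) :
    mapNeg g hp' hq' (mapNeg f hp hq x) = mapNeg e hp'' hq'' x := by
  subst he
  exact Homol.map_map _ _ _ (fun _ => Subtype.ext (by ext; rfl)) x

lemma mapOrd_mapOrd {e : M →ₗ[k] N'} (he : g ∘ₗ f = e) (hp'' : e ∘ₗ p = p'' ∘ₗ e)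
    (hq'' : e ∘ₗ q = q'' ∘ₗ e) (x : HOrd p q) :
    mapOrd g hp' hq' (mapOrd f hp hq x) = mapOrd e hp'' hq'' x := by
  subst he
  exact Homol.map_map _ _ _ (fun z => by
    obtain ⟨z, rfl⟩ := Submodule.mkQ_surjective _ z
    exact congrArg (Submodule.mkQ _) (by ext; rfl)) x

end Comp

end

/-! ### Endomorphisms homotopic to the identity -/

section Homotopy

variable {p q P : M →ₗ[k] M} (hp : P ∘ₗ p = p ∘ₗ P) (hq : P ∘ₗ q = q ∘ₗ P) {G : M →ₗ[k] M}
  (h₁ : ∀ x, p (G x) + G (p x) = x - P x) (h₂ : ∀ x, q (G x) + G (q x) = 0)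

include h₁ h₂ in
lemma mapPer_eq_self (x : HPer p q) : mapPer P hp hq x = x :=
  Homol.map_eq_self _ (mapCoeff G) (diff_homotopy h₁ h₂) x

include h₁ h₂ in
lemma mapNeg_eq_self (x : HNeg p q) : mapNeg P hp hq x = x :=
  Homol.map_eq_self _ (onPow (mapCoeff G) (mapCoeff_uPow G))
    (fun z => Subtype.ext (diff_homotopy h₁ h₂ z.1)) x

include h₁ h₂ in
lemma mapOrd_eq_self (x : HOrd p q) : mapOrd P hp hq x = x :=
  Homol.map_eq_self _ (onPol (mapCoeff G) (mapCoeff_uPow G))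
    (fun z => by
      obtain ⟨z, rfl⟩ := Submodule.mkQ_surjective _ z
      exact congrArg (Submodule.mkQ _) (diff_homotopy h₁ h₂ z)) x

end Homotopy

/-! ### Parts of the homology cut out by a projection -/

section Projection

variable {p q P : M →ₗ[k] M} (hp : P ∘ₗ p = p ∘ₗ P) (hq : P ∘ₗ q = q ∘ₗ P) {S S' : Submodule k M}
  (hS : ∀ z, z ∈ S ↔ P z = z) (hS' : ∀ z, z ∈ S' ↔ P z = 0) (hPP : ∀ z, P (P z) = P z)

include hS' in
lemma mem_neg_iff_map_eq_zero (z : uPow k M 0) :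
    z ∈ (coeffSub fun _ => S').submoduleOf (uPow k M 0) ↔
      onPow (mapCoeff P) (mapCoeff_uPow P) z = 0 := by
  refine ⟨fun h => Subtype.ext ?_, fun h j => (hS' _).2 ?_⟩
  · ext j
    exact (hS' _).1 (h j)
  · exact congrArg (fun t : uPow k M 0 => t.1.coeff j) h

include hS in
lemma mem_neg_iff_map_eq_self (z : uPow k M 0) :
    z ∈ (coeffSub fun _ => S).submoduleOf (uPow k M 0) ↔
      onPow (mapCoeff P) (mapCoeff_uPow P) z = z := by
  refine ⟨fun h => Subtype.ext ?_, fun h j => (hS _).2 ?_⟩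
  · ext j
    exact (hS _).1 (h j)
  · exact congrArg (fun t : uPow k M 0 => t.1.coeff j) h

include hS' in
lemma mem_ord_iff_map_eq_zero (z : HahnSeries ℤ M ⧸ uPow k M 1) :
    z ∈ (coeffSub fun _ => S').map (uPow k M 1).mkQ ↔
      onPol (mapCoeff P) (mapCoeff_uPow P) z = 0 := by
  obtain ⟨z, rfl⟩ := Submodule.mkQ_surjective _ z
  refine mem_coeffSub_map_iff.trans (Iff.trans ?_ (Submodule.Quotient.mk_eq_zero _).symm)
  exact forall₂_congr fun j _ => hS' _

include hS in
lemma mem_ord_iff_map_eq_self (z : HahnSeries ℤ M ⧸ uPow k M 1) :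
    z ∈ (coeffSub fun _ => S).map (uPow k M 1).mkQ ↔
      onPol (mapCoeff P) (mapCoeff_uPow P) z = z := by
  obtain ⟨z, rfl⟩ := Submodule.mkQ_surjective _ z
  refine mem_coeffSub_map_iff.trans (Iff.trans ?_ (Submodule.Quotient.eq _).symm)
  refine forall₂_congr fun j _ => (hS _).trans ?_
  rw [HahnSeries.coeff_sub, sub_eq_zero, mapCoeff_coeff]

include hPP in
lemma onPow_idem (z : uPow k M 0) : onPow (mapCoeff P) (mapCoeff_uPow P)
    (onPow (mapCoeff P) (mapCoeff_uPow P) z) = onPow (mapCoeff P) (mapCoeff_uPow P) z :=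
  Subtype.ext (by ext j; exact hPP _)

include hPP in
lemma onPol_idem (z : HahnSeries ℤ M ⧸ uPow k M 1) : onPol (mapCoeff P) (mapCoeff_uPow P)
    (onPol (mapCoeff P) (mapCoeff_uPow P) z) = onPol (mapCoeff P) (mapCoeff_uPow P) z := by
  obtain ⟨z, rfl⟩ := Submodule.mkQ_surjective _ z
  exact congrArg (Submodule.mkQ _) (by ext j; exact hPP _)

include hS' hPP in
lemma ker_mapNeg : LinearMap.ker (mapNeg P hp hq) = partNeg p q fun _ => S' :=
  Homol.ker_map_eq_part _ (mem_neg_iff_map_eq_zero hS') (onPow_idem hPP)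

include hS' hPP in
lemma ker_mapOrd : LinearMap.ker (mapOrd P hp hq) = partOrd p q fun _ => S' :=
  Homol.ker_map_eq_part _ (mem_ord_iff_map_eq_zero hS') (onPol_idem hPP)

include hp hq hS hS' hPP in
lemma isCompl_partNeg : IsCompl (partNeg p q fun _ => S) (partNeg p q fun _ => S') :=
  Homol.isCompl_part (mapNeg_chain hp hq) (mem_neg_iff_map_eq_self hS)
    (mem_neg_iff_map_eq_zero hS') (onPow_idem hPP)

include hp hq hS hS' hPP in
lemma isCompl_partOrd : IsCompl (partOrd p q fun _ => S) (partOrd p q fun _ => S') :=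
  Homol.isCompl_part (mapOrd_chain hp hq) (mem_ord_iff_map_eq_self hS)
    (mem_ord_iff_map_eq_zero hS') (onPol_idem hPP)

end Projection

end Series

namespace KaroubiModule

variable {k : Type*} [CommRing k] [Algebra ℚ k] {M : Type*} [AddCommGroup M] [Module k M]
  {M' : Type*} [AddCommGroup M'] [Module k M'] (K : KaroubiModule k M) (K' : KaroubiModule k M')

/-! ### Comparison of the homologies -/

lemma P_comp_b : K.P ∘ₗ K.b = K.b ∘ₗ K.P := LinearMap.ext K.P_b

lemma P_comp_d : K.P ∘ₗ K.d = K.d ∘ₗ K.P := LinearMap.ext K.P_d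

lemma P_comp_i : K.P ∘ₗ K.i = K.i ∘ₗ K.P := LinearMap.ext fun x => by simp [P_i, i_P]

lemma P_comp_B : K.P ∘ₗ K.B = K.B ∘ₗ K.P := LinearMap.ext fun x => by simp [P_B, B_P]

lemma mem_harmonic_iff (x : M) : x ∈ K.harmonic ↔ K.P x = x :=
  ⟨K.P_of_mem, fun h => h ▸ K.P_mem x⟩

lemma mem_antiharmonic_iff (x : M) : x ∈ K.antiharmonic ↔ K.P x = 0 := K.P_eq_zero_iff.symm

lemma B_G_add (x : M) : K.B (K.G x) + K.G (K.B x) = 0 := by rw [B_G, G_B, add_zero]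

/-- The operator -u⁻¹ G' contracts -ud on the antiharmonic part, and i does not interfere because i
G' = G' i = 0. The factor u⁻¹ confines this argument to Laurent series. -/
lemma per_contraction (z : HahnSeries ℤ M) :
    diff K.i K.d ((-(uInv k M ∘ₗ mapCoeff K.G')) z) + (-(uInv k M ∘ₗ mapCoeff K.G'))
      (diff K.i K.d z) = z - mapCoeff K.P z := by
  ext j
  have h := K.d_G' (z.coeff j)
  simp only [LinearMap.neg_apply, LinearMap.comp_apply, HahnSeries.coeff_add,
    HahnSeries.coeff_sub, HahnSeries.coeff_neg, diff_coeff, uInv_coeff, mapCoeff_coeff, map_neg,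
    map_sub, i_G', G'_i, add_sub_cancel_right, sub_add_cancel]
  rw [← h]
  abel

/-- Comparison of the periodic theories. -/
def perEquiv : HPer K.b K.B ≃ₗ[k] HPer K.i K.d :=
  LinearEquiv.ofLinearMap (mapPer K.E K.E_b K.E_B) (mapPer K.F K.F_i K.F_d)
    (LinearMap.ext fun x => by
      rw [LinearMap.comp_apply, mapPer_mapPer K.F_i K.F_d K.E_b K.E_B K.E_F K.P_comp_i K.P_comp_d]
      exact Homol.map_eq_self _ _ K.per_contraction x)
    (LinearMap.ext fun x => by
      rw [LinearMap.comp_apply, mapPer_mapPer K.E_b K.E_B K.F_i K.F_d K.F_E K.P_comp_b K.P_comp_B]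
      exact mapPer_eq_self _ _ K.b_G K.B_G_add x)

/-- On the side of (b, B) the composite is P, which is homotopic to the identity by `G`; no power of
u is needed. The opposite composite is not the identity in general. -/
lemma mapNeg_F_E (x : HNeg K.b K.B) :
    mapNeg K.F K.F_i K.F_d (mapNeg K.E K.E_b K.E_B x) = x := by
  rw [mapNeg_mapNeg K.E_b K.E_B K.F_i K.F_d K.F_E K.P_comp_b K.P_comp_B]
  exact mapNeg_eq_self _ _ K.b_G K.B_G_add x

lemma mapOrd_F_E (x : HOrd K.b K.B) :
    mapOrd K.F K.F_i K.F_d (mapOrd K.E K.E_b K.E_B x) = x := by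
  rw [mapOrd_mapOrd K.E_b K.E_B K.F_i K.F_d K.F_E K.P_comp_b K.P_comp_B]
  exact mapOrd_eq_self _ _ K.b_G K.B_G_add x

/-- The map induced by `E` is injective on homology, being split by that of `F`. Hence `F` has the
same kernel as `E ∘ F` = P, namely the classes of antiharmonic cycles. -/
lemma ker_mapNeg_F :
    LinearMap.ker (mapNeg K.F K.F_i K.F_d) = partNeg K.i K.d fun _ => K.antiharmonic := by
  rw [← ker_mapNeg K.P_comp_i K.P_comp_d K.mem_antiharmonic_iff K.P_P]
  ext x
  rw [LinearMap.mem_ker, LinearMap.mem_ker,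
    ← mapNeg_mapNeg K.F_i K.F_d K.E_b K.E_B K.E_F K.P_comp_i K.P_comp_d]
  refine ⟨fun h => by rw [h, map_zero], fun h => ?_⟩
  rw [← K.mapNeg_F_E (mapNeg K.F K.F_i K.F_d x), h, map_zero]

lemma ker_mapOrd_F :
    LinearMap.ker (mapOrd K.F K.F_i K.F_d) = partOrd K.i K.d fun _ => K.antiharmonic := by
  rw [← ker_mapOrd K.P_comp_i K.P_comp_d K.mem_antiharmonic_iff K.P_P]
  ext x
  rw [LinearMap.mem_ker, LinearMap.mem_ker,
    ← mapOrd_mapOrd K.F_i K.F_d K.E_b K.E_B K.E_F K.P_comp_i K.P_comp_d]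
  refine ⟨fun h => by rw [h, map_zero], fun h => ?_⟩
  rw [← K.mapOrd_F_E (mapOrd K.F K.F_i K.F_d x), h, map_zero]

lemma isCompl_neg : IsCompl (partNeg K.i K.d fun _ => K.harmonic)
    (partNeg K.i K.d fun _ => K.antiharmonic) :=
  isCompl_partNeg K.P_comp_i K.P_comp_d K.mem_harmonic_iff K.mem_antiharmonic_iff K.P_P

lemma isCompl_ord : IsCompl (partOrd K.i K.d fun _ => K.harmonic)
    (partOrd K.i K.d fun _ => K.antiharmonic) :=
  isCompl_partOrd K.P_comp_i K.P_comp_d K.mem_harmonic_iff K.mem_antiharmonic_iff K.P_P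

/-! ### The antiharmonic part of the homology -/

/-- The submodule `d` of the antiharmonic elements. -/
def exactAnti : Submodule k M := K.antiharmonic.map K.d

section exactAnti

variable {K} {f : M} (hf : f ∈ K.exactAnti)
include hf

lemma mem_antiharmonic_of_exactAnti : f ∈ K.antiharmonic := by
  obtain ⟨x, hx, rfl⟩ := hf
  exact K.d_mem_antiharmonic hx

lemma i_of_exactAnti : K.i f = 0 := K.i_antiharmonic (mem_antiharmonic_of_exactAnti hf)

lemma d_of_exactAnti : K.d f = 0 := by
  obtain ⟨x, hx, rfl⟩ := hf
  exact K.dd x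

lemma d_G'_of_exactAnti : K.d (K.G' f) = f := by
  have h := K.d_G' f
  rwa [d_of_exactAnti hf, map_zero, add_zero,
    K.P_of_mem_antiharmonic (mem_antiharmonic_of_exactAnti hf), sub_zero] at h

/-- The values of i are harmonic, so an antiharmonic one vanishes. Injectivity of both embeddings
comes down to this. -/
lemma eq_zero_of_exactAnti {x : M} (h : f = K.i x) : f = 0 := by
  have h' := K.P_of_mem_antiharmonic (mem_antiharmonic_of_exactAnti hf)
  rwa [h, P_i, ← h] at h'

end exactAnti

/-- One has (1 - κⁿ) d = (1 - κ) d (1 + κ + ⋯ + κⁿ⁻¹), and (1 - κ) d sees only the antiharmonic part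
of its argument. Graded commutators of exact forms have this shape. -/
lemma d_sub_pow_mem (n : ℕ) (x : M) :
    K.d x - (K.κ ^ n) (K.d x) ∈ K.exactAnti := by
  obtain ⟨t, ht⟩ : ∃ t, t = ∑ j ∈ Finset.range n, (K.κ ^ j) x := ⟨_, rfl⟩
  have h₁ : K.d x - (K.κ ^ n) (K.d x) = K.y (K.d t) := by
    rw [ht, map_sum, ← K.y_sum_pow]
    simp only [K.κ_pow_d']
  have h₂ := K.y_d_P t
  refine ⟨K.y (t - K.P t), K.y_mem_antiharmonic (K.sub_P_mem t), ?_⟩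
  rw [h₁, ← K.y_d, map_sub, map_sub, h₂, sub_zero]

/-- The constant Laurent series with values in `exactAnti`. -/
def negCycles : K.exactAnti →ₗ[k] uPow k M 0 :=
  (constL k M ∘ₗ K.exactAnti.subtype).codRestrict _ fun _ => constL_mem_uPow _

lemma diffPow_negCycles (f : K.exactAnti) : diffPow K.i K.d (K.negCycles f) = 0 := by
  refine Subtype.ext (HahnSeries.ext (funext fun j => ?_))
  change K.i ((constL k M f.1).coeff j) - K.d ((constL k M f.1).coeff (j - 1)) = 0
  have h₁ : K.i ((constL k M f.1).coeff j) = 0 := by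
    by_cases h : j = 0
    · rw [h, constL_coeff_zero, i_of_exactAnti f.2]
    · rw [constL_coeff_of_ne _ h, map_zero]
  have h₂ : K.d ((constL k M f.1).coeff (j - 1)) = 0 := by
    by_cases h : j - 1 = 0
    · rw [h, constL_coeff_zero, d_of_exactAnti f.2]
    · rw [constL_coeff_of_ne _ h, map_zero]
  rw [h₁, h₂, sub_zero]

/-- The embedding by constant terms. -/
def negEmb : K.exactAnti →ₗ[k] HNeg K.i K.d := Homol.ofCycles K.negCycles K.diffPow_negCycles

lemma negEmb_injective : Function.Injective K.negEmb := by
  rw [injective_iff_map_eq_zero]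
  intro f hf
  rw [negEmb, Homol.ofCycles_apply, Homol.mk_eq_zero_iff] at hf
  obtain ⟨w, hw⟩ := hf
  have h := congrArg (fun t : uPow k M 0 => t.1.coeff 0) hw
  change K.i (w.1.coeff 0) - K.d (w.1.coeff (0 - 1)) = (constL k M f.1).coeff 0 at h
  -- A power series has no coefficient at u⁻¹, so the constant term of a boundary is a value of i.
  rw [w.2 (0 - 1) (by norm_num), map_zero, sub_zero, constL_coeff_zero] at h
  exact Subtype.ext (eq_zero_of_exactAnti f.2 h.symm)

/-- On antiharmonic series the differential is -ud, so all coefficients of a cycle are closed, hence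
exact with antiharmonic primitives. Those of positive order in u are boundaries; for the constant
term a primitive would need order -1. -/
lemma range_negEmb : LinearMap.range K.negEmb = partNeg K.i K.d fun _ => K.antiharmonic := by
  ext x
  rw [mem_partNeg_iff]
  constructor
  · rintro ⟨f, rfl⟩
    refine ⟨K.negCycles f, K.diffPow_negCycles f, fun j => ?_, rfl⟩
    change (constL k M f.1).coeff j ∈ _
    by_cases h : j = 0
    · rw [h, constL_coeff_zero]
      exact mem_antiharmonic_of_exactAnti f.2
    · rw [constL_coeff_of_ne _ h]
      exact zero_mem _
  · rintro ⟨z, hz, ha, rfl⟩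
    have hd (j : ℤ) : K.d (z.1.coeff j) = 0 := by
      have h := congrArg (fun t : uPow k M 0 => t.1.coeff (j + 1)) hz
      change K.i (z.1.coeff (j + 1)) - K.d (z.1.coeff (j + 1 - 1)) = 0 at h
      rw [K.i_antiharmonic (ha _), zero_sub, neg_eq_zero, add_sub_cancel_right] at h
      exact h
    have hG (j : ℤ) : K.d (K.G' (z.1.coeff j)) = z.1.coeff j := by
      have h := K.d_G' (z.1.coeff j)
      rwa [hd, map_zero, add_zero, K.P_of_mem_antiharmonic (ha _), sub_zero] at h
    refine ⟨⟨z.1.coeff 0, K.G' (z.1.coeff 0), K.G'_mem _, hG 0⟩, ?_⟩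
    rw [negEmb, Homol.ofCycles_apply, Homol.mk_eq_mk_iff]
    -- Removing the constant term first makes division by u possible within power series.
    refine ⟨⟨uInv k M (mapCoeff K.G' (z.1 - constL k M (z.1.coeff 0))), fun j hj => ?_⟩, ?_⟩
    · rw [uInv_coeff, mapCoeff_coeff, HahnSeries.coeff_sub]
      rcases eq_or_ne (j + 1) 0 with h | h
      · rw [h, constL_coeff_zero, sub_self, map_zero]
      · rw [constL_coeff_of_ne _ h, z.2 _ (by omega), sub_zero, map_zero]
    · refine Subtype.ext (HahnSeries.ext (funext fun j => ?_))
      change K.i (K.G' _) - K.d (K.G' ((z.1 - constL k M (z.1.coeff 0)).coeff (j - 1 + 1))) =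
        (constL k M (z.1.coeff 0)).coeff j - z.1.coeff j
      rw [i_G', zero_sub, sub_add_cancel, HahnSeries.coeff_sub]
      rcases eq_or_ne j 0 with h | h
      · rw [h, constL_coeff_zero, sub_self, map_zero, map_zero, neg_zero]
      · rw [constL_coeff_of_ne _ h, sub_zero, zero_sub, hG]

/-- The antiharmonic primitives of `exactAnti`, as constant series. -/
def ordCycles : K.exactAnti →ₗ[k] HahnSeries ℤ M ⧸ uPow k M 1 :=
  (uPow k M 1).mkQ ∘ₗ constL k M ∘ₗ K.G' ∘ₗ K.exactAnti.subtype

/-- Since i G' = 0, the differential of the constant series is -u d G' x, which is zero modulo u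
M[[u]]. -/
lemma diffPol_constL_G' (x : M) :
    diffPol K.i K.d ((uPow k M 1).mkQ (constL k M (K.G' x))) = 0 := by
  refine (Submodule.Quotient.mk_eq_zero _).2 fun j hj => ?_
  rw [diff_coeff, constL_coeff_of_ne _ (by omega : j - 1 ≠ 0), map_zero, sub_zero]
  by_cases h : j = 0
  · rw [h, constL_coeff_zero, i_G']
  · rw [constL_coeff_of_ne _ h, map_zero]

lemma diffPol_ordCycles (f : K.exactAnti) : diffPol K.i K.d (K.ordCycles f) = 0 :=
  K.diffPol_constL_G' f.1

/-- The embedding by antiharmonic primitives. -/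
def ordEmb : K.exactAnti →ₗ[k] HOrd K.i K.d := Homol.ofCycles K.ordCycles K.diffPol_ordCycles

lemma ordEmb_injective : Function.Injective K.ordEmb := by
  rw [injective_iff_map_eq_zero]
  intro f hf
  rw [ordEmb, Homol.ofCycles_apply, Homol.mk_eq_zero_iff] at hf
  obtain ⟨w, hw⟩ := hf
  obtain ⟨w, rfl⟩ := Submodule.mkQ_surjective _ w
  have h := (Submodule.Quotient.eq _).1 hw 0 one_pos
  rw [HahnSeries.coeff_sub, sub_eq_zero] at h
  change K.i (w.coeff 0) - K.d (w.coeff (0 - 1)) = (constL k M (K.G' f.1)).coeff 0 at h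
  rw [constL_coeff_zero] at h
  -- Applying d to G' f = i w₀ - d w₋₁ gives f = d i w₀ = i (-d w₀), a value of i.
  have h' := congrArg K.d h
  rw [d_G'_of_exactAnti f.2, map_sub, K.dd, sub_zero,
    eq_neg_of_add_eq_zero_right (K.i_d (w.coeff 0)), ← map_neg] at h'
  exact Subtype.ext (eq_zero_of_exactAnti f.2 h'.symm)

/-- Modulo u M[[u]] the constant coefficient z₀ of an antiharmonic cycle is unconstrained and the
coefficients at negative powers are closed. Closed coefficients are boundaries, so the class depends
only on d z₀. -/
lemma range_ordEmb : LinearMap.range K.ordEmb = partOrd K.i K.d fun _ => K.antiharmonic := by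
  ext x
  constructor
  · rintro ⟨f, rfl⟩
    refine Homol.mem_part_iff.2 ⟨K.ordCycles f, K.diffPol_ordCycles f,
      ⟨constL k M (K.G' f.1), fun j => ?_, rfl⟩, rfl⟩
    by_cases h : j = 0
    · rw [h, constL_coeff_zero]
      exact K.G'_mem _
    · rw [constL_coeff_of_ne _ h]
      exact zero_mem _
  · intro hx
    obtain ⟨_, hz, ⟨z, ha, rfl⟩, rfl⟩ := Homol.mem_part_iff.1 hx
    have hd (j : ℤ) (hj : j < 0) : K.d (z.coeff j) = 0 := by
      have h := (Submodule.Quotient.mk_eq_zero _).1 hz (j + 1) (by omega)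
      rwa [diff_coeff, K.i_antiharmonic (ha _), zero_sub, neg_eq_zero,
        add_sub_cancel_right] at h
    refine ⟨⟨K.d (z.coeff 0), z.coeff 0, ha 0, rfl⟩, ?_⟩
    rw [ordEmb, Homol.ofCycles_apply, Homol.mk_eq_mk_iff]
    -- The differential of u⁻¹ G' z has coefficients -d G' z_j = G' d z_j - z_j, and G' d z_j
    -- vanishes for j < 0.
    refine ⟨(uPow k M 1).mkQ (uInv k M (mapCoeff K.G' z)), ?_⟩
    refine (Submodule.Quotient.eq _).2 fun j hj => ?_
    have hG := K.d_G' (z.coeff j)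
    rw [K.P_of_mem_antiharmonic (ha _), sub_zero] at hG
    change K.i (K.G' _) - K.d (K.G' (z.coeff (j - 1 + 1))) -
      ((constL k M (K.G' (K.d (z.coeff 0)))).coeff j - z.coeff j) = 0
    rw [i_G', sub_add_cancel]
    rcases eq_or_ne j 0 with rfl | h
    · rw [constL_coeff_zero]
      refine Eq.trans ?_ (sub_eq_zero.2 hG.symm)
      abel
    · rw [hd j (by omega), map_zero, add_zero] at hG
      rw [constL_coeff_of_ne _ h, hG]; abel

/-- Comparison of the negative theories. -/
def negEquiv {W : Type*} [AddCommGroup W] [Module k W] (ι : W →ₗ[k] HNeg K.i K.d)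
    (hι : LinearMap.range ι = partNeg K.i K.d fun _ => K.antiharmonic) :
    HNeg K.b K.B ≃ₗ[k] HNeg K.i K.d ⧸ LinearMap.range ι :=
  quotEquiv (mapNeg K.E K.E_b K.E_B) (mapNeg K.F K.F_i K.F_d) K.mapNeg_F_E _
    (hι.trans K.ker_mapNeg_F.symm)

/-- Comparison of the ordinary theories. -/
def ordEquiv {W : Type*} [AddCommGroup W] [Module k W] (ι : W →ₗ[k] HOrd K.i K.d)
    (hι : LinearMap.range ι = partOrd K.i K.d fun _ => K.antiharmonic) :
    HOrd K.b K.B ≃ₗ[k] HOrd K.i K.d ⧸ LinearMap.range ι :=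
  quotEquiv (mapOrd K.E K.E_b K.E_B) (mapOrd K.F K.F_i K.F_d) K.mapOrd_F_E _
    (hι.trans K.ker_mapOrd_F.symm)

/-! ### Arbitrary sections of the differential -/

/-- Elements of degree less than `m`. -/
def fil (m : ℕ) : Submodule k M := ⨆ n, ⨆ (_ : n < m), K.V n

lemma V_le_fil {n m : ℕ} (h : n < m) : K.V n ≤ K.fil m := le_iSup₂_of_le n h le_rfl

lemma fil_mono {m m' : ℕ} (h : m ≤ m') : K.fil m ≤ K.fil m' :=
  iSup₂_le fun _ hn => K.V_le_fil (hn.trans_le h)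

lemma exists_mem_fil (x : M) : ∃ m, x ∈ K.fil m := by
  have hx : x ∈ ⨆ n, K.V n := K.iSup_V ▸ Submodule.mem_top
  refine Submodule.iSup_induction _ (motive := fun x => ∃ m, x ∈ K.fil m) hx
    (fun n x hx => ⟨n + 1, K.V_le_fil n.lt_succ_self hx⟩) ⟨0, zero_mem _⟩ ?_
  rintro x y ⟨m, hx⟩ ⟨m', hy⟩
  exact ⟨max m m', add_mem (K.fil_mono (le_max_left _ _) hx) (K.fil_mono (le_max_right _ _) hy)⟩

section Contraction

variable {h : Module.End k M} (hd : ∀ x, K.d (h x) + h (K.d x) = x)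
include hd

lemma exists_d_eq {x : M} (hx : K.d x = 0) : x ∈ LinearMap.range K.d :=
  ⟨h x, by simpa [hx] using hd x⟩

variable (h₀ : ∀ x ∈ K.V 0, h x = 0) (h₁ : ∀ n, ∀ x ∈ K.V (n + 1), h x ∈ K.V n)

include h₀ h₁ in
omit hd in
-- Both i and h lower the degree by one. Only a drop of the degree bound by one is needed for the
-- induction in `exists_diff_eq`.
lemma i_h_mem_fil (m : ℕ) {x : M} (hx : x ∈ K.fil (m + 1)) : K.i (h x) + h (K.i x) ∈ K.fil m := by
  have key : K.fil (m + 1) ≤ (K.fil m).comap (K.i ∘ₗ h + h ∘ₗ K.i) := by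
    refine iSup₂_le fun n hn x hx => ?_
    change K.i (h x) + h (K.i x) ∈ K.fil m
    rcases n with _ | _ | n
    · simp [h₀ x hx, K.i_zero hx]
    · simp [K.i_zero (h₁ 0 x hx), h₀ _ (K.i_mem hx)]
    · exact K.V_le_fil (by omega : n < m) (add_mem (K.i_mem (h₁ _ x hx)) (h₁ _ _ (K.i_mem hx)))
  exact key hx

include h₀ h₁ in
/-- Cycles of bounded degree are boundaries. -/
lemma exists_diff_eq (m : ℕ) (z : HahnSeries ℤ M) (hz : diff K.i K.d z = 0)
    (hm : ∀ j, z.coeff j ∈ K.fil m) : ∃ w, diff K.i K.d w = z := by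
  induction m generalizing z with
  | zero =>
    refine ⟨0, ?_⟩
    ext j
    have := hm j
    simp only [fil, not_lt_zero, iSup_false, iSup_bot, Submodule.mem_bot] at this
    simp [this]
  | succ m ih =>
    have hz' (j : ℤ) : K.i (z.coeff (j + 1)) = K.d (z.coeff j) := by
      have e := congrArg (fun t => HahnSeries.coeff t (j + 1)) hz
      simpa [sub_eq_zero] using e
    -- The operator u⁻¹ h contracts -ud up to sign. Adding the boundary of u⁻¹ h z to z leaves only
    -- the error u⁻¹ (i h + h i) z, a cycle with a smaller degree bound.
    have e : z + diff K.i K.d (uInv k M (mapCoeff h z)) =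
        uInv k M (mapCoeff (K.i ∘ₗ h + h ∘ₗ K.i) z) := by
      ext j
      have e := hd (z.coeff j)
      simp only [HahnSeries.coeff_add, diff_coeff, uInv_coeff, mapCoeff_coeff,
        LinearMap.add_apply, LinearMap.comp_apply, sub_add_cancel, hz']
      nth_rewrite 1 [← e]
      abel
    obtain ⟨w, hw⟩ := ih (z + diff K.i K.d (uInv k M (mapCoeff h z))) (by
        rw [map_add, hz, zero_add]
        ext j
        simp only [diff_coeff, map_sub, K.i_i, K.dd, sub_zero, zero_sub, HahnSeries.coeff_zero]
        rw [← neg_add', add_comm, neg_eq_zero, add_comm]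
        exact K.i_d _)
      (fun j => by rw [e]; exact K.i_h_mem_fil h₀ h₁ m (hm _))
    exact ⟨w - uInv k M (mapCoeff h z), by rw [map_sub, hw]; abel⟩

variable {s : M → M} (hs : ∀ x ∈ LinearMap.range K.d, K.d (s x) = x)
include hs

/-- Write x_j for the iterates. Then d i x_j = -i d x_j, where d x₀ = f and d x_{j+1} = i x_j; this
vanishes since i f = 0 and i² = 0. Closed elements are exact by the contraction h. -/
lemma i_iterate_mem_range {f : M} (hf : f ∈ K.exactAnti) (j : ℕ) :
    K.i ((s ∘ K.i)^[j] (s f)) ∈ LinearMap.range K.d := by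
  induction j with
  | zero =>
    refine K.exists_d_eq hd ?_
    have e := K.i_d (s f)
    obtain ⟨x, -, rfl⟩ := id hf
    rw [hs _ ⟨x, rfl⟩, i_of_exactAnti hf, zero_add] at e
    exact e
  | succ j ih =>
    refine K.exists_d_eq hd ?_
    rw [Function.iterate_succ_apply', Function.comp_apply]
    have e := K.i_d (s (K.i ((s ∘ K.i)^[j] (s f))))
    rwa [hs _ ih, i_i, zero_add] at e

include h₀ h₁ in
-- The two representatives are compared in Laurent series, where neither is a cycle but both have
-- differential -uf. Their difference is a genuine Laurent cycle of bounded degree, hence a boundary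
-- by `exists_diff_eq`, and this persists modulo u M[[u]].
lemma isClassOf_ordEmb (f : K.exactAnti) (N : ℕ) (hN : ∀ j ≥ N, (s ∘ K.i)^[j] (s f.1) = 0) :
    IsClassOf (K.ordEmb f) (Submodule.Quotient.mk
      (∑ j ∈ Finset.range N, HahnSeries.single (-(j : ℤ)) ((s ∘ K.i)^[j] (s f.1)))) := by
  set x : ℕ → M := fun j => (s ∘ K.i)^[j] (s f.1) with hx
  set Z : HahnSeries ℤ M := ∑ j ∈ Finset.range N, HahnSeries.single (-(j : ℤ)) (x j) with hZ
  have hcoeff (t : ℤ) : Z.coeff t = ∑ j ∈ Finset.range N, if t = -(j : ℤ) then x j else 0 := by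
    rw [hZ, HahnSeries.coeff_sum]
    refine Finset.sum_congr rfl fun j _ => ?_
    rw [HahnSeries.coeff_single]
    congr
  have hpos (t : ℤ) (ht : 0 < t) : Z.coeff t = 0 := by
    rw [hcoeff]
    exact Finset.sum_eq_zero fun j _ => if_neg (by omega)
  have hneg (j : ℕ) : Z.coeff (-(j : ℤ)) = x j := by
    rw [hcoeff]
    by_cases hj : j < N
    · rw [Finset.sum_eq_single_of_mem j (Finset.mem_range.2 hj) fun j' _ h => if_neg (by omega),
        if_pos rfl]
    · rw [hx]
      dsimp only
      rw [hN j (by omega)]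
      exact Finset.sum_eq_zero fun j' h' => if_neg (by have := Finset.mem_range.1 h'; omega)
  have hf : f.1 ∈ LinearMap.range K.d := by
    obtain ⟨z, -, h⟩ := f.2
    exact ⟨z, h⟩
  have hcyc : diff K.i K.d (Z - constL k M (K.G' f.1)) = 0 := by
    ext t
    rw [diff_coeff, HahnSeries.coeff_sub, HahnSeries.coeff_sub, HahnSeries.coeff_zero]
    -- For t ≤ 0 the terms cancel by d x_{j+1} = i x_j and i G' = 0. At t = 1 both series contribute
    -- -f, and beyond that all coefficients are zero.
    rcases lt_trichotomy t 1 with ht | rfl | ht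
    · obtain ⟨j, rfl⟩ : ∃ j : ℕ, t = -(j : ℤ) := ⟨t.natAbs, by omega⟩
      have e : -(j : ℤ) - 1 = -((j + 1 : ℕ) : ℤ) := by push_cast; ring
      have e' : K.d (x (j + 1)) = K.i (x j) := by
        rw [hx]
        dsimp only
        rw [Function.iterate_succ_apply', Function.comp_apply]
        exact hs _ (K.i_iterate_mem_range hd hs f.2 j)
      have e'' : K.i ((constL k M (K.G' f.1)).coeff (-(j : ℤ))) = 0 := by
        rcases j with _ | j
        · rw [Nat.cast_zero, neg_zero, constL_coeff_zero, i_G']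
        · rw [constL_coeff_of_ne _ (by push_cast; omega), map_zero]
      rw [map_sub, e'', e, hneg, hneg, constL_coeff_of_ne _ (by push_cast; omega), sub_zero,
        sub_zero, e', sub_self]
    · have e := hneg 0
      rw [Nat.cast_zero, neg_zero] at e
      rw [hpos 1 one_pos, constL_coeff_of_ne _ one_ne_zero, sub_self, sub_self, map_zero, e,
        constL_coeff_zero, map_sub, d_G'_of_exactAnti f.2, zero_sub, neg_eq_zero, sub_eq_zero]
      exact hs _ hf
    · rw [hpos t (by omega), hpos _ (by omega), constL_coeff_of_ne _ (by omega),
        constL_coeff_of_ne _ (by omega)]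
      simp
  obtain ⟨m, hm⟩ : ∃ m, ∀ t, (Z - constL k M (K.G' f.1)).coeff t ∈ K.fil m := by
    choose μ hμ using K.exists_mem_fil
    -- Only finitely many coefficients occur, and the sum of their degree bounds serves as a common
    -- bound.
    refine ⟨∑ j ∈ Finset.range N, μ (x j) + μ (K.G' f.1), fun t => ?_⟩
    rw [HahnSeries.coeff_sub, hcoeff]
    refine sub_mem (sum_mem fun j hj => ?_) ?_
    · split_ifs
      · refine K.fil_mono ?_ (hμ _)
        exact (Finset.single_le_sum (f := fun j => μ (x j)) (fun _ _ => Nat.zero_le _) hj).trans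
          (Nat.le_add_right _ _)
      · exact zero_mem _
    · by_cases ht : t = 0
      · rw [ht, constL_coeff_zero]
        exact K.fil_mono (Nat.le_add_left _ _) (hμ _)
      · rw [constL_coeff_of_ne _ ht]
        exact zero_mem _
  obtain ⟨w, hw⟩ := K.exists_diff_eq hd h₀ h₁ m _ hcyc hm
  have hZc : diffPol K.i K.d (Submodule.Quotient.mk Z) = 0 := by
    have e : diffPol K.i K.d (Submodule.Quotient.mk Z - K.ordCycles f) = 0 :=
      congrArg (uPow k M 1).mkQ hcyc
    rwa [map_sub, K.diffPol_ordCycles, sub_zero] at e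
  refine ⟨hZc, ?_⟩
  change Homol.mk (K.ordCycles f) (K.diffPol_ordCycles f) = Homol.mk _ hZc
  rw [eq_comm, Homol.mk_eq_mk_iff]
  exact ⟨(uPow k M 1).mkQ w, congrArg (uPow k M 1).mkQ hw⟩

end Contraction

/-- The elements of degree `m`, for an integer `m`. -/
def degZ (m : ℤ) : Submodule k M := ⨆ (p : ℕ) (_ : (p : ℤ) = m), K.V p

lemma V_le_degZ (n : ℕ) : K.V n ≤ K.degZ n := le_iSup₂_of_le n rfl le_rfl

lemma degZ_of_neg {m : ℤ} (hm : m < 0) {x : M} (hx : x ∈ K.degZ m) : x = 0 := by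
  have h : K.degZ m ≤ ⊥ := iSup₂_le fun p hp => by omega
  exact (Submodule.mem_bot k).1 (h hx)

lemma i_mem_degZ {m : ℤ} {x : M} (hx : x ∈ K.degZ m) : K.i x ∈ K.degZ (m - 1) := by
  have h : K.degZ m ≤ (K.degZ (m - 1)).comap K.i := iSup₂_le fun p hp x h => by
    subst hp
    cases p with
    | zero => simp [K.i_zero h]
    | succ p =>
      rw [Submodule.mem_comap, Nat.cast_add, Nat.cast_one, add_sub_cancel_right]
      exact K.V_le_degZ p (K.i_mem h)
  exact h hx

lemma map_mem_degZ {T : Module.End k M} (hT : ∀ {n x}, x ∈ K.V n → T x ∈ K.V n) {m : ℤ} {x : M}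
    (hx : x ∈ K.degZ m) : T x ∈ K.degZ m := by
  have h : K.degZ m ≤ (K.degZ m).comap T := iSup₂_le fun p hp x h => by
    subst hp
    exact K.V_le_degZ p (hT h)
  exact h hx

/-- Both i and a homogeneous s lower the degree by one, so each iteration lowers it by two. The
iterates eventually land in negative degree, where everything is zero. -/
lemma iterate_mem_degZ {h : Module.End k M} (hd : ∀ x, K.d (h x) + h (K.d x) = x) {s : M → M}
    (hs : ∀ x ∈ LinearMap.range K.d, K.d (s x) = x)
    (hdeg : ∀ m : ℤ, ∀ x ∈ LinearMap.range K.d ⊓ K.degZ (m + 1), s x ∈ K.degZ m)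
    {m : ℤ} {f : M} (hf : f ∈ K.exactAnti) (hfm : f ∈ K.degZ (m + 1)) (j : ℕ) :
    (s ∘ K.i)^[j] (s f) ∈ K.degZ (m - 2 * j) := by
  induction j with
  | zero =>
    obtain ⟨x, -, rfl⟩ := id hf
    simpa using hdeg m _ ⟨⟨x, rfl⟩, hfm⟩
  | succ j ih =>
    rw [Function.iterate_succ_apply', Function.comp_apply]
    refine hdeg _ _ ⟨K.i_iterate_mem_range hd hs hf j, ?_⟩
    have e : m - 2 * ((j + 1 : ℕ) : ℤ) + 1 = m - 2 * j - 1 := by push_cast; ring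
    rw [e]
    exact K.i_mem_degZ ih

/-! ### Gradings and functoriality of the comparisons -/

/-- The total grading. -/
def tot (n : ℤ) : ℤ → Submodule k M := fun j => K.degZ (n + 2 * j)

lemma map_perEquiv (n : ℤ) : (partPer K.b K.B (K.tot n)).map K.perEquiv.toLinearMap =
    partPer K.i K.d (K.tot n) := by
  refine le_antisymm ?_ fun y hy => ⟨mapPer K.F K.F_i K.F_d y, ?_, K.perEquiv.apply_symm_apply y⟩
  · rintro _ ⟨x, hx, rfl⟩
    exact mapPer_mem_part K.E_b K.E_B (fun _ _ => K.map_mem_degZ K.E_mem) hx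
  · exact mapPer_mem_part K.F_i K.F_d (fun _ _ => K.map_mem_degZ K.F_mem) hy

section Quotients

variable {W : Type*} [AddCommGroup W] [Module k W] (ι : W →ₗ[k] HNeg K.i K.d)
  (hι : LinearMap.range ι = partNeg K.i K.d fun _ => K.antiharmonic)
  (ι₀ : W →ₗ[k] HOrd K.i K.d)
  (hι₀ : LinearMap.range ι₀ = partOrd K.i K.d fun _ => K.antiharmonic)

lemma negEquiv_eq_mk_iff {x : HNeg K.b K.B} {z : HNeg K.i K.d} :
    K.negEquiv ι hι x = Submodule.Quotient.mk z ↔ mapNeg K.F K.F_i K.F_d z = x :=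
  quotEquiv_eq_mk_iff

lemma ordEquiv_eq_mk_iff {x : HOrd K.b K.B} {z : HOrd K.i K.d} :
    K.ordEquiv ι₀ hι₀ x = Submodule.Quotient.mk z ↔ mapOrd K.F K.F_i K.F_d z = x :=
  quotEquiv_eq_mk_iff

lemma negEquiv_uNeg {x : HNeg K.b K.B} {z : HNeg K.i K.d}
    (h : K.negEquiv ι hι x = Submodule.Quotient.mk z) :
    K.negEquiv ι hι (uNeg _ _ x) = Submodule.Quotient.mk (uNeg _ _ z) := by
  rw [negEquiv_eq_mk_iff] at h ⊢
  rw [mapNeg_uNeg, h]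

lemma ordEquiv_uOrd {x : HOrd K.b K.B} {z : HOrd K.i K.d}
    (h : K.ordEquiv ι₀ hι₀ x = Submodule.Quotient.mk z) :
    K.ordEquiv ι₀ hι₀ (uOrd _ _ x) = Submodule.Quotient.mk (uOrd _ _ z) := by
  rw [ordEquiv_eq_mk_iff] at h ⊢
  rw [mapOrd_uOrd, h]

lemma map_negEquiv (n : ℤ) : (partNeg K.b K.B (K.tot n)).map (K.negEquiv ι hι).toLinearMap =
    (partNeg K.i K.d (K.tot n)).map (LinearMap.range ι).mkQ :=
  map_quotEquiv
    (fun _ hx => mapNeg_mem_part K.E_b K.E_B (fun _ _ => K.map_mem_degZ K.E_mem) hx)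
    (fun _ hx => mapNeg_mem_part K.F_i K.F_d (fun _ _ => K.map_mem_degZ K.F_mem) hx)

lemma map_ordEquiv (n : ℤ) : (partOrd K.b K.B (K.tot n)).map (K.ordEquiv ι₀ hι₀).toLinearMap =
    (partOrd K.i K.d (K.tot n)).map (LinearMap.range ι₀).mkQ :=
  map_quotEquiv
    (fun _ hx => mapOrd_mem_part K.E_b K.E_B (fun _ _ => K.map_mem_degZ K.E_mem) hx)
    (fun _ hx => mapOrd_mem_part K.F_i K.F_d (fun _ _ => K.map_mem_degZ K.F_mem) hx)

end Quotients

section Functoriality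

variable {K K'} {f : M →ₗ[k] M'} (hκ : f ∘ₗ K.κ = K'.κ ∘ₗ f) (hb : f ∘ₗ K.b = K'.b ∘ₗ f)
  (hB : f ∘ₗ K.B = K'.B ∘ₗ f) (hi : f ∘ₗ K.i = K'.i ∘ₗ f) (hd : f ∘ₗ K.d = K'.d ∘ₗ f)

include hκ in
lemma perEquiv_map (hc : f ∘ₗ K.c = K'.c ∘ₗ f) (x : HPer K.b K.B) :
    K'.perEquiv (mapPer f hb hB x) = mapPer f hi hd (K.perEquiv x) :=
  Homol.map_map_eq _ (mapCoeff_diff _ K'.E_b K'.E_B) (mapCoeff_diff _ K.E_b K.E_B) _ (fun _ => by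
    ext j
    exact (E_comm (LinearMap.congr_fun hκ) (LinearMap.congr_fun hc) _).symm) x

include hκ in
lemma negEquiv_map (hc' : f ∘ₗ K.c' = K'.c' ∘ₗ f) {W W' : Type*} [AddCommGroup W] [Module k W]
    [AddCommGroup W'] [Module k W'] {ι : W →ₗ[k] HNeg K.i K.d}
    {hι : LinearMap.range ι = partNeg K.i K.d fun _ => K.antiharmonic}
    {ι' : W' →ₗ[k] HNeg K'.i K'.d}
    {hι' : LinearMap.range ι' = partNeg K'.i K'.d fun _ => K'.antiharmonic}
    {x : HNeg K.b K.B} {z : HNeg K.i K.d} (h : K.negEquiv ι hι x = Submodule.Quotient.mk z) :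
    K'.negEquiv ι' hι' (mapNeg f hb hB x) = Submodule.Quotient.mk (mapNeg f hi hd z) := by
  rw [negEquiv_eq_mk_iff] at h ⊢
  rw [← h]
  exact Homol.map_map_eq _ _ _ _ (fun _ => Subtype.ext (by
    ext j
    exact (F_comm (LinearMap.congr_fun hκ) (LinearMap.congr_fun hc') _).symm)) z

include hκ in
lemma ordEquiv_map (hc' : f ∘ₗ K.c' = K'.c' ∘ₗ f) {W W' : Type*} [AddCommGroup W] [Module k W]
    [AddCommGroup W'] [Module k W'] {ι : W →ₗ[k] HOrd K.i K.d}
    {hι : LinearMap.range ι = partOrd K.i K.d fun _ => K.antiharmonic}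
    {ι' : W' →ₗ[k] HOrd K'.i K'.d}
    {hι' : LinearMap.range ι' = partOrd K'.i K'.d fun _ => K'.antiharmonic}
    {x : HOrd K.b K.B} {z : HOrd K.i K.d} (h : K.ordEquiv ι hι x = Submodule.Quotient.mk z) :
    K'.ordEquiv ι' hι' (mapOrd f hb hB x) = Submodule.Quotient.mk (mapOrd f hi hd z) := by
  rw [ordEquiv_eq_mk_iff] at h ⊢
  rw [← h]
  refine Homol.map_map_eq _ _ _ _ (fun t => ?_) z
  obtain ⟨t, rfl⟩ := Submodule.mkQ_surjective _ t
  refine congrArg (Submodule.mkQ _) ?_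
  ext j
  exact (F_comm (LinearMap.congr_fun hκ) (LinearMap.congr_fun hc') _).symm

include hκ hb in
-- The primitive G' f is built from κ and b alone, so it is preserved by every map that commutes
-- with these. An arbitrary section of d has no such naturality.
lemma ordEmb_map {x : K.exactAnti} {x' : K'.exactAnti} (h : x'.1 = f x.1) :
    K'.ordEmb x' = mapOrd f hi hd (K.ordEmb x) := by
  refine Homol.mk_congr (congrArg (Submodule.mkQ _) ?_) _
  ext j
  change (constL k M' (K'.G' x'.1)).coeff j = f ((constL k M (K.G' x.1)).coeff j)
  rw [h, ← G'_comm (LinearMap.congr_fun hκ) (LinearMap.congr_fun hb)]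
  rcases eq_or_ne j 0 with rfl | h
  · rw [constL_coeff_zero, constL_coeff_zero]
  · rw [constL_coeff_of_ne _ h, constL_coeff_of_ne _ h, map_zero]

end Functoriality

end KaroubiModule

section Concrete

variable (k : Type u) [CommRing k] (A : Type v) [Ring A] [Algebra k A]

/-! ### The Karoubi module of reduced forms -/

/-- Multiplication by `c n` on forms of degree `n`. -/
def scale (c : ℕ → k) : Omega k A →ₗ[k] Omega k A :=
  Polynomial.lsum (fun n => c n • LinearMap.id) ∘ₗ (comps k A).toLinearMap

lemma scale_of_mem_deg (c : ℕ → k) {n : ℕ} {ω : Omega k A} (h : ω ∈ deg k A n) :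
    scale k A c ω = c n • ω := by
  simp [scale, comps_of_mem_deg k A h, Polynomial.lsum]

/-- Multiplication by `c n` on reduced forms of degree `n`. -/
def scaleBar (c : ℕ → k) : Obar k A →ₗ[k] Obar k A :=
  descend (scale k A c) (c 0) (scale_of_mem_deg k A c (one_mem_deg k A))

variable {k A} in
lemma descend_toBar {T : Omega k A →ₗ[k] Omega k A} {c : k} {h : T 1 = c • 1} (ω : Omega k A) :
    descend T c h (toBar k A ω) = toBar k A (T ω) := rfl

lemma kappaBar_pow_toBar (j : ℕ) (ω : Omega k A) :
    (kappaBar k A ^ j) (toBar k A ω) = toBar k A ((kappa k A ^ j) ω) := by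
  induction j generalizing ω with
  | zero => rfl
  | succ j ih => rw [pow_succ, pow_succ, Module.End.mul_apply, Module.End.mul_apply, ← ih]; rfl

lemma toBar_surjective : Function.Surjective (toBar k A) := Submodule.mkQ_surjective _

lemma toBar_one : toBar k A 1 = 0 := by
  rw [toBar, Submodule.mkQ_apply, Submodule.Quotient.mk_eq_zero]
  exact ⟨1, by simp⟩

/-- The Karoubi module of reduced forms. -/
def karoubi [Algebra ℚ k] : KaroubiModule k (Obar k A) where
  κ := kappaBar k A
  b := bBar k A
  d := dBar k A
  i := iBar k A
  B := connesBBar k A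
  c := scaleBar k A fun n => algebraMap ℚ k (n.factorial : ℚ)⁻¹
  c' := scaleBar k A fun n => algebraMap ℚ k (n.factorial : ℚ)
  V n := (deg k A n).map (toBar k A)
  iSup_V := by
    rw [← Submodule.map_iSup, iSup_deg, Submodule.map_top]
    exact LinearMap.range_eq_top.2 (toBar_surjective k A)
  b_mem := by
    rintro n _ ⟨ω, hω, rfl⟩
    exact ⟨_, bOp_mem_deg hω, rfl⟩
  b_zero := by
    rintro _ ⟨ω, hω, rfl⟩
    rw [bBar, descend_toBar, bOp_of_mem_deg_zero k A hω, map_zero]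
  d_mem := by
    rintro n _ ⟨ω, hω, rfl⟩
    exact ⟨_, dOp_mem_deg hω, rfl⟩
  bb x := by
    obtain ⟨ω, rfl⟩ := toBar_surjective k A x
    exact congrArg (toBar k A) (LinearMap.congr_fun (bOp_bOp k A) ω)
  dd x := by
    obtain ⟨ω, rfl⟩ := toBar_surjective k A x
    exact congrArg (toBar k A) (LinearMap.congr_fun (dOp_dOp k A) ω)
  bd x := by
    obtain ⟨ω, rfl⟩ := toBar_surjective k A x
    exact congrArg (toBar k A) (LinearMap.congr_fun (bOp_dOp_add k A) ω)
  κ_pow_d := by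
    rintro n _ ⟨ω, hω, rfl⟩
    rw [dBar, descend_toBar, kappaBar_pow_toBar, kappa_pow_dOp hω]
  κ_pow_sub := by
    rintro n _ ⟨ω, hω, rfl⟩
    rw [dBar, bBar, descend_toBar, kappaBar_pow_toBar, kappaBar_pow_toBar, descend_toBar,
      ← kappa_pow_sub hω, map_sub]
  i_eq := by
    rintro n _ ⟨ω, hω, rfl⟩
    rw [iBar, bBar, descend_toBar, descend_toBar, iOp_of_mem_deg hω, map_sum]
    exact Finset.sum_congr rfl fun j _ => (kappaBar_pow_toBar k A j _).symm
  B_eq := by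
    rintro n _ ⟨ω, hω, rfl⟩
    rw [connesBBar, dBar, descend_toBar, descend_toBar, connesB_of_mem_deg k A hω, map_sum]
    exact Finset.sum_congr rfl fun j _ => (kappaBar_pow_toBar k A j _).symm
  c_eq := by
    rintro n _ ⟨ω, hω, rfl⟩
    rw [scaleBar, descend_toBar, scale_of_mem_deg k A _ hω, map_smul]
  c'_eq := by
    rintro n _ ⟨ω, hω, rfl⟩
    rw [scaleBar, descend_toBar, scale_of_mem_deg k A _ hω, map_smul]

section Functoriality

variable {k A} {A' : Type v} [Ring A'] [Algebra k A'] (φ : A →ₐ[k] A')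

lemma obarMap_kappaBar : obarMap φ ∘ₗ kappaBar k A = kappaBar k A' ∘ₗ obarMap φ :=
  obarMap_descend φ (kappa_omegaMap φ)

lemma obarMap_scaleBar (c : ℕ → k) :
    obarMap φ ∘ₗ scaleBar k A c = scaleBar k A' c ∘ₗ obarMap φ :=
  obarMap_descend φ fun ω => by
    simp only [scale, LinearMap.comp_apply, AlgHom.toLinearMap_apply, comps_omegaMap]
    exact lsum_map φ (fun n ω => by simp) _

end Functoriality

/-! ### Commutators of exact forms -/

lemma range_dA_pow_le_range_dOp (n : ℕ) :
    LinearMap.range (dA k A) ^ (n + 1) ≤ LinearMap.range (dOp k A) := by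
  rw [range_dA_pow, Submodule.span_le]
  rintro _ ⟨l, hl, rfl⟩
  obtain ⟨a, l, rfl⟩ := List.exists_cons_of_length_eq_add_one hl
  exact ⟨_, dOp_inc_mul_word k A a l⟩

lemma coeff_comps_dOp (ω : Omega k A) : (comps k A (dOp k A ω)).coeff 0 = 0 ∧
    ∀ m, (comps k A (dOp k A ω)).coeff m ∈ LinearMap.range (dA k A) ^ m := by
  have hω : ω ∈ ⨆ n, deg k A n := iSup_deg k A ▸ Submodule.mem_top
  refine Submodule.iSup_induction _ (motive := fun ω => (comps k A (dOp k A ω)).coeff 0 = 0 ∧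
    ∀ m, (comps k A (dOp k A ω)).coeff m ∈ LinearMap.range (dA k A) ^ m) hω
    (fun n ω h => ?_) (by simp) (fun x y hx hy => ?_)
  · rw [comps_of_mem_deg k A (dOp_mem_deg h)]
    refine ⟨by rw [Polynomial.coeff_monomial_of_ne _ (by omega)], fun m => ?_⟩
    rcases eq_or_ne (n + 1) m with rfl | hm
    · rw [Polynomial.coeff_monomial_same]
      exact dOp_mem_pow h
    · rw [Polynomial.coeff_monomial_of_ne _ hm.symm]
      exact zero_mem _
  · simp only [map_add, Polynomial.coeff_add]
    exact ⟨by rw [hx.1, hy.1, add_zero], fun m => add_mem (hx.2 m) (hy.2 m)⟩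

/-- A primitive of x need not be homogeneous, so the components of its differential are compared
through `comps`. -/
lemma mem_pow_of_mem_range_dOp {m : ℕ} {x : Omega k A} (hx : x ∈ LinearMap.range (dOp k A))
    (hm : x ∈ deg k A m) : (m = 0 → x = 0) ∧ x ∈ LinearMap.range (dA k A) ^ m := by
  obtain ⟨ω, rfl⟩ := hx
  have h := coeff_comps_dOp k A ω
  rw [comps_of_mem_deg k A hm] at h
  refine ⟨?_, by simpa using h.2 m⟩
  rintro rfl
  simpa using h.1

/-- The n differentials of z are rotated to the front; the sign (-1)^(n(n+1)) is trivial.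
Consequently the graded commutator of x and z is (1 - κⁿ)(xz). -/
lemma kappa_pow_mul_of_mem_pow {m n : ℕ} {x z : Omega k A} (hx : x ∈ deg k A m)
    (hz : z ∈ LinearMap.range (dA k A) ^ n) :
    (kappa k A ^ n) (x * z) = (-1 : k) ^ (m * n) • (z * x) := by
  rw [range_dA_pow] at hz
  refine LinearMap.eqOn_span (f := (kappa k A ^ n) ∘ₗ LinearMap.mulLeft k x)
    (g := (-1 : k) ^ (m * n) • LinearMap.mulRight k x) ?_ hz
  rintro _ ⟨l, rfl, rfl⟩
  have h := kappa_pow_mul_word k A hx l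
  have e : l.length * (m + l.length + 1) = m * l.length + l.length * (l.length + 1) := by ring
  rw [e, pow_add, neg_one_pow_mul_succ, mul_one] at h
  exact h

variable [Algebra ℚ k]

/-- One inclusion holds because d (1 - κ) = (1 - κ) d and (1 - κ)(w da) = [w, da] for a product w of
differentials. For the other, [x, z] = (1 - κⁿ)(xz) with xz exact, and `d_sub_pow_mem` applies. -/
lemma exactAnti_eq_commBar : (karoubi k A).exactAnti = commBar k A := by
  refine le_antisymm ?_ (Submodule.map_le_iff_le_comap.2 (Submodule.span_le.2 ?_))
  · have key : ∀ t, (karoubi k A).d ((karoubi k A).y t) ∈ commBar k A := by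
      intro t
      obtain ⟨ω, rfl⟩ := toBar_surjective k A t
      rw [← KaroubiModule.y_d]
      change toBar k A (dOp k A ω - kappa k A (dOp k A ω)) ∈ _
      refine Submodule.mem_map_of_mem (f := toBar k A) ?_
      have hω : ω ∈ ⨆ n, deg k A n := iSup_deg k A ▸ Submodule.mem_top
      have hle : ⨆ n, deg k A n ≤ (superComm k A (LinearMap.range (dOp k A))).comap
          ((LinearMap.id - kappa k A) ∘ₗ dOp k A) := by
        refine iSup_le fun n ω hω => ?_
        refine map_mem_of_mem_deg (T := (LinearMap.id - kappa k A) ∘ₗ dOp k A)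
          (S := superComm k A (LinearMap.range (dOp k A))) (fun a l _ => ?_) hω
        rw [LinearMap.comp_apply, dOp_inc_mul_word, LinearMap.sub_apply, LinearMap.id_apply]
        have hc (c : A) : dA k A (abar k A c) ∈ LinearMap.range (dOp k A) ⊓ deg k A 1 :=
          ⟨⟨_, dOp_inc k A c⟩, dA_mem_deg k A _⟩
        induction l using List.reverseRecOn with
        | nil =>
          have h := kappa_mul_dA k A (one_mem_deg k A) (abar k A a)
          rw [one_mul, pow_zero, one_smul, mul_one] at h
          rw [word_singleton, h, sub_self]
          exact zero_mem _
        | append_singleton l c _ =>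
          rw [← List.cons_append, word_append, word_singleton,
            kappa_mul_dA k A (word_mem_deg k A _)]
          refine Submodule.subset_span ⟨(a :: l).length, 1, _, _,
            ⟨⟨_, dOp_inc_mul_word k A a l⟩, word_mem_deg k A _⟩, hc c, ?_⟩
          rw [mul_one]
      exact hle hω
    rintro _ ⟨_, ⟨t, rfl⟩, rfl⟩
    rw [sq, Module.End.mul_apply]
    exact key _
  · rintro _ ⟨m, n, x, z, ⟨hx, hxm⟩, ⟨hz, hzn⟩, rfl⟩
    obtain ⟨hx₀, hx'⟩ := mem_pow_of_mem_range_dOp k A hx hxm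
    obtain ⟨-, hz'⟩ := mem_pow_of_mem_range_dOp k A hz hzn
    -- An exact form of degree 0 vanishes. Otherwise xz has positive degree and, as a combination of
    -- products of differentials, is itself exact.
    rcases m with _ | m
    · rw [hx₀ rfl]
      simp
    · have h : x * z ∈ LinearMap.range (dA k A) ^ (m + n + 1) := by
        rw [add_right_comm, pow_add]
        exact Submodule.mul_mem_mul hx' hz'
      obtain ⟨ω, hω⟩ := range_dA_pow_le_range_dOp k A _ h
      rw [← kappa_pow_mul_of_mem_pow k A hxm hz', ← hω]
      have e := (karoubi k A).d_sub_pow_mem n (toBar k A ω)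
      change toBar k A (dOp k A ω) - (kappaBar k A ^ n) (toBar k A (dOp k A ω)) ∈ _ at e
      rw [kappaBar_pow_toBar, ← map_sub] at e
      exact e

end Concrete

/-! ### A contraction of the de Rham differential -/

section Contraction

variable (k : Type u) [CommRing k] (A : Type v) [Ring A] [Algebra k A] [SplitUnit k A]

/-- A retraction of the unit map. -/
def retr : A →ₗ[k] k := (SplitUnit.exists_retraction (k := k) (A := A)).choose

lemma retr_one : retr k A 1 = 1 := by
  have h := (SplitUnit.exists_retraction (k := k) (A := A)).choose_spec 1
  rwa [map_one] at h

/-- The section of `A → A / k` with values in the kernel of the retraction. -/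
def sect : Abar k A →ₗ[k] A :=
  (LinearMap.range (Algebra.linearMap k A)).liftQ
    (LinearMap.id - (retr k A).smulRight (1 : A)) (by
      rintro _ ⟨c, rfl⟩
      simp [Algebra.algebraMap_eq_smul_one, retr_one])

lemma sect_abar (a : A) : sect k A (abar k A a) = a - retr k A a • 1 :=
  (Submodule.liftQ_apply _ _ a).trans (by simp)

lemma abar_sect (x : Abar k A) : abar k A (sect k A x) = x := by
  obtain ⟨a, rfl⟩ := Submodule.mkQ_surjective _ x
  change abar k A (sect k A (abar k A a)) = abar k A a
  rw [sect_abar, map_sub, map_smul, abar_one, smul_zero, sub_zero]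

/-- Recursion for the contraction `a₀ da₁ ⋯ daₙ ↦ r(a₀) a₁ da₂ ⋯ daₙ`. -/
def contrAux : ℕ → Omega k A →ₗ[k] Omega k A
  | 0 => 0
  | 1 => TensorProduct.lift (((LinearMap.lsmul k (Omega k A)).flip ∘ₗ
      (inc k A).toLinearMap ∘ₗ sect k A).flip ∘ₗ
      (retr k A ∘ₗ LinearMap.fst k A (Omega k A ⊗[k] Abar k A) ∘ₗ splitLast k A)) ∘ₗ
      LinearMap.snd k A (Omega k A ⊗[k] Abar k A) ∘ₗ splitLast k A
  | n + 2 => TensorProduct.lift ((LinearMap.mul k (Omega k A)).compl₁₂ (contrAux (n + 1))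
      (dA k A)) ∘ₗ LinearMap.snd k A (Omega k A ⊗[k] Abar k A) ∘ₗ splitLast k A

/-- The form dc determines c only modulo k; `sect` picks the representative in the kernel of the
retraction. -/
lemma contrAux_word (a c : A) (l : List A) :
    contrAux k A (l.length + 1) (inc k A a * word k A (c :: l)) =
      retr k A a • (inc k A (sect k A (abar k A c)) * word k A l) := by
  induction l using List.reverseRecOn with
  | nil => simp [contrAux, word_singleton]
  | append_singleton l x ih =>
    rw [← List.cons_append, inc_mul_word_append, inc_mul_word_append, ← smul_mul_assoc, ← ih,
      List.length_append, List.length_singleton]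
    simp [contrAux]

/-- The contraction `a₀ da₁ ⋯ daₙ ↦ r(a₀) a₁ da₂ ⋯ daₙ`. -/
def contr : Omega k A →ₗ[k] Omega k A :=
  Polynomial.lsum (contrAux k A) ∘ₗ (comps k A).toLinearMap

lemma contr_of_mem_deg {n : ℕ} {ω : Omega k A} (h : ω ∈ deg k A n) :
    contr k A ω = contrAux k A n ω := by
  simp [contr, comps_of_mem_deg k A h, Polynomial.lsum]

lemma contr_inc (a : A) : contr k A (inc k A a) = 0 := by
  rw [contr_of_mem_deg k A (inc_mem_deg k A a)]; rfl

lemma contr_word (a c : A) (l : List A) : contr k A (inc k A a * word k A (c :: l)) =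
    retr k A a • (inc k A (sect k A (abar k A c)) * word k A l) := by
  rw [contr_of_mem_deg k A (inc_mul_word_mem k A a (c :: l)), List.length_cons, contrAux_word]

lemma contr_mem_deg {n : ℕ} {ω : Omega k A} (h : ω ∈ deg k A (n + 1)) :
    contr k A ω ∈ deg k A n :=
  map_mem_of_mem_deg (fun a l hl => by
    obtain ⟨c, l, rfl⟩ := List.exists_cons_of_length_eq_add_one hl
    obtain rfl : l.length = n := by simpa using hl
    rw [contr_word]
    exact Submodule.smul_mem _ _ (inc_mul_word_mem k A _ l)) h

/-- The contraction on reduced forms. -/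
def contrBar : Obar k A →ₗ[k] Obar k A :=
  descend (contr k A) 0 (by simpa using contr_inc k A 1)

/-- On a₀ da₁ ⋯ daₙ with n > 0 the two terms are r(a₀) da₁ ⋯ daₙ and (a₀ - r(a₀)) da₁ ⋯ daₙ. In
degree 0 only a₀ - r(a₀) remains, which agrees with a₀ modulo k; this is where reduced forms are
needed. -/
lemma dBar_contrBar_add (x : Obar k A) :
    dBar k A (contrBar k A x) + contrBar k A (dBar k A x) = x := by
  obtain ⟨ω, rfl⟩ := toBar_surjective k A x
  have h : toBar k A ∘ₗ (dOp k A ∘ₗ contr k A + contr k A ∘ₗ dOp k A) = toBar k A := by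
    refine linearMap_ext_word fun a l => ?_
    have e : word k A (a :: l) = inc k A 1 * word k A (a :: l) := by simp
    simp only [LinearMap.comp_apply, LinearMap.add_apply]
    rw [dOp_inc_mul_word, e, contr_word, retr_one, one_smul, sect_abar]
    rcases l with _ | ⟨c, l⟩
    · simp [contr_inc, toBar_one]
    · rw [contr_word, map_smul, dOp_inc_mul_word, word_cons, abar_sect, ← word_cons, map_sub,
        map_smul, map_one, sub_mul, smul_mul_assoc, one_mul, add_sub_cancel]
  exact LinearMap.congr_fun h ω

variable [Algebra ℚ k]

lemma contrBar_zero (x : Obar k A) (hx : x ∈ (karoubi k A).V 0) : contrBar k A x = 0 := by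
  obtain ⟨ω, hω, rfl⟩ := hx
  rw [contrBar, descend_toBar, contr_of_mem_deg k A hω]
  exact map_zero _

lemma contrBar_mem (n : ℕ) (x : Obar k A) (hx : x ∈ (karoubi k A).V (n + 1)) :
    contrBar k A x ∈ (karoubi k A).V n := by
  obtain ⟨ω, hω, rfl⟩ := hx
  exact ⟨_, contr_mem_deg k A hω, rfl⟩

end Contraction

/-! ### The comparisons and the embeddings of [dΩ, dΩ] for an algebra -/

section Embeddings

variable (k : Type u) [CommRing k] [Algebra ℚ k] (A : Type v) [Ring A] [Algebra k A]

/-- Commutators of exact forms are the differentials of antiharmonic forms. -/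
def commEquiv : commBar k A ≃ₗ[k] (karoubi k A).exactAnti :=
  LinearEquiv.ofEq _ _ (exactAnti_eq_commBar k A).symm

/-- The embedding of `[dΩ, dΩ]` in `H (Ω̄[[u]], i - u d)`. -/
def commNeg : commBar k A →ₗ[k] HRneg k A :=
  (karoubi k A).negEmb ∘ₗ (commEquiv k A).toLinearMap

/-- The embedding of `[dΩ, dΩ]` in `H (Ω̄ ⊗ R, i - u d)`. -/
def commOrd : commBar k A →ₗ[k] HR k A :=
  (karoubi k A).ordEmb ∘ₗ (commEquiv k A).toLinearMap

lemma range_commNeg :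
    LinearMap.range (commNeg k A) = partNeg _ _ fun _ => (karoubi k A).antiharmonic :=
  (LinearMap.range_comp_of_range_eq_top _ (commEquiv k A).range).trans
    (karoubi k A).range_negEmb

lemma range_commOrd :
    LinearMap.range (commOrd k A) = partOrd _ _ fun _ => (karoubi k A).antiharmonic :=
  (LinearMap.range_comp_of_range_eq_top _ (commEquiv k A).range).trans
    (karoubi k A).range_ordEmb

lemma exists_isClassOf_commNeg (f : commBar k A) : ∃ z : uPow k (Obar k A) 0,
    z.1 = HahnSeries.single (0 : ℤ) f.1 ∧ IsClassOf (commNeg k A f) z :=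
  ⟨(karoubi k A).negCycles (commEquiv k A f), rfl, (karoubi k A).diffPow_negCycles _, rfl⟩

lemma commNeg_injective : Function.Injective (commNeg k A) :=
  (karoubi k A).negEmb_injective.comp (commEquiv k A).injective

lemma commOrd_injective : Function.Injective (commOrd k A) :=
  (karoubi k A).ordEmb_injective.comp (commEquiv k A).injective

/-- Comparison of the periodic theories of `A`. -/
def hcPerEquiv : HCper k A ≃ₗ[k] HRper k A := (karoubi k A).perEquiv

lemma hcPerEquiv_uPer (x : HCper k A) :
    hcPerEquiv k A (uPer _ _ x) = uPer _ _ (hcPerEquiv k A x) :=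
  mapPer_uPer (karoubi k A).E_b (karoubi k A).E_B x

lemma map_hcPerEquiv (n : ℤ) :
    (partPer _ _ (totDeg k A n) : Submodule k (HCper k A)).map (hcPerEquiv k A).toLinearMap =
      partPer _ _ (totDeg k A n) :=
  (karoubi k A).map_perEquiv n

/-- Comparison of the negative theories of `A`. -/
def hcNegEquiv : HCneg k A ≃ₗ[k] (HRneg k A ⧸ LinearMap.range (commNeg k A)) :=
  (karoubi k A).negEquiv _ (range_commNeg k A)

/-- Comparison of the ordinary theories of `A`. -/
def hcEquiv : HC k A ≃ₗ[k] (HR k A ⧸ LinearMap.range (commOrd k A)) :=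
  (karoubi k A).ordEquiv _ (range_commOrd k A)

lemma hcNegEquiv_uNeg (x : HCneg k A) (y : HRneg k A)
    (h : hcNegEquiv k A x = Submodule.Quotient.mk y) :
    hcNegEquiv k A (uNeg _ _ x) = Submodule.Quotient.mk (uNeg _ _ y) :=
  (karoubi k A).negEquiv_uNeg _ (range_commNeg k A) h

lemma hcEquiv_uOrd (x : HC k A) (y : HR k A) (h : hcEquiv k A x = Submodule.Quotient.mk y) :
    hcEquiv k A (uOrd _ _ x) = Submodule.Quotient.mk (uOrd _ _ y) :=
  (karoubi k A).ordEquiv_uOrd _ (range_commOrd k A) h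

lemma map_hcNegEquiv (n : ℤ) :
    (partNeg _ _ (totDeg k A n) : Submodule k (HCneg k A)).map (hcNegEquiv k A).toLinearMap =
      (partNeg _ _ (totDeg k A n)).map (LinearMap.range (commNeg k A)).mkQ :=
  (karoubi k A).map_negEquiv _ (range_commNeg k A) n

lemma map_hcEquiv (n : ℤ) :
    (partOrd _ _ (totDeg k A n) : Submodule k (HC k A)).map (hcEquiv k A).toLinearMap =
      (partOrd _ _ (totDeg k A n)).map (LinearMap.range (commOrd k A)).mkQ :=
  (karoubi k A).map_ordEquiv _ (range_commOrd k A) n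

section Sections

variable [SplitUnit k A] {s : Obar k A → Obar k A}
  (hs : ∀ ω ∈ LinearMap.range (dBar k A), dBar k A (s ω) = ω)
include hs

lemma commOrd_section (f : commBar k A) : f.1 ∈ LinearMap.range (dBar k A) ∧
    (∀ j : ℕ, iBar k A ((s ∘ iBar k A)^[j] (s f)) ∈ LinearMap.range (dBar k A)) ∧
    (∀ N : ℕ, (∀ j ≥ N, (s ∘ iBar k A)^[j] (s f) = 0) →
      IsClassOf (commOrd k A f) (Submodule.Quotient.mk
        (∑ j ∈ Finset.range N, HahnSeries.single (-(j : ℤ)) ((s ∘ iBar k A)^[j] (s f))))) := by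
  have hf : f.1 ∈ (karoubi k A).exactAnti := (commEquiv k A f).2
  refine ⟨?_, fun j => (karoubi k A).i_iterate_mem_range (dBar_contrBar_add k A) hs hf j,
    fun N hN => ?_⟩
  · obtain ⟨z, -, hz⟩ := hf
    exact ⟨z, hz⟩
  · exact (karoubi k A).isClassOf_ordEmb (dBar_contrBar_add k A) (contrBar_zero k A)
      (contrBar_mem k A) hs (commEquiv k A f) N hN

lemma iterate_section_mem (hdeg : ∀ (m : ℤ), ∀ ω ∈ LinearMap.range (dBar k A) ⊓ degBar k A (m + 1),
      s ω ∈ degBar k A m)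
    (m : ℤ) (f : Obar k A) (hf : f ∈ commBar k A ⊓ degBar k A (m + 1)) (j : ℕ) :
    (s ∘ iBar k A)^[j] (s f) ∈ degBar k A (m - 2 * j) ∧
      (m < 2 * j → (s ∘ iBar k A)^[j] (s f) = 0) := by
  have hf' : f ∈ (karoubi k A).exactAnti := (commEquiv k A ⟨f, hf.1⟩).2
  have h := (karoubi k A).iterate_mem_degZ (dBar_contrBar_add k A) hs hdeg hf' hf.2 j
  exact ⟨h, fun hj => (karoubi k A).degZ_of_neg (by omega) h⟩

end Sections

section Functoriality

variable {k A} {A' : Type v} [Ring A'] [Algebra k A'] (φ : A →ₐ[k] A')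

lemma hcPerEquiv_map (x : HCper k A) :
    hcPerEquiv k A' (HCper.map φ x) = HRper.map φ (hcPerEquiv k A x) :=
  KaroubiModule.perEquiv_map (K := karoubi k A) (K' := karoubi k A') (obarMap_kappaBar φ)
    (obarMap_bBar φ) (obarMap_connesBBar φ) (obarMap_iBar φ) (obarMap_dBar φ)
    (obarMap_scaleBar φ _) x

lemma hcNegEquiv_map (x : HCneg k A) (y : HRneg k A)
    (h : hcNegEquiv k A x = Submodule.Quotient.mk y) :
    hcNegEquiv k A' (HCneg.map φ x) = Submodule.Quotient.mk (HRneg.map φ y) :=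
  KaroubiModule.negEquiv_map (K := karoubi k A) (K' := karoubi k A') (obarMap_kappaBar φ)
    (obarMap_bBar φ) (obarMap_connesBBar φ) (obarMap_iBar φ) (obarMap_dBar φ)
    (obarMap_scaleBar φ _) h

lemma hcEquiv_map (x : HC k A) (y : HR k A)
    (h : hcEquiv k A x = Submodule.Quotient.mk y) :
    hcEquiv k A' (HC.map φ x) = Submodule.Quotient.mk (HR.map φ y) :=
  KaroubiModule.ordEquiv_map (K := karoubi k A) (K' := karoubi k A') (obarMap_kappaBar φ)
    (obarMap_bBar φ) (obarMap_connesBBar φ) (obarMap_iBar φ) (obarMap_dBar φ)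
    (obarMap_scaleBar φ _) h

lemma commOrd_map (f : commBar k A) (f' : commBar k A') (h : f'.1 = obarMap φ f.1) :
    commOrd k A' f' = HR.map φ (commOrd k A f) :=
  KaroubiModule.ordEmb_map (K := karoubi k A) (K' := karoubi k A') (obarMap_kappaBar φ)
    (obarMap_bBar φ) (obarMap_iBar φ) (obarMap_dBar φ) h

end Functoriality

end Embeddings

end NCForms

end

/-! ### Assembly of the theorem -/

theorem theoremt (k : Type u) [CommRing k] [Algebra ℚ k] :
    -- the operators are differentials that anticommute
    (∀ (A : Type v) [Ring A] [Algebra k A] [NCForms.SplitUnit k A],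
      NCForms.bBar k A ∘ₗ NCForms.bBar k A = 0 ∧
      NCForms.connesBBar k A ∘ₗ NCForms.connesBBar k A = 0 ∧
      NCForms.bBar k A ∘ₗ NCForms.connesBBar k A +
        NCForms.connesBBar k A ∘ₗ NCForms.bBar k A = 0 ∧
      NCForms.iBar k A ∘ₗ NCForms.iBar k A = 0 ∧
      NCForms.dBar k A ∘ₗ NCForms.dBar k A = 0 ∧
      NCForms.iBar k A ∘ₗ NCForms.dBar k A + NCForms.dBar k A ∘ₗ NCForms.iBar k A = 0) ∧
    -- periodic cyclic homology
    (∃ e : ∀ (A : Type v) [Ring A] [Algebra k A] [NCForms.SplitUnit k A],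
        NCForms.HCper k A ≃ₗ[k] NCForms.HRper k A,
      (∀ (A : Type v) [Ring A] [Algebra k A] [NCForms.SplitUnit k A],
        (∀ x : NCForms.HCper k A, e A (NCForms.uPer _ _ x) = NCForms.uPer _ _ (e A x)) ∧
        (∀ n : ℤ, (NCForms.partPer _ _ (NCForms.totDeg k A n) :
            Submodule k (NCForms.HCper k A)).map (e A).toLinearMap =
          NCForms.partPer _ _ (NCForms.totDeg k A n))) ∧
      (∀ (A A' : Type v) [Ring A] [Algebra k A] [NCForms.SplitUnit k A]
          [Ring A'] [Algebra k A'] [NCForms.SplitUnit k A'] (φ : A →ₐ[k] A')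
          (x : NCForms.HCper k A),
        e A' (NCForms.HCper.map φ x) = NCForms.HRper.map φ (e A x))) ∧
    -- negative cyclic homology
    (∃ (ι : ∀ (A : Type v) [Ring A] [Algebra k A] [NCForms.SplitUnit k A],
        NCForms.commBar k A →ₗ[k] NCForms.HRneg k A)
      (e : ∀ (A : Type v) [Ring A] [Algebra k A] [NCForms.SplitUnit k A],
        NCForms.HCneg k A ≃ₗ[k] (NCForms.HRneg k A ⧸ LinearMap.range (ι A))),
      (∀ (A : Type v) [Ring A] [Algebra k A] [NCForms.SplitUnit k A],
        -- `ι` is the inclusion of `[dΩ, dΩ]` as constant terms in `u`; it is injective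
        (∀ f : NCForms.commBar k A,
          ∃ z : NCForms.uPow k (NCForms.Obar k A) 0,
            z.1 = HahnSeries.single (0 : ℤ) f.1 ∧ NCForms.IsClassOf (ι A f) z) ∧
        Function.Injective (ι A) ∧
        -- its image is the antiharmonic part, with complement the harmonic part
        LinearMap.range (ι A) =
          NCForms.partNeg _ _ (fun _ => NCForms.antiharm k A) ∧
        IsCompl
          (NCForms.partNeg _ _ (fun _ => NCForms.harm k A) : Submodule k (NCForms.HRneg k A))
          (NCForms.partNeg _ _ (fun _ => NCForms.antiharm k A)) ∧
        -- `e` respects multiplication by `u` and the grading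
        (∀ (x : NCForms.HCneg k A) (y : NCForms.HRneg k A),
          e A x = Submodule.Quotient.mk y →
            e A (NCForms.uNeg _ _ x) = Submodule.Quotient.mk (NCForms.uNeg _ _ y)) ∧
        (∀ n : ℤ, (NCForms.partNeg _ _ (NCForms.totDeg k A n) :
            Submodule k (NCForms.HCneg k A)).map (e A).toLinearMap =
          (NCForms.partNeg _ _ (NCForms.totDeg k A n)).map
            (LinearMap.range (ι A)).mkQ)) ∧
      -- `e` is natural
      (∀ (A A' : Type v) [Ring A] [Algebra k A] [NCForms.SplitUnit k A]
          [Ring A'] [Algebra k A'] [NCForms.SplitUnit k A'] (φ : A →ₐ[k] A')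
          (x : NCForms.HCneg k A) (y : NCForms.HRneg k A),
        e A x = Submodule.Quotient.mk y →
          e A' (NCForms.HCneg.map φ x) = Submodule.Quotient.mk (NCForms.HRneg.map φ y))) ∧
    -- ordinary cyclic homology
    (∃ (ι : ∀ (A : Type v) [Ring A] [Algebra k A] [NCForms.SplitUnit k A],
        NCForms.commBar k A →ₗ[k] NCForms.HR k A)
      (e : ∀ (A : Type v) [Ring A] [Algebra k A] [NCForms.SplitUnit k A],
        NCForms.HC k A ≃ₗ[k] (NCForms.HR k A ⧸ LinearMap.range (ι A))),
      (∀ (A : Type v) [Ring A] [Algebra k A] [NCForms.SplitUnit k A],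
        -- `ι f` is the class of `∑ u⁻ʲ (s i)ʲ s f`, for every section `s` of `d` on its image
        (∀ s : NCForms.Obar k A → NCForms.Obar k A,
          (∀ ω ∈ LinearMap.range (NCForms.dBar k A), NCForms.dBar k A (s ω) = ω) →
          (∀ f : NCForms.commBar k A,
            f.1 ∈ LinearMap.range (NCForms.dBar k A) ∧
            (∀ j : ℕ, NCForms.iBar k A ((s ∘ NCForms.iBar k A)^[j] (s f)) ∈
              LinearMap.range (NCForms.dBar k A)) ∧
            (∀ K : ℕ, (∀ j ≥ K, (s ∘ NCForms.iBar k A)^[j] (s f) = 0) →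
              NCForms.IsClassOf (ι A f) (Submodule.Quotient.mk
                (∑ j ∈ Finset.range K, HahnSeries.single (-(j : ℤ))
                  ((s ∘ NCForms.iBar k A)^[j] (s f)))))) ∧
          -- the sum is finite if `s` is homogeneous
          ((∀ (m : ℤ), ∀ ω ∈ LinearMap.range (NCForms.dBar k A) ⊓ NCForms.degBar k A (m + 1),
              s ω ∈ NCForms.degBar k A m) →
            ∀ (m : ℤ), ∀ f ∈ NCForms.commBar k A ⊓ NCForms.degBar k A (m + 1), ∀ j : ℕ,
              (s ∘ NCForms.iBar k A)^[j] (s f) ∈ NCForms.degBar k A (m - 2 * j) ∧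
              (m < 2 * j → (s ∘ NCForms.iBar k A)^[j] (s f) = 0))) ∧
        Function.Injective (ι A) ∧
        -- its image is the antiharmonic part, with complement the harmonic part
        LinearMap.range (ι A) =
          NCForms.partOrd _ _ (fun _ => NCForms.antiharm k A) ∧
        IsCompl
          (NCForms.partOrd _ _ (fun _ => NCForms.harm k A) : Submodule k (NCForms.HR k A))
          (NCForms.partOrd _ _ (fun _ => NCForms.antiharm k A)) ∧
        -- `e` respects multiplication by `u` and the grading
        (∀ (x : NCForms.HC k A) (y : NCForms.HR k A),
          e A x = Submodule.Quotient.mk y →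
            e A (NCForms.uOrd _ _ x) = Submodule.Quotient.mk (NCForms.uOrd _ _ y)) ∧
        (∀ n : ℤ, (NCForms.partOrd _ _ (NCForms.totDeg k A n) :
            Submodule k (NCForms.HC k A)).map (e A).toLinearMap =
          (NCForms.partOrd _ _ (NCForms.totDeg k A n)).map
            (LinearMap.range (ι A)).mkQ)) ∧
      -- `ι` and `e` are natural
      (∀ (A A' : Type v) [Ring A] [Algebra k A] [NCForms.SplitUnit k A]
          [Ring A'] [Algebra k A'] [NCForms.SplitUnit k A'] (φ : A →ₐ[k] A'),
        (∀ (f : NCForms.commBar k A) (f' : NCForms.commBar k A'),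
          f'.1 = NCForms.obarMap φ f.1 → ι A' f' = NCForms.HR.map φ (ι A f)) ∧
        (∀ (x : NCForms.HC k A) (y : NCForms.HR k A),
          e A x = Submodule.Quotient.mk y →
            e A' (NCForms.HC.map φ x) = Submodule.Quotient.mk (NCForms.HR.map φ y)))) := by
  refine ⟨fun A _ _ _ => ?_, ⟨fun A _ _ _ => NCForms.hcPerEquiv k A,
    fun A _ _ _ => ⟨NCForms.hcPerEquiv_uPer k A, NCForms.map_hcPerEquiv k A⟩,
    fun A A' _ _ _ _ _ _ φ => NCForms.hcPerEquiv_map φ⟩,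
    ⟨fun A _ _ _ => NCForms.commNeg k A, fun A _ _ _ => NCForms.hcNegEquiv k A,
      fun A _ _ _ => ?_, fun A A' _ _ _ _ _ _ φ => NCForms.hcNegEquiv_map φ⟩,
    ⟨fun A _ _ _ => NCForms.commOrd k A, fun A _ _ _ => NCForms.hcEquiv k A,
      fun A _ _ _ => ?_,
      fun A A' _ _ _ _ _ _ φ => ⟨NCForms.commOrd_map φ, NCForms.hcEquiv_map φ⟩⟩⟩
  · exact ⟨LinearMap.ext (NCForms.karoubi k A).bb, LinearMap.ext (NCForms.karoubi k A).B_B,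
      LinearMap.ext (NCForms.karoubi k A).b_B, LinearMap.ext (NCForms.karoubi k A).i_i,
      LinearMap.ext (NCForms.karoubi k A).dd, LinearMap.ext (NCForms.karoubi k A).i_d⟩
  · exact ⟨NCForms.exists_isClassOf_commNeg k A, NCForms.commNeg_injective k A,
      NCForms.range_commNeg k A, (NCForms.karoubi k A).isCompl_neg,
      NCForms.hcNegEquiv_uNeg k A, NCForms.map_hcNegEquiv k A⟩
  · exact ⟨fun s hs => ⟨NCForms.commOrd_section k A hs, NCForms.iterate_section_mem k A hs⟩,
      NCForms.commOrd_injective k A, NCForms.range_commOrd k A, (NCForms.karoubi k A).isCompl_ord,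
      NCForms.hcEquiv_uOrd k A, NCForms.map_hcEquiv k A⟩
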